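/- \textbf{Setting.} For $f:[0,1]\to\mathbb R$ and $p\ge 1$ let $V_p(f)=\sup\sum_i|f(t_{i+1})-f(t_i)|^p\in[0,\infty]$, the supremum being over all subdivisions $(t_i)$ of $[0,1]$, and let $\mathcal V(f)=\inf\{p\ge1: V_p(f)<\infty\}\in[1,\infty]$ (with $\inf\varnothing=\infty$ and $1/\infty=0$). \emph{Tree of a continuous path.} If $\omega:[0,1]\to\mathbb R$ is continuous, then $\delta(s,t)=\omega(s)+\omega(t)-2\inf_{[s,t]}\omega$ is a semi-distance on $[0,1]$; let $\mathbb T=[0,1]/\delta$ be the quotient metric space (a compact real tree) and $\pi:[0,1]\to\mathbb T$ the projection. Put $O=\pi(U)$ for any $U$ at which $\omega$ is minimal, $A=\pi(0)$, $B=\pi(1)$, and for $\tau\in\mathbb T$ put $\tau^\nearrow=\inf\pi^{-1}(\tau)$, $\tau^\nwarrow=\sup\pi^{-1}(\tau)$. \emph{Tree of a c\`adl\`ag path.} If $\omega$ is c\`adl\`ag, let $\mathbb G$ be the set of $(t,x)$ with $t\in[0,1]$ and $x$ between $\omega(t-)$ and $\omega(t)$ (where $\omega(0-)=\omega(0)$),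 with the semi-distance $\delta((t,x),(t,x'))=|x-x'|$ and $\delta((s,x),(t,x'))=x+x'-2\bigl(\inf_{(s,t)}\omega\wedge x\wedge x'\bigr)$ for $s<t$; let $\mathbb T=\mathbb G/\delta$ with projection $\pi$, let $O=\pi(z)$ for any $z\in\mathbb G$ whose second component is minimal, $A=\pi(0,\omega(0))$, $B=\pi(1,\omega(1))$, and let $\tau^\nearrow,\tau^\nwarrow$ be the infimum and the supremum of the time components of the points of $\pi^{-1}(\tau)$. In both cases $[\sigma,\tau]$ denotes the arc between $\sigma,\tau\in\mathbb T$, the skeleton $S$ is the set of $\tau$ that lie in $[O,\sigma]$ for some $\sigma\neq\tau$, and the length measure $\lambda$ is the unique Borel measure on $\mathbb T$ with $\lambda(\mathbb T\setminus S)=0$ and $\lambda([\sigma,\tau])=\delta(\sigma,\tau)$ for all $\sigma,\tau$ (it is the one-dimensional Hausdorff measure restricted to $S$). For $\rho:[0,1]\to\mathbb R$ we use the convention that $\rho(\tau^\nearrow)$ is replaced by $0$ if $\tau\in[O,A]\setminus\{O\}$ and $\rho(\tau^\nwarrow)$ is replaced by $0$ if $\tau\in[O,B]\setminus\{O\}$.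 (No replacement occurs if $\omega(0)=\omega(1)=\inf\omega$; in general this amounts to extending $\omega$ to $[-1,2]$, nondecreasing on $[-1,0]$ and nonincreasing on $[1,2]$ with value $\inf\omega$ at $-1$ and $2$, and $\rho$ by $0$.) When $\rho(\tau^\nearrow)-\rho(\tau^\nwarrow)$ is $\lambda$-integrable, put $$\int_0^1\rho\,d\omega:=\int_{\mathbb T}\bigl(\rho(\tau^\nearrow)-\rho(\tau^\nwarrow)\bigr)\lambda(d\tau),\qquad \int_s^t\rho\,d\omega:=\int_0^1\rho 1_{(s,t]}\,d\omega .$$ \textbf{Theorem.} Let $p,q\ge1$ with $1/p+1/q>1$. There is a constant $C=C(p,q)<\infty$ such that the following holds for all $\omega,\rho:[0,1]\to\mathbb R$ such that either $\omega$ is continuous, or $\omega$ is c\`adl\`ag and $\rho$ is continuous at every time of discontinuity of $\omega$. (Products in $[0,\infty]$ use $0\cdot\infty=0$.) (1) The measure $\lambda$ exists and is unique, and $$\int_{\mathbb T}|\rho(\tau^\nearrow)-\rho(\tau^\nwarrow)|\,\lambda(d\tau)\le C\,V_p(\omega)^{1/p}\bigl(V_q(\rho)^{1/q}+\sup|\rho|\bigr).$$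 (2) If $1/\mathcal V(\omega)+1/\mathcal V(\rho)>1$, then $\rho(\tau^\nearrow)-\rho(\tau^\nwarrow)$ is $\lambda$-integrable, so that $\int_0^1\rho\,d\omega$ exists, and $$\Bigl|\int_0^1\rho\,d\omega\Bigr|\le C\,V_p(\omega)^{1/p}\bigl(V_q(\rho)^{1/q}+\sup|\rho|\bigr).$$ Moreover $\int_0^1\rho\,d\omega$ is Young's Riemann--Stieltjes integral, that is $$\int_0^1\rho\,d\omega=\lim\sum_i\rho(s_i)\bigl(\omega(t_{i+1})-\omega(t_i)\bigr),\qquad t_i\le s_i\le t_{i+1},$$ as the mesh of the subdivision $(t_i)$ of $[0,1]$ tends to $0$. For all $s\le t$ in $[0,1]$ the integral $\int_s^t\rho\,d\omega$ exists in the same sense; these integrals satisfy the Chasles relation $\int_s^t\rho\,d\omega+\int_t^u\rho\,d\omega=\int_s^u\rho\,d\omega$ for $s\le t\le u$, the one with $s=0$, $t=1$ is equal to $\int_0^1\rho\,d\omega$ defined by the first formula, and $$V_p\Bigl(\int_0^{\cdot}\rho\,d\omega\Bigr)^{1/p}\le C\,V_p(\omega)^{1/p}\bigl(V_q(\rho)^{1/q}+\sup|\rho|\bigr).$$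 -/

import Mathlib

open MeasureTheory Set Filter Topology
open scoped ENNReal NNReal unitInterval

noncomputable section

namespace PathTree

/-! ### Subdivisions, `p`-variation, variation index -/

/-- `0 = t 0 ≤ t 1 ≤ ⋯ ≤ t n = 1` is a subdivision of `[0,1]`
(the values of `t` after `n` play no role: they are all equal to `1`). -/
def IsSubdivision (n : ℕ) (t : ℕ → I) : Prop :=
  Monotone t ∧ t 0 = 0 ∧ t n = 1

/-- The `p`-variation `V_p(f) = sup ∑ |f(t_{i+1}) - f(t_i)| ^ p`, with values in `[0,∞]`. -/
def pVar (p : ℝ) (f : I → ℝ) : ℝ≥0∞ :=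
  ⨆ (n : ℕ) (t : ℕ → I) (_ : IsSubdivision n t),
    ∑ i ∈ Finset.range n, ‖f (t (i + 1)) - f (t i)‖ₑ ^ p

/-- The variation index `inf {p ≥ 1 ; V_p(f) < ∞}`, equal to `∞` if there is no such `p`. -/
def varIndex (f : I → ℝ) : ℝ≥0∞ :=
  ⨅ (p : ℝ) (_ : 1 ≤ p ∧ pVar p f < ∞), ENNReal.ofReal p

/-- `sup |f|`, with values in `[0,∞]`. -/
def supAbs (f : I → ℝ) : ℝ≥0∞ := ⨆ t, ‖f t‖ₑ

/-- `lim ∑ ρ(s_i) (ω(t_{i+1}) - ω(t_i)) = J` for `t_i ≤ s_i ≤ t_{i+1}`, as the mesh of the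
subdivision `(t_i)` of `[0,1]` tends to `0`. -/
def RiemannSumsTendTo (ρ ω : I → ℝ) (J : ℝ) : Prop :=
  ∀ ε > 0, ∃ η > 0, ∀ (n : ℕ) (t s : ℕ → I), IsSubdivision n t →
    (∀ i < n, t i ≤ s i ∧ s i ≤ t (i + 1)) →
    (∀ i < n, (t (i + 1) : ℝ) - t i < η) →
    |∑ i ∈ Finset.range n, ρ (s i) * (ω (t (i + 1)) - ω (t i)) - J| < ε

/-! ### Arcs, skeleton and length measure in a rooted real tree -/

section RealTree

variable {T : Type*} [MetricSpace T]

/-- The points lying metrically between `x` and `y`; in a real tree this is the arc `[x,y]`. -/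
def arc (x y : T) : Set T := {z | dist x z + dist z y = dist x y}

/-- The skeleton of the tree with root `O`: the points having another point above them
(that is, the points which are not leaves). -/
def skeleton (O : T) : Set T := {x | ∃ y, y ≠ x ∧ x ∈ arc O y}

variable [MeasurableSpace T]

/-- The defining property of the length measure: it is supported by the skeleton, and the measure
of an arc is its length. -/
def IsLengthMeasure (O : T) (μ : Measure T) : Prop :=
  μ (skeleton O)ᶜ = 0 ∧ ∀ x y : T, μ (arc x y) = edist x y

/-- The length measure, constructed as the one-dimensional Hausdorff measure restricted to the
skeleton. -/
def lengthMeasure [BorelSpace T] (O : T) : Measure T :=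
  (Measure.hausdorffMeasure 1).restrict (skeleton O)

end RealTree

/-! ### Trees coded by a path -/

/-- The data from which the tree of a path is built: the set `carrier` of points of the (completed)
graph with its semi-distance `δ`, the time component and the level of its points, and
its points at times `0` and `1`. Only the two instances `ofContinuous` and `ofCadlag` are used. -/
structure Coding where
  carrier : Type
  metric : PseudoMetricSpace carrier
  time : carrier → I
  level : carrier → ℝ
  first : carrier
  last : carrier

namespace Coding

instance (D : Coding) : PseudoMetricSpace D.carrier := D.metric

/-- The tree `𝕋`: the quotient metric space associated with the semi-distance `δ`. -/
def Tree (D : Coding) : Type := SeparationQuotient D.carrier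

variable (D : Coding)

instance : MetricSpace D.Tree := inferInstanceAs (MetricSpace (SeparationQuotient D.carrier))

instance : MeasurableSpace D.Tree := borel D.Tree

instance : BorelSpace D.Tree := ⟨rfl⟩

/-- The projection `π`. -/
def proj (z : D.carrier) : D.Tree := SeparationQuotient.mk z

/-- `A = π(0)`. -/
def ptA : D.Tree := D.proj D.first

/-- `B = π(1)`. -/
def ptB : D.Tree := D.proj D.last

/-- The root `O = π(U)`, where `U` is any point at which the level is minimal (two such points
are at `δ`-distance `0`). -/
def root : D.Tree :=
  D.proj (@Classical.epsilon D.carrier ⟨D.first⟩ fun z => ∀ w, D.level z ≤ D.level w)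

/-- The length measure `λ`. -/
def length : Measure D.Tree := lengthMeasure D.root

variable {D}

/-- `τ^↗`, the infimum of the times of the points of `π⁻¹(τ)`. -/
def up (τ : D.Tree) : I := sInf (D.time '' (D.proj ⁻¹' {τ}))

/-- `τ^↖`, the supremum of the times of the points of `π⁻¹(τ)`. -/
def down (τ : D.Tree) : I := sSup (D.time '' (D.proj ⁻¹' {τ}))

open Classical in
/-- `ρ(τ^↗)`, where `ρ` is extended by `0` outside `[0,1]`: if the path is extended to a path
`ω'` on `[-1,2]` which is nondecreasing on `[-1,0]`, nonincreasing on `[1,2]` and satisfies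
`ω'(-1) = ω'(2) = inf ω`, then the points `τ` of the arc `[O,A]` other than `O` are
reached before time `0`. If `π(0) = π(1)` then `A = O` and this is simply `ρ(τ^↗)`. -/
def valUp (ρ : I → ℝ) (τ : D.Tree) : ℝ :=
  if τ ∈ arc D.root D.ptA \ {D.root} then 0 else ρ (up τ)

open Classical in
/-- `ρ(τ^↖)`, where `ρ` is extended by `0` outside `[0,1]`: in the extended path, the points `τ`
of the arc `[O,B]` other than `O` are left after time `1`. -/
def valDown (ρ : I → ℝ) (τ : D.Tree) : ℝ :=
  if τ ∈ arc D.root D.ptB \ {D.root} then 0 else ρ (down τ)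

variable (D)

/-- The integrand `τ ↦ ρ(τ^↗) - ρ(τ^↖)` on the tree. It is equal to `-ρ(τ^↖)` on `[O,A]` and
to `ρ(τ^↗)` on `[O,B]`, except at the root. -/
def increment (ρ : I → ℝ) (τ : D.Tree) : ℝ := valUp ρ τ - valDown ρ τ

/-- The tree integral `∫ ρ dω = ∫_𝕋 (ρ(τ^↗) - ρ(τ^↖)) λ(dτ)`. -/
def integral (ρ : I → ℝ) : ℝ := ∫ τ, D.increment ρ τ ∂D.length

/-- The tree integral `∫_s^t ρ dω`, obtained by replacing `ρ` by `ρ 1_{(s,t]}`. -/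
def integralOn (ρ : I → ℝ) (s t : I) : ℝ := D.integral ((Ioc s t).indicator ρ)

end Coding

/-! ### Continuous paths -/

/-- The semi-distance `δ(s,t) = ω(s) + ω(t) - 2 inf_{[s,t]} ω` of a continuous path. -/
def contDist (ω : C(I, ℝ)) (s t : I) : ℝ :=
  ω s + ω t - 2 * sInf (ω '' uIcc s t)

theorem contBdd (ω : C(I, ℝ)) (S : Set I) : BddBelow (ω '' S) :=
  (isCompact_range ω.continuous).bddBelow.mono (image_subset_range _ _)

theorem contDist_self (ω : C(I, ℝ)) (s : I) : contDist ω s s = 0 := by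
  rw [contDist, uIcc_self, image_singleton, csInf_singleton]; ring

theorem contDist_comm (ω : C(I, ℝ)) (s t : I) : contDist ω s t = contDist ω t s := by
  simp only [contDist, uIcc_comm s t, add_comm (ω s)]

theorem contDist_triangle (ω : C(I, ℝ)) (x y z : I) :
    contDist ω x z ≤ contDist ω x y + contDist ω y z := by
  have h1 : sInf (ω '' uIcc x y) ≤ ω y := csInf_le (contBdd ω _) ⟨y, right_mem_uIcc, rfl⟩
  have h2 : sInf (ω '' uIcc y z) ≤ ω y := csInf_le (contBdd ω _) ⟨y, left_mem_uIcc, rfl⟩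
  have h3 : min (sInf (ω '' uIcc x y)) (sInf (ω '' uIcc y z)) ≤ sInf (ω '' uIcc x z) := by
    refine le_csInf ⟨_, x, left_mem_uIcc, rfl⟩ ?_
    rintro _ ⟨u, hu, rfl⟩
    rcases uIcc_subset_uIcc_union_uIcc (b := y) hu with hu | hu
    · exact min_le_of_left_le (csInf_le (contBdd ω _) ⟨u, hu, rfl⟩)
    · exact min_le_of_right_le (csInf_le (contBdd ω _) ⟨u, hu, rfl⟩)
  unfold contDist
  rcases min_le_iff.1 h3 with h | h <;> linarith

/-- The interval `[0,1]` with the semi-distance `δ` of the continuous path `ω`. -/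
def TimeLine (_ω : C(I, ℝ)) : Type := I

instance (ω : C(I, ℝ)) : PseudoMetricSpace (TimeLine ω) where
  dist := contDist ω
  dist_self := contDist_self ω
  dist_comm := contDist_comm ω
  dist_triangle := contDist_triangle ω

/-- The tree of a continuous path `ω` is `𝕋 = [0,1]/δ`. -/
def ofContinuous (ω : C(I, ℝ)) : Coding where
  carrier := TimeLine ω
  metric := inferInstance
  time := fun t => t
  level := ω
  first := (0 : I)
  last := (1 : I)

/-! ### Càdlàg paths -/

/-- A càdlàg path on `[0,1]`: right-continuous with left limits. -/
structure CadlagPath where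
  toFun : I → ℝ
  right_cont : ∀ t, ContinuousWithinAt toFun (Ici t) t
  left_lim : ∀ t, ∃ l, Tendsto toFun (𝓝[<] t) (𝓝 l)

namespace CadlagPath

instance : CoeFun CadlagPath fun _ => I → ℝ := ⟨CadlagPath.toFun⟩

theorem bddBelow (ω : CadlagPath) (S : Set I) : BddBelow (ω '' S) := by
  have key : BddBelow (ω '' univ) := by
    refine isCompact_univ.induction_on (p := fun s => BddBelow (ω '' s)) (by simp)
      (fun s t hst ht => ht.mono (image_mono hst))
      (fun s t hs ht => by rw [image_union]; exact hs.union ht) ?_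
    intro t _
    obtain ⟨l, hl⟩ := ω.left_lim t
    have e1 : ∀ᶠ u in 𝓝[<] t, min (l - 1) (ω t - 1) ≤ ω u :=
      (hl.eventually (eventually_gt_nhds (sub_one_lt l))).mono
        fun u hu => (min_le_left _ _).trans hu.le
    have e2 : ∀ᶠ u in 𝓝[≥] t, min (l - 1) (ω t - 1) ≤ ω u :=
      ((ω.right_cont t).eventually (eventually_gt_nhds (sub_one_lt (ω t)))).mono
        fun u hu => (min_le_right _ _).trans hu.le
    have e : ∀ᶠ u in 𝓝 t, min (l - 1) (ω t - 1) ≤ ω u := by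
      rw [← nhdsLT_sup_nhdsGE]
      exact eventually_sup.2 ⟨e1, e2⟩
    refine ⟨_, mem_nhdsWithin_of_mem_nhds e, min (l - 1) (ω t - 1), ?_⟩
    rintro _ ⟨u, hu, rfl⟩
    exact hu
  exact key.mono (image_mono (subset_univ _))

/-- The graph `𝔾` of `ω` augmented by the jumps: the points `(t,x)` such that `x` is between
`ω(t-)` and `ω(t)`, with the convention `ω(0-) = ω(0)`. -/
def Graph (ω : CadlagPath) : Type :=
  {z : I × ℝ // z.2 ∈ uIcc (Function.leftLim ω z.1) (ω z.1)}

/-- The semi-distance `δ((t,x),(t,x')) = |x' - x|` and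
`δ((s,x),(t,x')) = x + x' - 2 (inf_{(s,t)} ω ∧ x ∧ x')` for `s ≠ t`, where `(s,t)` is the open
interval between `s` and `t`. -/
def graphDist (ω : CadlagPath) (z w : Graph ω) : ℝ :=
  if z.1.1 = w.1.1 then |w.1.2 - z.1.2|
  else z.1.2 + w.1.2 -
    2 * min (sInf (ω '' Ioo (min z.1.1 w.1.1) (max z.1.1 w.1.1))) (min z.1.2 w.1.2)

/-- The lowest level between two points of the graph. -/
def graphInf (ω : CadlagPath) (z w : Graph ω) : ℝ :=
  if z.1.1 = w.1.1 then min z.1.2 w.1.2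
  else min (sInf (ω '' Ioo (min z.1.1 w.1.1) (max z.1.1 w.1.1))) (min z.1.2 w.1.2)

theorem graphDist_eq (ω : CadlagPath) (z w : Graph ω) :
    graphDist ω z w = z.1.2 + w.1.2 - 2 * graphInf ω z w := by
  unfold graphDist graphInf
  split_ifs
  · rcases le_total z.1.2 w.1.2 with h | h
    · rw [abs_of_nonneg (by linarith), min_eq_left h]; ring
    · rw [abs_of_nonpos (by linarith), min_eq_right h]; ring
  · rfl

theorem graphInf_comm (ω : CadlagPath) (z w : Graph ω) :
    graphInf ω z w = graphInf ω w z := by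
  unfold graphInf
  simp only [eq_comm (a := z.1.1), min_comm z.1.1, max_comm z.1.1, min_comm z.1.2]

theorem graphInf_le_left (ω : CadlagPath) (z w : Graph ω) : graphInf ω z w ≤ z.1.2 := by
  unfold graphInf
  split_ifs
  · exact min_le_left _ _
  · exact (min_le_right _ _).trans (min_le_left _ _)

theorem graphInf_le_right (ω : CadlagPath) (z w : Graph ω) : graphInf ω z w ≤ w.1.2 := by
  rw [graphInf_comm]; exact graphInf_le_left ω w z

theorem graphInf_le_apply (ω : CadlagPath) {z w : Graph ω} {u : I}
    (h1 : z.1.1 < u) (h2 : u < w.1.1) : graphInf ω z w ≤ ω u := by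
  have h := h1.trans h2
  unfold graphInf
  rw [if_neg h.ne, min_eq_left h.le, max_eq_right h.le]
  exact (min_le_left _ _).trans (csInf_le (ω.bddBelow _) ⟨u, ⟨h1, h2⟩, rfl⟩)

theorem graphInf_le_apply_left (ω : CadlagPath) {z w : Graph ω}
    (h : z.1.1 < w.1.1) : graphInf ω z w ≤ ω z.1.1 := by
  have : (𝓝[>] z.1.1).NeBot := nhdsGT_neBot_of_exists_gt ⟨_, h⟩
  have ht : Tendsto ω (𝓝[>] z.1.1) (𝓝 (ω z.1.1)) :=
    (ω.right_cont z.1.1).mono_left (nhdsWithin_mono _ Ioi_subset_Ici_self)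
  refine ge_of_tendsto ht ?_
  filter_upwards [Ioo_mem_nhdsGT h] with u hu
  exact graphInf_le_apply ω hu.1 hu.2

theorem graphInf_min_aux (ω : CadlagPath) {x z : Graph ω} (y : Graph ω)
    (h : x.1.1 < z.1.1) : min (graphInf ω x y) (graphInf ω y z) ≤ graphInf ω x z := by
  have hx : min (graphInf ω x y) (graphInf ω y z) ≤ x.1.2 :=
    (min_le_left _ _).trans (graphInf_le_left ω x y)
  have hz : min (graphInf ω x y) (graphInf ω y z) ≤ z.1.2 :=
    (min_le_right _ _).trans (graphInf_le_right ω y z)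
  conv_rhs => unfold graphInf
  rw [if_neg h.ne, min_eq_left h.le, max_eq_right h.le]
  refine le_min (le_csInf ((nonempty_Ioo.2 h).image _) ?_) (le_min hx hz)
  rintro _ ⟨u, ⟨hu1, hu2⟩, rfl⟩
  rcases lt_trichotomy u y.1.1 with hy | hy | hy
  · exact (min_le_left _ _).trans (graphInf_le_apply ω hu1 hy)
  · subst hy
    exact (min_le_right _ _).trans (graphInf_le_apply_left ω hu2)
  · exact (min_le_right _ _).trans (graphInf_le_apply ω hy hu2)

theorem graphInf_min (ω : CadlagPath) (x y z : Graph ω) :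
    min (graphInf ω x y) (graphInf ω y z) ≤ graphInf ω x z := by
  rcases lt_trichotomy x.1.1 z.1.1 with h | h | h
  · exact graphInf_min_aux ω y h
  · have hx : min (graphInf ω x y) (graphInf ω y z) ≤ x.1.2 :=
      (min_le_left _ _).trans (graphInf_le_left ω x y)
    have hz : min (graphInf ω x y) (graphInf ω y z) ≤ z.1.2 :=
      (min_le_right _ _).trans (graphInf_le_right ω y z)
    conv_rhs => unfold graphInf
    rw [if_pos h]
    exact le_min hx hz
  · rw [graphInf_comm ω x z, graphInf_comm ω x y, graphInf_comm ω y z, min_comm]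
    exact graphInf_min_aux ω y h

instance (ω : CadlagPath) : PseudoMetricSpace (Graph ω) where
  dist := graphDist ω
  dist_self z := by simp [graphDist]
  dist_comm z w := by
    rw [graphDist_eq, graphDist_eq, graphInf_comm, add_comm z.1.2]
  dist_triangle x y z := by
    simp only [graphDist_eq]
    have h1 := graphInf_le_right ω x y
    have h2 := graphInf_le_left ω y z
    rcases min_le_iff.1 (graphInf_min ω x y z) with h | h <;> linarith

end CadlagPath

/-- The tree of a càdlàg path `ω` is `𝕋 = 𝔾/δ`. -/
def ofCadlag (ω : CadlagPath) : Coding where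
  carrier := ω.Graph
  metric := inferInstance
  time := fun z => z.1.1
  level := fun z => z.1.2
  first := ⟨(0, ω 0), right_mem_uIcc⟩
  last := ⟨(1, ω 1), right_mem_uIcc⟩

end PathTree

end

noncomputable section

namespace PathTree

/-! ### Real trees -/

/-! The path is read as the contour of a rooted tree. Away from `[O,A]` and `[O,B]`, a point `τ` is
an excursion of `ω` above a level, and the integrand is the increment of `ρ` between the beginning
and the end of that excursion. Points that are not comparable in the tree have disjoint excursions
(`lst_lt_fst_or`).

The estimate comes from sorting excursions by height. Put `R = V_p(ω)^{1/p}` and `h = R/2^(k+1)`,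
and consider heights in `(h,2h]`. Points in this slice whose levels differ by multiples of `h` form
an antichain. Disjointness then bounds their number by `2^((k+1)p)` and the sum of the `q`-th powers
of their increments by `V_q(ρ)`. Hölder's inequality, followed by integration over the levels modulo
`h` (`setLIntegral_lengthMeasure_le`), bounds the slice by `R r^(k+1) V_q(ρ)^{1/q}` with `r =
2^(p(1-1/q)-1)`. This is summable because `1/p+1/q>1` means `r<1`.

On a window `(s,t]` the same argument uses only the variation of `ω` there. The points which are not
excursions of the window contribute at most `sup|ρ|` on the arc `[π(s),π(t)]`, of length at most
twice the local `V_p^{1/p}`. Superadditivity of the variation then controls the indefinite integral.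

For Riemann sums, the tree integral of `1_{(s,t]}` is `ω(t)-ω(s)`, so a Riemann sum is the tree
integral of `ρ∘φ`, where `φ` is a monotone step function close to the identity. Such a `φ` does not
increase the variation, so the slice bounds are uniform and dominated convergence applies
(`tendsto_integral`).

Continuous and càdlàg paths are treated together through `Coding.Chart`: the graph is parametrized
by a linear continuum on which the level is continuous. This is `[0,1]` itself, or the lexicographic
square, in which each jump is filled in linearly. The filling does not increase the `p`-variation,
since the filled path is an average of one-sided evaluations of `ω`. -/

/-- A metric space satisfying the four point condition and in which any two points are joined by
a metric arc. -/
structure IsRealTree (T : Type*) [MetricSpace T] : Prop where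
  four : ∀ x y z w : T, dist x y + dist z w ≤ max (dist x z + dist y w) (dist x w + dist y z)
  geod : ∀ (x y : T) (a : ℝ), 0 ≤ a → a ≤ dist x y → ∃ z ∈ arc x y, dist x z = a

section RealTree

variable {T : Type*} [MetricSpace T]

theorem mem_arc {x y z : T} : z ∈ arc x y ↔ dist x z + dist z y = dist x y := Iff.rfl

theorem mem_arc_of_le {x y z : T} (h : dist x z + dist z y ≤ dist x y) : z ∈ arc x y :=
  le_antisymm h (dist_triangle _ _ _)

theorem left_mem_arc (x y : T) : x ∈ arc x y := by simp [mem_arc]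

theorem right_mem_arc (x y : T) : y ∈ arc x y := by simp [mem_arc]

theorem arc_comm (x y : T) : arc x y = arc y x := by
  ext z; simp only [mem_arc, dist_comm y z, dist_comm z x, dist_comm y x, add_comm]

theorem arc_self (x : T) : arc x x = {x} := by
  ext z
  rw [mem_arc, dist_self, dist_comm z x, mem_singleton_iff, add_self_eq_zero, dist_eq_zero, eq_comm]

theorem isClosed_arc (x y : T) : IsClosed (arc x y) :=
  isClosed_eq (by fun_prop) (by fun_prop)

theorem arc_trans {O x y z : T} (h : x ∈ arc O y) (h' : y ∈ arc O z) : x ∈ arc O z := by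
  rw [mem_arc] at h h'
  apply mem_arc_of_le
  linarith [dist_triangle x y z]

namespace IsRealTree

variable (hT : IsRealTree T)
include hT

/-- The four point condition gives the upper bound and the triangle inequality the lower one.
Consequently the distance to an endpoint is an isometry from an arc to an interval. -/
theorem dist_of_mem_arc {x y z w : T} (hz : z ∈ arc x y) (hw : w ∈ arc x y) :
    dist z w = |dist x z - dist x w| := by
  have h := hT.four x y z w
  rw [mem_arc] at hz hw
  have h1 := dist_triangle x z w
  have h2 := dist_triangle x w z
  rw [dist_comm w z] at h2
  rw [dist_comm y w, dist_comm y z] at h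
  apply le_antisymm
  · rcases le_max_iff.1 h with h | h
    · exact le_trans (by linarith) (le_abs_self _)
    · exact le_trans (by linarith) (neg_le_abs _)
  · rw [abs_le]; constructor <;> linarith

theorem mem_arc_of_dist_le {O x y z : T} (hx : x ∈ arc O z) (hy : y ∈ arc O z)
    (h : dist O x ≤ dist O y) : x ∈ arc O y := by
  rw [mem_arc, hT.dist_of_mem_arc hx hy, abs_of_nonpos (by linarith)]; ring

theorem mem_arc_or_mem_arc {O x y z : T} (hx : x ∈ arc O z) (hy : y ∈ arc O z) :
    x ∈ arc O y ∨ y ∈ arc O x :=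
  (le_total (dist O x) (dist O y)).imp (hT.mem_arc_of_dist_le hx hy)
    (hT.mem_arc_of_dist_le hy hx)

theorem eq_of_mem_arc {O x y z : T} (hx : x ∈ arc O z) (hy : y ∈ arc O z)
    (h : dist O x = dist O y) : x = y := by
  rw [← dist_eq_zero, hT.dist_of_mem_arc hx hy, h, sub_self, abs_zero]

/-- A point below `b` but not below `a` lies between `a` and `b`. -/
theorem mem_arc_of_not_mem {O a b x : T} (hb : x ∈ arc O b) (ha : x ∉ arc O a) :
    x ∈ arc a b := by
  have h := hT.four O b x a
  have h2 : dist O a < dist O x + dist x a :=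
    lt_of_le_of_ne (dist_triangle _ _ _) fun h => ha h.symm
  rw [mem_arc] at hb
  apply mem_arc_of_le
  rw [dist_comm b x, dist_comm b a] at h
  rw [dist_comm a x]
  rcases le_max_iff.1 h with h | h <;> linarith

theorem mem_arc_or_of_mem_arc (O : T) {x y z : T} (hz : z ∈ arc x y) :
    z ∈ arc O x ∨ z ∈ arc O y := by
  have h := hT.four O z x y
  rw [mem_arc] at hz
  rw [dist_comm x z] at hz
  rcases le_max_iff.1 h with h | h
  · left; apply mem_arc_of_le; linarith
  · right; apply mem_arc_of_le; linarith

/-- The endpoint of an arc can be perturbed without losing the points far from it, which makes a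
dense sequence of endpoints sufficient. -/
theorem mem_arc_of_near {O x y z : T} (hz : z ∈ arc O y) (h : dist y x < dist z y) :
    z ∈ arc O x := by
  have h4 := hT.four O y z x
  rw [mem_arc] at hz
  have h2 := dist_nonneg (x := z) (y := x)
  apply mem_arc_of_le
  rw [dist_comm y z] at h4
  rcases le_max_iff.1 h4 with h4 | h4 <;> linarith

/-- The arc parametrization -/
theorem exists_param (x y : T) : ∃ γ : ℝ → T, LipschitzWith 1 γ ∧ (∀ a, γ a ∈ arc x y) ∧
    (∀ a ∈ Icc 0 (dist x y), dist x (γ a) = a) ∧ ∀ z ∈ arc x y, γ (dist x z) = z := by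
  have hD : (0 : ℝ) ≤ dist x y := dist_nonneg
  choose g hg1 hg2 using fun a : Icc (0 : ℝ) (dist x y) => hT.geod x y a a.2.1 a.2.2
  have key : ∀ a ∈ Icc 0 (dist x y), dist x (g (projIcc 0 _ hD a)) = a := fun a ha => by
    rw [hg2, projIcc_of_mem hD ha]
  -- Clamping the parameter makes `γ` constant outside `[0, dist x y]`, so it is 1-Lipschitz on the
  -- whole line.
  refine ⟨fun a => g (projIcc 0 _ hD a), ?_, fun a => hg1 _, key, fun z hz => ?_⟩
  · refine LipschitzWith.of_dist_le_mul fun a b => ?_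
    rw [hT.dist_of_mem_arc (hg1 _) (hg1 _), hg2, hg2, NNReal.coe_one, one_mul, Real.dist_eq]
    exact abs_projIcc_sub_projIcc hD
  · have hz' : dist x z ∈ Icc 0 (dist x y) :=
      ⟨dist_nonneg, by rw [mem_arc] at hz; linarith [dist_nonneg (x := z) (y := y)]⟩
    exact hT.eq_of_mem_arc (hg1 _) hz (key _ hz')

end IsRealTree

/-- The points having a point at distance more than `c` above them. -/
def above (O : T) (c : ℝ) : Set T := {x | ∃ y, x ∈ arc O y ∧ c < dist x y}

theorem skeleton_eq_above (O : T) : skeleton O = above O 0 := by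
  ext x
  simp only [skeleton, above, mem_ofPred_eq, dist_pos]
  exact exists_congr fun y => ⟨fun h => ⟨h.2, h.1.symm⟩, fun h => ⟨h.2.symm, h.1⟩⟩

theorem above_anti (O : T) {c d : ℝ} (h : c ≤ d) : above O d ⊆ above O c :=
  fun _ ⟨y, hy, hc⟩ => ⟨y, hy, h.trans_lt hc⟩

namespace IsRealTree

variable (hT : IsRealTree T)
include hT

/-- The condition `c < dist x y` is open in `y`, so `y` can be moved to a nearby `u n`. This yields
measurability, and a countable cover of the skeleton by arcs from the root. -/
theorem above_eq_iUnion {u : ℕ → T} (hu : DenseRange u) (O : T) {c : ℝ} (hc : 0 ≤ c) :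
    above O c = ⋃ n, arc O (u n) ∩ {x | c < dist x (u n)} := by
  ext x
  simp only [above, mem_ofPred_eq, mem_iUnion, mem_inter_iff]
  refine ⟨fun ⟨y, hy, hcy⟩ => ?_, fun ⟨n, hn⟩ => ⟨u n, hn⟩⟩
  obtain ⟨n, hn⟩ := hu.exists_dist_lt y (sub_pos.2 hcy)
  refine ⟨n, hT.mem_arc_of_near hy (by linarith), ?_⟩
  have := dist_triangle x (u n) y
  rw [dist_comm (u n) y] at this
  linarith

/-- A point of the arc lies below one of the two ends, hence is not a leaf unless it equals that
end. So restricting to the skeleton removes no length from an arc. -/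
theorem arc_diff_skeleton (O x y : T) : arc x y \ skeleton O ⊆ {x, y} := by
  rintro z ⟨hz, hs⟩
  by_contra! h
  simp only [mem_insert_iff, mem_singleton_iff, not_or] at h
  rcases hT.mem_arc_or_of_mem_arc O hz with h' | h'
  exacts [hs ⟨x, Ne.symm h.1, h'⟩, hs ⟨y, Ne.symm h.2, h'⟩]

variable [MeasurableSpace T] [BorelSpace T]

theorem hausdorffMeasure_arc (x y : T) : Measure.hausdorffMeasure 1 (arc x y) = edist x y := by
  obtain ⟨γ, hγ, h1, h2, h3⟩ := hT.exists_param x y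
  have hi : Isometry (fun z : arc x y => dist x (z : T)) := Isometry.of_dist_eq fun z w => by
    rw [Real.dist_eq, ← hT.dist_of_mem_arc z.2 w.2]; rfl
  have e1 : (fun z : arc x y => dist x (z : T)) '' univ = Icc 0 (dist x y) := by
    ext a
    simp only [mem_image, mem_univ, true_and, Subtype.exists]
    constructor
    · rintro ⟨z, hz, rfl⟩
      exact ⟨dist_nonneg, by rw [mem_arc] at hz; linarith [dist_nonneg (x := z) (y := y)]⟩
    · intro ha
      exact ⟨γ a, h1 a, h2 a ha⟩
  have e2 : (Subtype.val : arc x y → T) '' univ = arc x y := by simp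
  rw [← e2, isometry_subtype_coe.hausdorffMeasure_image (Or.inl zero_le_one),
    ← hi.hausdorffMeasure_image (Or.inl zero_le_one), e1, hausdorffMeasure_real,
    Real.volume_Icc, sub_zero, edist_dist]

variable [SecondCountableTopology T] 

theorem measurableSet_above (O : T) {c : ℝ} (hc : 0 ≤ c) : MeasurableSet (above O c) := by
  have : Nonempty T := ⟨O⟩
  rw [hT.above_eq_iUnion (TopologicalSpace.denseRange_denseSeq T) O hc]
  exact .iUnion fun n => (isClosed_arc _ _ |>.measurableSet).inter
    (isOpen_lt continuous_const (by fun_prop)).measurableSet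

theorem measurableSet_skeleton (O : T) : MeasurableSet (skeleton O) := by
  rw [skeleton_eq_above]; exact hT.measurableSet_above O le_rfl

theorem isLengthMeasure_lengthMeasure (O : T) : IsLengthMeasure O (lengthMeasure O) := by
  refine ⟨by simp [lengthMeasure, (hT.measurableSet_skeleton O).compl], fun x y => ?_⟩
  have h0 : Measure.hausdorffMeasure 1 (arc x y \ skeleton O) = 0 := by
    refine measure_mono_null (hT.arc_diff_skeleton O x y) ?_
    have hz : ∀ z : T, Measure.hausdorffMeasure 1 {z} = 0 := fun z => by
      rw [← arc_self, hT.hausdorffMeasure_arc, edist_self]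
    exact measure_union_null (s := {x}) (t := {y}) (hz x) (hz y)
  rw [lengthMeasure, Measure.restrict_apply ((isClosed_arc x y).measurableSet),
    ← hT.hausdorffMeasure_arc, ← measure_inter_add_sdiff (arc x y) (hT.measurableSet_skeleton O),
    h0, add_zero]

end IsRealTree

/-! ### Uniqueness of the length measure and slicing by levels -/

namespace IsLengthMeasure

variable [MeasurableSpace T] {O : T} {μ : Measure T} (hμ : IsLengthMeasure O μ)
include hμ

theorem measure_singleton (x : T) : μ {x} = 0 := by
  rw [← arc_self, hμ.2, edist_self]

/-- On an arc issued from the root, a length measure is the image of Lebesgue's measure. -/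
theorem restrict_arc [BorelSpace T] (hT : IsRealTree T) {x : T} {γ : ℝ → T} (hγ : LipschitzWith 1 γ)
    (h1 : ∀ a, γ a ∈ arc O x) (h2 : ∀ a ∈ Icc 0 (dist O x), dist O (γ a) = a)
    (h3 : ∀ z ∈ arc O x, γ (dist O z) = z) :
    μ.restrict (arc O x) = (volume.restrict (Icc 0 (dist O x))).map γ := by
  have hg : Measurable fun z : T => dist O z := by fun_prop
  have hγm : Measurable γ := hγ.continuous.measurable
  have hfin : μ (arc O x) < ∞ := by rw [hμ.2]; exact edist_lt_top _ _
  have : IsFiniteMeasure (μ.restrict (arc O x)) := ⟨by simpa using hfin⟩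
  have key : (μ.restrict (arc O x)).map (fun z => dist O z) =
      volume.restrict (Icc 0 (dist O x)) := by
    -- The points of `arc O x` at distance at most `a` from the root form the arc `[O, γ a]`, whose
    -- measure is prescribed; half-lines determine the image measure.
    refine Measure.ext_of_Iic _ _ fun a => ?_
    rw [Measure.map_apply hg measurableSet_Iic, Measure.restrict_apply (hg measurableSet_Iic),
      Measure.restrict_apply measurableSet_Iic]
    rcases lt_or_ge a 0 with ha | ha
    · have e1 : (fun z => dist O z) ⁻¹' Iic a ∩ arc O x = ∅ := by
        ext z; simp only [mem_inter_iff, mem_preimage, mem_Iic, mem_empty_iff_false, iff_false,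
          not_and]
        intro h; linarith [dist_nonneg (x := O) (y := z)]
      have e2 : Iic a ∩ Icc 0 (dist O x) = ∅ := by
        ext z; simp only [mem_inter_iff, mem_Iic, mem_Icc, mem_empty_iff_false, iff_false]
        intro h; linarith [h.1, h.2.1]
      rw [e1, e2]; simp
    · rcases le_total a (dist O x) with ha' | ha'
      · have e1 : (fun z => dist O z) ⁻¹' Iic a ∩ arc O x = arc O (γ a) := by
          ext z
          simp only [mem_inter_iff, mem_preimage, mem_Iic]
          constructor
          · rintro ⟨hz, hz'⟩
            exact hT.mem_arc_of_dist_le hz' (h1 a) (by rwa [h2 a ⟨ha, ha'⟩])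
          · intro hz
            refine ⟨?_, arc_trans hz (h1 a)⟩
            rw [mem_arc, h2 a ⟨ha, ha'⟩] at hz
            linarith [dist_nonneg (x := z) (y := γ a)]
        have e2 : Iic a ∩ Icc 0 (dist O x) = Icc 0 a := by
          ext z; simp only [mem_inter_iff, mem_Iic, mem_Icc]
          exact ⟨fun h => ⟨h.2.1, h.1⟩, fun h => ⟨h.2, h.1, h.2.trans ha'⟩⟩
        rw [e1, e2, hμ.2, edist_dist, h2 a ⟨ha, ha'⟩, Real.volume_Icc, sub_zero]
      · have e1 : (fun z => dist O z) ⁻¹' Iic a ∩ arc O x = arc O x := by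
          refine inter_eq_right.2 fun z hz => ?_
          rw [mem_arc] at hz
          rw [mem_preimage, mem_Iic]; linarith [dist_nonneg (x := z) (y := x)]
        have e2 : Iic a ∩ Icc 0 (dist O x) = Icc 0 (dist O x) :=
          inter_eq_right.2 fun z hz => hz.2.trans ha'
        rw [e1, e2, hμ.2, edist_dist, Real.volume_Icc, sub_zero]
  rw [← key, Measure.map_map hγm hg]
  conv_lhs => rw [← Measure.map_id (μ := μ.restrict (arc O x))]
  refine Measure.map_congr ?_
  filter_upwards [ae_restrict_mem (isClosed_arc O x).measurableSet] with z hz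
  exact (h3 z hz).symm

end IsLengthMeasure

namespace IsRealTree

variable (hT : IsRealTree T)
include hT

variable [MeasurableSpace T] [BorelSpace T] [SecondCountableTopology T] 

/-- The arcs from the root to a dense sequence cover the skeleton, and on each of them a length
measure is the image of Lebesgue measure. -/
theorem isLengthMeasure_iff (O : T) (μ : Measure T) :
    IsLengthMeasure O μ ↔ μ = lengthMeasure O := by
  refine ⟨fun h => ?_, fun h => h ▸ hT.isLengthMeasure_lengthMeasure O⟩
  have h' := hT.isLengthMeasure_lengthMeasure O
  have : Nonempty T := ⟨O⟩
  set u := TopologicalSpace.denseSeq T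
  have hs : skeleton O ⊆ ⋃ n, arc O (u n) := by
    rw [skeleton_eq_above,
      hT.above_eq_iUnion (TopologicalSpace.denseRange_denseSeq T) O le_rfl]
    exact iUnion_mono fun n => inter_subset_left
  have key : μ.restrict (⋃ n, arc O (u n)) = (lengthMeasure O).restrict (⋃ n, arc O (u n)) := by
    refine Measure.restrict_iUnion_congr.2 fun n => ?_
    obtain ⟨γ, hγ, h1, h2, h3⟩ := hT.exists_param O (u n)
    rw [h.restrict_arc hT hγ h1 h2 h3, h'.restrict_arc hT hγ h1 h2 h3]
  have aux : ∀ ν : Measure T, ν (skeleton O)ᶜ = 0 → ν.restrict (⋃ n, arc O (u n)) = ν := by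
    intro ν hν
    refine Measure.restrict_eq_self_of_ae_mem ?_
    exact measure_mono_null (compl_subset_compl.2 hs) hν
  rw [aux _ h.1, aux _ h'.1] at key
  exact key

/-- A bound for the length measure by slicing the tree along its levels. -/
theorem setLIntegral_lengthMeasure_le (O : T) {S : Set T} (hS : MeasurableSet S) {g : T → ℝ≥0∞}
    (hg : Measurable g) {a : ℝ} (ha : 0 < a) {B : ℝ≥0∞}
    (hB : ∀ F : Finset T, (∀ x ∈ F, x ∈ S) →
      (∀ x ∈ F, ∀ y ∈ F, ∃ k : ℤ, dist O x - dist O y = k * a) → ∑ x ∈ F, g x ≤ B) :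
    ∫⁻ x in S, g x ∂lengthMeasure O ≤ ENNReal.ofReal a * B := by
  classical
  have hμ := hT.isLengthMeasure_lengthMeasure O
  have : Nonempty T := ⟨O⟩
  set u := TopologicalSpace.denseSeq T
  have hs : skeleton O ⊆ ⋃ n, arc O (u n) := by
    rw [skeleton_eq_above,
      hT.above_eq_iUnion (TopologicalSpace.denseRange_denseSeq T) O le_rfl]
    exact iUnion_mono fun n => inter_subset_left
  choose γ hγ h1 h2 h3 using fun n => hT.exists_param O (u n)
  -- Disjoint pieces of arcs: on each piece a point is determined by its level.
  set P := disjointed fun n => arc O (u n) with hP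
  have hPm : ∀ n, MeasurableSet (P n) :=
    MeasurableSet.disjointed fun n => (isClosed_arc O (u n)).measurableSet
  have hPa : ∀ n, P n ⊆ arc O (u n) := disjointed_subset _
  have hPd : Pairwise (Function.onFun Disjoint P) := disjoint_disjointed _
  set g' := S.indicator g with hg'
  have hg'm : Measurable g' := hg.indicator hS
  set G : ℕ → ℝ → ℝ≥0∞ := fun n =>
    (Icc 0 (dist O (u n))).indicator fun l => (P n).indicator g' (γ n l) with hG
  have hGm : ∀ n, Measurable (G n) := fun n =>
    ((hg'm.indicator (hPm n)).comp (hγ n).continuous.measurable).indicator measurableSet_Icc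
  have e1 : ∫⁻ x in S, g x ∂lengthMeasure O = ∑' n, ∫⁻ l, G n l := by
    rw [← lintegral_indicator hS, ← Measure.restrict_eq_self_of_ae_mem (μ := lengthMeasure O)
      (s := ⋃ n, P n) (by
        rw [hP, iUnion_disjointed]
        exact measure_mono_null (compl_subset_compl.2 hs) hμ.1),
      lintegral_iUnion hPm hPd]
    congr 1; ext n
    rw [← lintegral_indicator (hPm n), show ∫⁻ l, G n l = _ from
        lintegral_indicator measurableSet_Icc _,
      ← lintegral_map (μ := volume.restrict (Icc 0 (dist O (u n)))) (hg'm.indicator (hPm n))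
        (hγ n).continuous.measurable,
      ← hμ.restrict_arc hT (hγ n) (h1 n) (h2 n) (h3 n),
      ← lintegral_indicator (isClosed_arc O (u n)).measurableSet]
    congr 1; ext x
    by_cases hx : x ∈ P n
    · rw [indicator_of_mem (hPa n hx)]
    · rw [indicator_of_notMem hx]
      by_cases hx' : x ∈ arc O (u n)
      · rw [indicator_of_mem hx', indicator_of_notMem hx]
      · rw [indicator_of_notMem hx']
  -- Levels are folded modulo `a`: the integral over all levels becomes an integral over `l ∈ (0,a]`
  -- of sums over the levels in `l + aℤ`, each bounded by `B`.
  have hfd := isAddFundamentalDomain_Ioc ha 0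
  rw [e1, ← lintegral_tsum fun n => (hGm n).aemeasurable, hfd.lintegral_eq_tsum'',
    ← lintegral_tsum fun z => by
      refine Measurable.aemeasurable ?_
      exact (Measurable.tsum hGm).comp (measurable_const_vadd _)]
  calc _ ≤ ∫⁻ _ in Ioc 0 (0 + a), B := by
        refine lintegral_mono fun l => ?_
        rw [← ENNReal.tsum_prod (f := fun (z : AddSubgroup.zmultiples a) n => G n (z +ᵥ l)),
          ENNReal.tsum_eq_iSup_sum]
        refine iSup_le fun s => ?_
        set s' := s.filter fun i => G i.2 (i.1 +ᵥ l) ≠ 0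
        have hs' : ∀ i ∈ s', (i.1 : ℝ) + l ∈ Icc 0 (dist O (u i.2)) ∧
            γ i.2 (i.1 + l) ∈ P i.2 ∧ G i.2 (i.1 +ᵥ l) = g' (γ i.2 (i.1 + l)) := by
          intro i hi
          have hi := (Finset.mem_filter.1 hi).2
          have hi' : (i.1 +ᵥ l : ℝ) = i.1 + l := rfl
          rw [hi'] at hi ⊢
          have m1 := mem_of_indicator_ne_zero hi
          simp only [hG] at hi ⊢
          rw [indicator_of_mem m1] at hi ⊢
          have m2 := mem_of_indicator_ne_zero hi
          exact ⟨m1, m2, indicator_of_mem m2 _⟩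
        have hlev : ∀ i ∈ s', dist O (γ i.2 (i.1 + l)) = i.1 + l := fun i hi =>
          h2 _ _ (hs' i hi).1
        -- The tree point determines its level, hence the translate, and the disjointness of the
        -- pieces determines the index `n`.
        have hinj : Set.InjOn (fun i : AddSubgroup.zmultiples a × ℕ => γ i.2 (i.1 + l)) s' := by
          intro i hi j hj hij
          simp only at hij
          have hl : (i.1 : ℝ) + l = j.1 + l := by rw [← hlev i hi, hij, hlev j hj]
          refine Prod.ext (Subtype.ext (by linarith)) ?_
          by_contra hne
          exact disjoint_left.1 (hPd hne) (hs' i hi).2.1 (hij ▸ (hs' j hj).2.1)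
        calc _ = ∑ i ∈ s', g' (γ i.2 (i.1 + l)) := by
              rw [← Finset.sum_filter_ne_zero]
              exact Finset.sum_congr rfl fun i hi => (hs' i hi).2.2
          _ = ∑ x ∈ s'.image fun i => γ i.2 (i.1 + l), g' x := by rw [Finset.sum_image hinj]
          _ = ∑ x ∈ (s'.image fun i => γ i.2 (i.1 + l)).filter (· ∈ S), g x := by
              rw [Finset.sum_filter]; rfl
          _ ≤ B := by
              refine hB _ (fun x hx => (Finset.mem_filter.1 hx).2) fun x hx y hy => ?_
              obtain ⟨i, hi, rfl⟩ := Finset.mem_image.1 (Finset.mem_filter.1 hx).1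
              obtain ⟨j, hj, rfl⟩ := Finset.mem_image.1 (Finset.mem_filter.1 hy).1
              rw [hlev i hi, hlev j hj]
              obtain ⟨k, hk⟩ := AddSubgroup.mem_zmultiples_iff.1 (i.1 - j.1).2
              refine ⟨k, ?_⟩
              rw [← zsmul_eq_mul, hk, AddSubgroup.coe_sub]; ring
    _ = ENNReal.ofReal a * B := by simp [mul_comm]

end IsRealTree

end RealTree

end PathTree

end

noncomputable section

namespace PathTree

/-! ### Variation along chains of a linear order -/

/-- The `p`-variation of `g` along the chains of points of `s`. -/
def chainVar {X : Type*} [Preorder X] (p : ℝ) (g : X → ℝ) (s : Set X) : ℝ≥0∞ :=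
  ⨆ c : ℕ × {t : ℕ → X // Monotone t ∧ ∀ i, t i ∈ s},
    ∑ i ∈ Finset.range c.1, ‖g (c.2.1 (i + 1)) - g (c.2.1 i)‖ₑ ^ p

section ChainVar

variable {X Y : Type*} [LinearOrder X] [LinearOrder Y] {p : ℝ} {g : X → ℝ} {s : Set X}

theorem sum_le_chainVar (n : ℕ) {t : ℕ → X} (ht : Monotone t) (hs : ∀ i, t i ∈ s) :
    ∑ i ∈ Finset.range n, ‖g (t (i + 1)) - g (t i)‖ₑ ^ p ≤ chainVar p g s :=
  le_iSup (fun c : ℕ × {t : ℕ → X // Monotone t ∧ ∀ i, t i ∈ s} =>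
    ∑ i ∈ Finset.range c.1, ‖g (c.2.1 (i + 1)) - g (c.2.1 i)‖ₑ ^ p) (n, ⟨t, ht, hs⟩)

theorem chainVar_le {B : ℝ≥0∞} (h : ∀ (n : ℕ) (t : ℕ → X), Monotone t → (∀ i, t i ∈ s) →
    ∑ i ∈ Finset.range n, ‖g (t (i + 1)) - g (t i)‖ₑ ^ p ≤ B) : chainVar p g s ≤ B :=
  iSup_le fun c => h c.1 c.2.1 c.2.2.1 c.2.2.2

theorem chainVar_mono {s' : Set X} (h : s ⊆ s') : chainVar p g s ≤ chainVar p g s' :=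
  chainVar_le fun n _ ht hs => sum_le_chainVar n ht fun i => h (hs i)

theorem chainVar_comp_le {φ : Y → X} (hφ : Monotone φ) {s' : Set Y} (h : MapsTo φ s' s) :
    chainVar p (g ∘ φ) s' ≤ chainVar p g s :=
  chainVar_le fun n _ ht hs => sum_le_chainVar n (hφ.comp ht) fun i => h (hs i)

theorem enorm_rpow_le_chainVar {x y : X} (hxy : x ≤ y) (hx : x ∈ s) (hy : y ∈ s) :
    ‖g y - g x‖ₑ ^ p ≤ chainVar p g s := by
  have h := sum_le_chainVar (p := p) (g := g) (s := s) 1 (t := fun i => if i = 0 then x else y)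
    (by
      refine monotone_nat_of_le_succ fun n => ?_
      by_cases hn : n = 0 <;> simp [hn, hxy])
    (by intro i; split_ifs <;> assumption)
  simpa using h

/-- A chain of `s` is followed by a chain of `s'`; the increment at the junction is nonnegative and
is dropped. A set without chains has variation `0`, as an empty supremum. -/
theorem chainVar_add_le {s' : Set X} (h : ∀ x ∈ s, ∀ y ∈ s', x ≤ y) :
    chainVar p g s + chainVar p g s' ≤ chainVar p g (s ∪ s') := by
  by_cases h1 : Nonempty {t : ℕ → X // Monotone t ∧ ∀ i, t i ∈ s}
  swap
  · have : chainVar p g s ≤ 0 := chainVar_le fun n t ht hs => (h1 ⟨⟨t, ht, hs⟩⟩).elim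
    rw [nonpos_iff_eq_zero.1 this, zero_add]
    exact chainVar_mono subset_union_right
  by_cases h2 : Nonempty {t : ℕ → X // Monotone t ∧ ∀ i, t i ∈ s'}
  swap
  · have : chainVar p g s' ≤ 0 := chainVar_le fun n t ht hs => (h2 ⟨⟨t, ht, hs⟩⟩).elim
    rw [nonpos_iff_eq_zero.1 this, add_zero]
    exact chainVar_mono subset_union_left
  refine ENNReal.iSup_add_iSup_le ?_
  rintro ⟨n, t, ht, hs⟩ ⟨m, t', ht', hs'⟩
  -- The first chain uses the `n + 1` points `t 0, …, t n`, so the second starts at index `n + 1`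
  -- and the term of index `n` is the junction.
  set w : ℕ → X := fun i => if i ≤ n then t i else t' (i - (n + 1)) with hw
  have hw1 : ∀ i ≤ n, w i = t i := fun i hi => if_pos hi
  have hw2 : ∀ i, w (n + 1 + i) = t' i := fun i => by
    rw [hw]; dsimp only; rw [if_neg (by omega), Nat.add_sub_cancel_left]
  have hwm : Monotone w := by
    refine monotone_nat_of_le_succ fun i => ?_
    rcases lt_trichotomy i n with hi | rfl | hi
    · rw [hw1 i hi.le, hw1 (i + 1) hi]; exact ht (Nat.le_succ i)
    · rw [hw1 i le_rfl, show i + 1 = i + 1 + 0 from rfl, hw2]; exact h _ (hs _) _ (hs' _)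
    · obtain ⟨k, rfl⟩ := Nat.exists_eq_add_of_le (Nat.succ_le_of_lt hi)
      rw [Nat.succ_eq_add_one, hw2, add_assoc (n + 1), hw2]; exact ht' (Nat.le_succ k)
  have hws : ∀ i, w i ∈ s ∪ s' := fun i => by
    rw [hw]; dsimp only; split_ifs
    exacts [Or.inl (hs _), Or.inr (hs' _)]
  refine le_trans ?_ (sum_le_chainVar (n + 1 + m) hwm hws)
  rw [Finset.sum_range_add _ (n + 1) m, Finset.sum_range_succ]
  refine add_le_add ((Finset.sum_congr rfl fun i hi => ?_).le.trans le_self_add)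
    (Finset.sum_congr rfl fun i _ => ?_).le
  · rw [Finset.mem_range] at hi
    rw [hw1 i hi.le, hw1 (i + 1) hi]
  · rw [add_assoc (n + 1), hw2, hw2]

theorem chainVar_Icc_add_le {x y z : X} (hxy : x ≤ y) (hyz : y ≤ z) :
    chainVar p g (Icc x y) + chainVar p g (Icc y z) ≤ chainVar p g (Icc x z) := by
  refine (chainVar_add_le fun a ha b hb => ha.2.trans hb.1).trans (chainVar_mono ?_)
  rw [Icc_union_Icc_eq_Icc hxy hyz]

theorem sum_chainVar_Icc_le {e : ℕ → X} (he : Monotone e) (n : ℕ) :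
    ∑ i ∈ Finset.range n, chainVar p g (Icc (e i) (e (i + 1))) ≤
      chainVar p g (Icc (e 0) (e n)) := by
  induction n with
  | zero => simp
  | succ n ih =>
    rw [Finset.sum_range_succ]
    exact (add_le_add_left ih _).trans
      (chainVar_Icc_add_le (he (Nat.zero_le n)) (he (Nat.le_succ n)))

/-- The variation along a family of intervals which are pairwise disjoint. -/
theorem sum_le_chainVar_of_disjoint {ι : Type*} (F : Finset ι) {a b : ι → X} {x y : X}
    (ha : ∀ i ∈ F, x ≤ a i) (hab : ∀ i ∈ F, a i ≤ b i) (hb : ∀ i ∈ F, b i ≤ y)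
    (hd : ∀ i ∈ F, ∀ j ∈ F, i ≠ j → b i < a j ∨ b j < a i) :
    ∑ i ∈ F, ‖g (b i) - g (a i)‖ₑ ^ p ≤ chainVar p g (Icc x y) := by
  classical
  induction F using Finset.strongInduction generalizing y with
  | H F ih =>
    rcases F.eq_empty_or_nonempty with rfl | hF
    · simp
    -- Remove the rightmost interval: by disjointness all the others end before `a i`.
    obtain ⟨i, hi, hmax⟩ := F.exists_max_image a hF
    rw [← Finset.sum_erase_add _ _ hi]
    have hsub := Finset.erase_subset i F
    have h1 := ih (F.erase i) (Finset.erase_ssubset hi) (y := a i)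
      (fun j hj => ha j (hsub hj)) (fun j hj => hab j (hsub hj))
      (fun j hj => by
        obtain ⟨hne, hj⟩ := Finset.mem_erase.1 hj
        rcases hd i hi j hj hne.symm with h | h
        · exact absurd ((hmax j hj).trans (hab i hi)) (not_le.2 h)
        · exact h.le)
      (fun j hj k hk => hd j (hsub hj) k (hsub hk))
    refine (add_le_add h1 (enorm_rpow_le_chainVar (s := Icc (a i) y) (hab i hi)
      ⟨le_rfl, (hab i hi).trans (hb i hi)⟩ ⟨hab i hi, hb i hi⟩)).trans ?_
    exact chainVar_Icc_add_le (ha i hi) ((hab i hi).trans (hb i hi))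

end ChainVar

theorem pVar_le_chainVar {p : ℝ} {f : I → ℝ} : pVar p f ≤ chainVar p f univ :=
  iSup_le fun n => iSup_le fun _ => iSup_le fun ht => sum_le_chainVar n ht.1 fun _ => mem_univ _

theorem chainVar_le_pVar {p : ℝ} {f : I → ℝ} {s : Set I} : chainVar p f s ≤ pVar p f := by
  refine chainVar_le fun n t ht _ => ?_
  -- The chain is completed by the endpoints `0` and `1`, which adds two increments.
  set w : ℕ → I := fun i => if i = 0 then 0 else if i ≤ n + 1 then t (i - 1) else 1 with hw
  have hw1 : ∀ i ≤ n, w (i + 1) = t i := fun i hi => by simp [hw, hi]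
  have hsub : IsSubdivision (n + 2) w := by
    refine ⟨monotone_nat_of_le_succ fun i => ?_, by simp [hw], by simp [hw]⟩
    rcases Nat.eq_zero_or_pos i with rfl | hi
    · exact unitInterval.nonneg'
    · simp only [hw, hi.ne', if_false, Nat.succ_ne_zero]
      split_ifs
      · exact ht (by omega)
      · exact unitInterval.le_one'
      · omega
      · exact le_rfl
  refine le_trans ?_ (le_iSup_of_le (n + 2) (le_iSup_of_le w (le_iSup_of_le hsub le_rfl)))
  rw [Finset.sum_range_succ, Finset.sum_range_succ']
  refine le_trans (Finset.sum_congr rfl fun i hi => ?_).le (le_self_add.trans le_self_add)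
  rw [Finset.mem_range] at hi
  rw [hw1 i hi.le, hw1 (i + 1) hi]

/-- Take for `v t` the `q`-variation of `ρ` on `[0,t]` and use superadditivity. A discontinuity of
`ρ` is then one of the monotone function `v`. -/
theorem exists_monotone_control {q : ℝ} (hq : 1 ≤ q) {ρ : I → ℝ} (h : pVar q ρ < ∞) :
    ∃ v : I → ℝ, Monotone v ∧ ∀ s t, |ρ t - ρ s| ^ q ≤ |v t - v s| := by
  have hfin : ∀ t : I, chainVar q ρ (Icc 0 t) ≠ ∞ := fun t => (chainVar_le_pVar.trans_lt h).ne
  have key : ∀ s t : I, s ≤ t → |ρ t - ρ s| ^ q ≤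
      (chainVar q ρ (Icc 0 t)).toReal - (chainVar q ρ (Icc 0 s)).toReal := by
    intro s t hst
    have h1 := (add_le_add_right (enorm_rpow_le_chainVar (p := q) (g := ρ) hst
      (left_mem_Icc.2 hst) (right_mem_Icc.2 hst)) _).trans
      (chainVar_Icc_add_le (p := q) (g := ρ) (unitInterval.nonneg' (t := s)) hst)
    have h2 := ENNReal.toReal_mono (hfin t) h1
    rw [ENNReal.toReal_add (hfin s) (ENNReal.rpow_ne_top_of_nonneg (by linarith) (by simp)),
      ← ENNReal.toReal_rpow, toReal_enorm, Real.norm_eq_abs] at h2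
    linarith
  refine ⟨fun t => (chainVar q ρ (Icc 0 t)).toReal, fun s t hst => ?_, fun s t => ?_⟩
  · have := key s t hst
    have h0 : 0 ≤ |ρ t - ρ s| ^ q := by positivity
    dsimp only; linarith
  · rcases le_total s t with hst | hst
    · exact (key s t hst).trans (le_abs_self _)
    · rw [abs_sub_comm]; exact (key t s hst).trans (by rw [abs_sub_comm]; exact le_abs_self _)

/-- A function of finite `q`-variation has at most countably many discontinuities. -/
theorem countable_not_continuousAt {q : ℝ} (hq : 1 ≤ q) {ρ : I → ℝ} (h : pVar q ρ < ∞) :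
    {t | ¬ ContinuousAt ρ t}.Countable := by
  obtain ⟨v, hv, hρ⟩ := exists_monotone_control hq h
  refine hv.countable_not_continuousAt.mono fun t ht => ?_
  refine mt (fun hc : ContinuousAt v t => ?_) ht
  have h1 : Tendsto (fun s => |v s - v t| ^ (1 / q)) (𝓝 t) (𝓝 0) := by
    have h2 : Tendsto (fun s => |v s - v t|) (𝓝 t) (𝓝 0) := by
      have := (hc.tendsto.sub_const (v t)).abs
      simpa using this
    have := h2.rpow_const (p := 1 / q) (Or.inr (by positivity))
    rwa [Real.zero_rpow (by positivity)] at this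
  rw [ContinuousAt, tendsto_iff_dist_tendsto_zero]
  refine squeeze_zero (fun _ => dist_nonneg) (fun s => ?_) h1
  rw [Real.dist_eq, one_div, Real.le_rpow_inv_iff_of_pos (abs_nonneg _) (abs_nonneg _) (by linarith)]
  exact hρ t s

/-- The preimage of an open set differs from its interior only by points of discontinuity. -/
theorem measurable_of_countable_not_continuousAt {ρ : I → ℝ}
    (h : {t | ¬ ContinuousAt ρ t}.Countable) : Measurable ρ := by
  refine measurable_of_isOpen fun U hU => ?_
  have : ρ ⁻¹' U = interior (ρ ⁻¹' U) ∪ (ρ ⁻¹' U ∩ {t | ¬ ContinuousAt ρ t}) := by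
    ext t
    constructor
    · intro ht
      by_cases hc : ContinuousAt ρ t
      · exact Or.inl (mem_interior_iff_mem_nhds.2 (hc (hU.mem_nhds ht)))
      · exact Or.inr ⟨ht, hc⟩
    · rintro (ht | ht)
      exacts [interior_subset ht, ht.1]
  rw [this]
  exact isOpen_interior.measurableSet.union (h.mono inter_subset_right).measurableSet

end PathTree

end

noncomputable section

namespace PathTree

/-! ### Charts of a coding -/

/-- A parametrization of the graph of a path by a linear continuum `X` on which the level is
continuous; `lastAt s` is the last point of `X` at time `s`. -/
structure Coding.Chart (D : Coding) (ω : I → ℝ) (X : Type*) [ConditionallyCompleteLinearOrder X]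
    [BoundedOrder X] [TopologicalSpace X] where
  pt : X → D.carrier
  lastAt : I → X
  surj : Function.Surjective pt
  cont : Continuous fun x => D.level (pt x)
  dist_eq : ∀ x y, x ≤ y → dist (pt x) (pt y) =
    D.level (pt x) + D.level (pt y) - 2 * sInf ((fun z => D.level (pt z)) '' Icc x y)
  time_mono : Monotone fun x => D.time (pt x)
  time_le_iff : ∀ x s, D.time (pt x) ≤ s ↔ x ≤ lastAt s
  time_lastAt : ∀ s, D.time (pt (lastAt s)) = s
  level_lastAt : ∀ s, D.level (pt (lastAt s)) = ω s
  pt_of_le : ∀ x ≤ lastAt 0, pt x = D.first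
  pt_top : pt ⊤ = D.last
  chainVar_le : ∀ p, 1 ≤ p → chainVar p (fun x => D.level (pt x)) univ ≤ pVar p ω

namespace Coding.Chart

variable {D : Coding} {ω : I → ℝ} {X : Type*} [ConditionallyCompleteLinearOrder X]
  [BoundedOrder X] [TopologicalSpace X] (K : D.Chart ω X)

/-- The level on `X`. -/
def lev (x : X) : ℝ := D.level (K.pt x)

/-- The projection of `X` on the tree. -/
def toTree (x : X) : D.Tree := D.proj (K.pt x)

/-- The time on `X`. -/
def tm (x : X) : I := D.time (K.pt x)

/-- The lowest level between two points. -/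
def low (x y : X) : ℝ := sInf (K.lev '' uIcc x y)

theorem continuous_lev : Continuous K.lev := K.cont

theorem toTree_surjective : Function.Surjective K.toTree := fun τ => by
  obtain ⟨z, rfl⟩ := SeparationQuotient.surjective_mk τ
  obtain ⟨x, rfl⟩ := K.surj z
  exact ⟨x, rfl⟩

theorem tm_mono : Monotone K.tm := K.time_mono

theorem low_comm (x y : X) : K.low x y = K.low y x := by rw [low, low, uIcc_comm]

theorem dist_toTree (x y : X) :
    dist (K.toTree x) (K.toTree y) = K.lev x + K.lev y - 2 * K.low x y := by
  have key : ∀ x y, x ≤ y →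
      dist (K.toTree x) (K.toTree y) = K.lev x + K.lev y - 2 * K.low x y := fun x y h => by
    rw [low, uIcc_of_le h]; exact K.dist_eq x y h
  rcases le_total x y with h | h
  · exact key x y h
  · rw [dist_comm, key y x h, low_comm]; ring

theorem toTree_of_le {x : X} (h : x ≤ K.lastAt 0) : K.toTree x = D.ptA :=
  congrArg D.proj (K.pt_of_le _ h)

theorem toTree_bot : K.toTree ⊥ = D.ptA := K.toTree_of_le bot_le

theorem toTree_top : K.toTree ⊤ = D.ptB := congrArg D.proj K.pt_top

theorem lastAt_mono : Monotone K.lastAt := fun s _ hst =>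
  (K.time_le_iff _ _).1 ((K.time_lastAt s).le.trans hst)

variable [OrderTopology X]

theorem exists_lev_eq_low (x y : X) : ∃ z ∈ uIcc x y, K.lev z = K.low x y :=
  (isCompact_uIcc.image K.continuous_lev).sInf_mem (nonempty_uIcc.image _)

theorem low_le {x y z : X} (h : z ∈ uIcc x y) : K.low x y ≤ K.lev z :=
  csInf_le (isCompact_uIcc.image K.continuous_lev).bddBelow ⟨z, h, rfl⟩

theorem le_low {x y : X} {c : ℝ} (h : ∀ z ∈ uIcc x y, c ≤ K.lev z) : c ≤ K.low x y := by
  obtain ⟨z, hz, h'⟩ := K.exists_lev_eq_low x y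
  exact h' ▸ h z hz

theorem min_low_le (x y z : X) : min (K.low x y) (K.low y z) ≤ K.low x z := by
  refine K.le_low fun u hu => ?_
  rcases uIcc_subset_uIcc_union_uIcc (b := y) hu with hu | hu
  · exact min_le_of_left_le (K.low_le hu)
  · exact min_le_of_right_le (K.low_le hu)

/-- This is the four point condition once the levels cancel in `dist = lev + lev - 2 low`. It
follows from the ultrametric inequality `min_low_le` applied along four routes. -/
theorem low_four (x y z w : X) :
    min (K.low x z + K.low y w) (K.low x w + K.low y z) ≤ K.low x y + K.low z w := by
  have h1 := K.min_low_le x z y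
  have h2 := K.min_low_le x w y
  have h3 := K.min_low_le z x w
  have h4 := K.min_low_le z y w
  rw [K.low_comm z y] at h1 h4
  rw [K.low_comm w y] at h2
  rw [K.low_comm z x] at h3
  simp only [min_le_iff] at *
  by_contra! h
  rcases h1 with h1 | h1 <;> rcases h2 with h2 | h2 <;> rcases h3 with h3 | h3 <;>
    rcases h4 with h4 | h4 <;> linarith [h.1, h.2]

/-- Near `x` the whole interval between `x` and `y` stays close to `x`, so the level oscillates
little on it, and the distance is controlled by that oscillation. -/
theorem continuous_toTree : Continuous K.toTree := by
  rw [continuous_iff_continuousAt]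
  intro x
  rw [ContinuousAt, Metric.tendsto_nhds]
  intro ε hε
  have h1 : ∀ᶠ y in 𝓝 x, |K.lev y - K.lev x| < ε / 4 := by
    have := K.continuous_lev.continuousAt (x := x)
    rw [ContinuousAt, Metric.tendsto_nhds] at this
    exact this (ε / 4) (by positivity)
  have h2 : Tendsto (fun y => uIcc x y) (𝓝 x) (𝓝 x).smallSets :=
    tendsto_const_nhds.uIcc tendsto_id
  filter_upwards [h2.eventually (eventually_smallSets_forall.2 h1)] with y hy
  have e := hy y right_mem_uIcc
  have hm : K.lev x - ε / 4 ≤ K.low x y := K.le_low fun z hz => by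
    have := abs_lt.1 (hy z hz); linarith [this.1]
  rw [dist_comm, K.dist_toTree]
  have := abs_lt.1 e
  linarith [this.2]

theorem compactSpace_domain : CompactSpace X :=
  ⟨by rw [← Icc_bot_top]; exact isCompact_Icc⟩

include K in
theorem compactSpace_tree : CompactSpace D.Tree := by
  have : CompactSpace X := compactSpace_domain
  exact ⟨by rw [← K.toTree_surjective.range_eq]; exact isCompact_range K.continuous_toTree⟩

include K in
theorem secondCountable_tree : SecondCountableTopology D.Tree := by
  have := K.compactSpace_tree
  infer_instance

/-- Compactness provides a minimizer of the level, so the choice operator in `root` really selects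
one. -/
theorem exists_root : ∃ U, K.toTree U = D.root ∧ ∀ x, K.lev U ≤ K.lev x := by
  have : CompactSpace X := compactSpace_domain
  obtain ⟨U, -, hU⟩ := isCompact_univ.exists_isMinOn univ_nonempty K.continuous_lev.continuousOn
  have hex : ∃ z : D.carrier, ∀ w, D.level z ≤ D.level w := ⟨K.pt U, fun w => by
    obtain ⟨x, rfl⟩ := K.surj w
    exact hU (mem_univ x)⟩
  obtain ⟨V, hV⟩ := K.surj (@Classical.epsilon D.carrier ⟨D.first⟩
    fun z => ∀ w, D.level z ≤ D.level w)
  refine ⟨V, congrArg D.proj hV, fun x => ?_⟩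
  rw [lev, hV]
  exact @Classical.epsilon_spec_aux _ ⟨D.first⟩ (fun z => ∀ w, D.level z ≤ D.level w) hex _

theorem dist_root {U : X} (hU : K.toTree U = D.root) (hU' : ∀ x, K.lev U ≤ K.lev x) (x : X) :
    dist D.root (K.toTree x) = K.lev x - K.lev U := by
  have : K.low U x = K.lev U := le_antisymm (K.low_le left_mem_uIcc) (K.le_low fun z _ => hU' z)
  rw [← hU, K.dist_toTree, this]; ring

theorem dist_root_sub (x y : X) :
    dist D.root (K.toTree x) - dist D.root (K.toTree y) = K.lev x - K.lev y := by
  obtain ⟨U, hU, hU'⟩ := K.exists_root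
  rw [K.dist_root hU hU', K.dist_root hU hU']; ring

/-- Distances to the root are levels up to a constant, so lying below `x` amounts to `low u x = lev
u`. This translates the genealogy of the tree into statements on the path. -/
theorem mem_arc_root {u x : X} :
    K.toTree u ∈ arc D.root (K.toTree x) ↔ ∀ z ∈ uIcc u x, K.lev u ≤ K.lev z := by
  have h := K.dist_root_sub u x
  rw [mem_arc, K.dist_toTree]
  refine ⟨fun h1 z hz => le_trans (by linarith) (K.low_le hz), fun h1 => ?_⟩
  have h2 := K.le_low h1
  have h3 := K.low_le (left_mem_uIcc (a := u) (b := x))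
  linarith

theorem toTree_eq_iff {x y : X} (h : K.lev x = K.lev y) :
    K.toTree x = K.toTree y ↔ ∀ z ∈ uIcc x y, K.lev x ≤ K.lev z := by
  rw [← dist_eq_zero, K.dist_toTree, ← h]
  refine ⟨fun h1 z hz => le_trans (by linarith) (K.low_le hz), fun h1 => ?_⟩
  have h2 := K.le_low h1
  have h3 := K.low_le (left_mem_uIcc (a := x) (b := y))
  linarith

theorem lev_eq_of_toTree_eq {x y : X} (h : K.toTree x = K.toTree y) : K.lev x = K.lev y := by
  have := K.dist_root_sub x y
  rw [h, sub_self] at this; linarith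

/-- The first point of the fibre of `τ`. -/
def fst (τ : D.Tree) : X := sInf (K.toTree ⁻¹' {τ})

/-- The last point of the fibre of `τ`. -/
def lst (τ : D.Tree) : X := sSup (K.toTree ⁻¹' {τ})

theorem isClosed_fibre (τ : D.Tree) : IsClosed (K.toTree ⁻¹' {τ}) :=
  isClosed_singleton.preimage K.continuous_toTree

theorem toTree_fst (τ : D.Tree) : K.toTree (K.fst τ) = τ :=
  (K.isClosed_fibre τ).csInf_mem (K.toTree_surjective τ) (OrderBot.bddBelow _)

theorem toTree_lst (τ : D.Tree) : K.toTree (K.lst τ) = τ :=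
  (K.isClosed_fibre τ).csSup_mem (K.toTree_surjective τ) (OrderTop.bddAbove _)

omit [OrderTopology X] in
theorem fst_le {x : X} {τ : D.Tree} (h : K.toTree x = τ) : K.fst τ ≤ x :=
  csInf_le (OrderBot.bddBelow _) h

omit [OrderTopology X] in
theorem le_lst {x : X} {τ : D.Tree} (h : K.toTree x = τ) : x ≤ K.lst τ :=
  le_csSup (OrderTop.bddAbove _) h

theorem fst_le_lst (τ : D.Tree) : K.fst τ ≤ K.lst τ := K.fst_le (K.toTree_lst τ)

theorem up_eq (τ : D.Tree) : up τ = K.tm (K.fst τ) := by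
  refine IsLeast.csInf_eq ⟨⟨K.pt (K.fst τ), K.toTree_fst τ, rfl⟩, ?_⟩
  rintro _ ⟨z, hz, rfl⟩
  obtain ⟨x, rfl⟩ := K.surj z
  exact K.tm_mono (K.fst_le hz)

theorem down_eq (τ : D.Tree) : down τ = K.tm (K.lst τ) := by
  refine IsGreatest.csSup_eq ⟨⟨K.pt (K.lst τ), K.toTree_lst τ, rfl⟩, ?_⟩
  rintro _ ⟨z, hz, rfl⟩
  obtain ⟨x, rfl⟩ := K.surj z
  exact K.tm_mono (K.le_lst hz)

/-- The first and last visits project to the same tree point, so the level does not go below theirs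
in between. -/
theorem mem_arc_of_mem_Icc {τ : D.Tree} {w : X} (h : w ∈ Icc (K.fst τ) (K.lst τ)) :
    τ ∈ arc D.root (K.toTree w) := by
  have h1 : K.toTree (K.fst τ) = K.toTree (K.lst τ) := by rw [toTree_fst, toTree_lst]
  have h2 := (K.toTree_eq_iff (K.lev_eq_of_toTree_eq h1)).1 h1
  rw [← K.toTree_fst τ, mem_arc_root]
  intro z hz
  refine h2 z ?_
  rw [uIcc_of_le (K.fst_le_lst τ)]
  rw [uIcc_of_le h.1] at hz
  exact ⟨hz.1, hz.2.trans h.2⟩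

variable [DenselyOrdered X]

/-- Starting from `x` towards `y`, take the first point where the level is at most `c`; by the
intermediate value theorem the level there is exactly `c`. -/
theorem exists_first_passage {x y : X} {c : ℝ} (h1 : K.low x y ≤ c) (h2 : c ≤ K.lev x) :
    ∃ u ∈ uIcc x y, K.lev u = c ∧ ∀ z ∈ uIcc x u, c ≤ K.lev z := by
  obtain ⟨m, hm, hm'⟩ := K.exists_lev_eq_low x y
  have hcpt : IsCompact (uIcc x y ∩ {w | K.lev w ≤ c}) :=
    isCompact_uIcc.inter_right (isClosed_le K.continuous_lev continuous_const)
  have hne : (uIcc x y ∩ {w | K.lev w ≤ c}).Nonempty := ⟨m, hm, (hm'.le.trans h1 :)⟩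
  rcases le_total x y with hxy | hxy
  · rw [uIcc_of_le hxy] at hcpt hne ⊢
    obtain ⟨u, hu, hmin⟩ := hcpt.exists_isLeast hne
    have hlt : ∀ z ∈ Ico x u, c < K.lev z := fun z hz => by
      by_contra! h
      exact hz.2.not_ge (hmin ⟨⟨hz.1, hz.2.le.trans hu.1.2⟩, h⟩)
    obtain ⟨v, hv, hvc⟩ := intermediate_value_Icc' hu.1.1 K.continuous_lev.continuousOn ⟨hu.2, h2⟩
    have hvu : v = u := by
      by_contra! h
      exact (hlt v ⟨hv.1, lt_of_le_of_ne hv.2 h⟩).ne' hvc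
    subst hvu
    refine ⟨v, hu.1, hvc, fun z hz => ?_⟩
    rw [uIcc_of_le hu.1.1] at hz
    rcases hz.2.eq_or_lt with rfl | h
    exacts [hvc.ge, (hlt z ⟨hz.1, h⟩).le]
  · rw [uIcc_of_ge hxy] at hcpt hne ⊢
    obtain ⟨u, hu, hmax⟩ := hcpt.exists_isGreatest hne
    have hlt : ∀ z ∈ Ioc u x, c < K.lev z := fun z hz => by
      by_contra! h
      exact hz.1.not_ge (hmax ⟨⟨hu.1.1.trans hz.1.le, hz.2⟩, h⟩)
    obtain ⟨v, hv, hvc⟩ := intermediate_value_Icc hu.1.2 K.continuous_lev.continuousOn ⟨hu.2, h2⟩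
    have hvu : v = u := by
      by_contra! h
      exact (hlt v ⟨lt_of_le_of_ne hv.1 h.symm, hv.2⟩).ne' hvc
    subst hvu
    refine ⟨v, hu.1, hvc, fun z hz => ?_⟩
    rw [uIcc_of_ge hu.1.2] at hz
    rcases hz.1.eq_or_lt with rfl | h
    exacts [hvc.ge, (hlt z ⟨h, hz.2⟩).le]

include K in
theorem isRealTree : IsRealTree D.Tree where
  four := by
    intro a b c d
    obtain ⟨x, rfl⟩ := K.toTree_surjective a
    obtain ⟨y, rfl⟩ := K.toTree_surjective b
    obtain ⟨z, rfl⟩ := K.toTree_surjective c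
    obtain ⟨w, rfl⟩ := K.toTree_surjective d
    have h := K.low_four x y z w
    simp only [K.dist_toTree]
    rcases min_le_iff.1 h with h | h
    · exact le_max_of_le_left (by linarith)
    · exact le_max_of_le_right (by linarith)
  geod := by
    -- The arc goes down from `x` to the lowest level and then up to `y`. On the descending half,
    -- the point at distance `a` is the first passage at level `lev x - a`.
    have key : ∀ (x y : X) (a : ℝ), 0 ≤ a → a ≤ K.lev x - K.low x y →
        ∃ z ∈ arc (K.toTree x) (K.toTree y), dist (K.toTree x) z = a := by
      intro x y a h0 ha
      obtain ⟨u, hu, hc, hz⟩ := K.exists_first_passage (x := x) (y := y) (c := K.lev x - a)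
        (by linarith) (by linarith)
      have h1 : K.low x u = K.lev x - a :=
        le_antisymm (hc ▸ K.low_le right_mem_uIcc) (K.le_low hz)
      have h2 : K.low x y ≤ K.low u y := K.le_low fun z hz =>
        K.low_le (uIcc_subset_uIcc hu right_mem_uIcc hz)
      have h3 : dist (K.toTree x) (K.toTree u) = a := by rw [K.dist_toTree, h1, hc]; ring
      refine ⟨K.toTree u, mem_arc_of_le ?_, h3⟩
      rw [h3, K.dist_toTree, K.dist_toTree, hc]; linarith
    intro b c a h0 ha
    obtain ⟨x, rfl⟩ := K.toTree_surjective b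
    obtain ⟨y, rfl⟩ := K.toTree_surjective c
    rcases le_total a (K.lev x - K.low x y) with h | h
    · exact key x y a h0 h
    -- On the ascending half, the point is found by descending from `y`.
    · have hd := K.dist_toTree x y
      obtain ⟨z, hz, hz'⟩ := key y x (dist (K.toTree x) (K.toTree y) - a) (by linarith)
        (by rw [hd, K.low_comm y x]; linarith)
      rw [arc_comm] at hz
      refine ⟨z, hz, ?_⟩
      rw [mem_arc, dist_comm z, hz'] at hz
      linarith

/-- If the path later went below the level of `τ`, its first passage at that level after `w` would
be another visit of `τ`, after the last one. So it stays above until the end. -/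
theorem mem_arc_last {τ : D.Tree} {w : X} (h : τ ∈ arc D.root (K.toTree w)) (hw : K.lst τ < w) :
    τ ∈ arc D.root D.ptB := by
  rw [← K.toTree_lst τ, mem_arc_root, uIcc_of_le hw.le] at h
  rw [← K.toTree_lst τ, ← K.toTree_top, mem_arc_root]
  by_contra! hc
  obtain ⟨z, hz, hlt⟩ := hc
  rw [uIcc_of_le le_top] at hz
  have hwz : w < z := by
    by_contra! h'
    exact hlt.not_ge (h z ⟨hz.1, h'⟩)
  obtain ⟨u, hu, hc, hz'⟩ := K.exists_first_passage (x := w) (y := z)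
    ((K.low_le right_mem_uIcc).trans hlt.le) (h w ⟨hw.le, le_rfl⟩)
  rw [uIcc_of_le hwz.le] at hu
  rw [uIcc_of_le hu.1] at hz'
  have : K.toTree (K.lst τ) = K.toTree u := by
    rw [K.toTree_eq_iff hc.symm, uIcc_of_le (hw.le.trans hu.1)]
    intro v hv
    rcases le_total v w with h' | h'
    exacts [h v ⟨hv.1, h'⟩, hz' v ⟨h', hv.2⟩]
  rw [K.toTree_lst] at this
  exact (hw.trans_le hu.1).not_ge (K.le_lst this.symm)

/-- The time reversal of `mem_arc_last`. -/
theorem mem_arc_first {τ : D.Tree} {w : X} (h : τ ∈ arc D.root (K.toTree w)) (hw : w < K.fst τ) :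
    τ ∈ arc D.root D.ptA := by
  rw [← K.toTree_fst τ, mem_arc_root, uIcc_of_ge hw.le] at h
  rw [← K.toTree_fst τ, ← K.toTree_bot, mem_arc_root]
  by_contra! hc
  obtain ⟨z, hz, hlt⟩ := hc
  rw [uIcc_of_ge bot_le] at hz
  have hwz : z < w := by
    by_contra! h'
    exact hlt.not_ge (h z ⟨h', hz.2⟩)
  obtain ⟨u, hu, hc, hz'⟩ := K.exists_first_passage (x := w) (y := z)
    ((K.low_le right_mem_uIcc).trans hlt.le) (h w ⟨le_rfl, hw.le⟩)
  rw [uIcc_of_ge hwz.le] at hu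
  rw [uIcc_of_ge hu.2] at hz'
  have : K.toTree (K.fst τ) = K.toTree u := by
    rw [K.toTree_eq_iff hc.symm, uIcc_of_ge (hu.2.trans hw.le)]
    intro v hv
    rcases le_total v w with h' | h'
    exacts [hz' v ⟨hv.1, h'⟩, h v ⟨h', hv.2⟩]
  rw [K.toTree_fst] at this
  exact (hu.2.trans_lt hw).not_ge (K.fst_le this.symm)

/-- The points above `τ` are those which are visited between the first and last visits of `τ`, with
the convention that the points of `[O,A]` are visited at the beginning, and those of `[O,B]` at
the end. -/
theorem mem_arc_iff {τ : D.Tree} {w : X} : τ ∈ arc D.root (K.toTree w) ↔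
    (τ ∈ arc D.root D.ptA ∨ K.fst τ ≤ w) ∧ (τ ∈ arc D.root D.ptB ∨ w ≤ K.lst τ) := by
  have h0 := K.fst_le_lst τ
  rcases lt_or_ge w (K.fst τ) with h | h
  · have : τ ∈ arc D.root D.ptA → τ ∈ arc D.root (K.toTree w) := by
      rw [← K.toTree_bot, ← K.toTree_fst τ, mem_arc_root, mem_arc_root, uIcc_of_ge bot_le, uIcc_of_ge h.le]
      exact fun h' z hz => h' z ⟨bot_le, hz.2⟩
    exact ⟨fun h' => ⟨Or.inl (K.mem_arc_first h' h), Or.inr (h.le.trans h0)⟩,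
      fun h' => this (h'.1.resolve_right h.not_ge)⟩
  rcases lt_or_ge (K.lst τ) w with h' | h'
  · have : τ ∈ arc D.root D.ptB → τ ∈ arc D.root (K.toTree w) := by
      rw [← K.toTree_top, ← K.toTree_lst τ, mem_arc_root, mem_arc_root, uIcc_of_le le_top, uIcc_of_le h'.le]
      exact fun h1 z hz => h1 z ⟨hz.1, le_top⟩
    exact ⟨fun h1 => ⟨Or.inr h, Or.inl (K.mem_arc_last h1 h')⟩,
      fun h1 => this (h1.2.resolve_right h'.not_ge)⟩
  · exact ⟨fun _ => ⟨Or.inr h, Or.inr h'⟩, fun _ => K.mem_arc_of_mem_Icc ⟨h, h'⟩⟩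

omit [DenselyOrdered X] in
include K in
-- Sublevel sets are images in the tree of initial segments of `X`, which are compact.
theorem measurable_up : Measurable (up : D.Tree → I) := by
  have : CompactSpace X := compactSpace_domain
  refine measurable_of_Iic fun s => ?_
  have : up ⁻¹' Iic s = K.toTree '' Iic (K.lastAt s) := by
    ext τ
    rw [mem_preimage, K.up_eq, mem_Iic, tm, K.time_le_iff]
    constructor
    · exact fun h => ⟨_, h, K.toTree_fst τ⟩
    · rintro ⟨x, hx, hx'⟩
      exact (K.fst_le hx').trans hx
  rw [this]
  exact (isClosed_Iic.isCompact.image K.continuous_toTree).isClosed.measurableSet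

omit [DenselyOrdered X] in
include K in
theorem measurable_down : Measurable (down : D.Tree → I) := by
  have : CompactSpace X := compactSpace_domain
  have hc : Continuous K.tm := K.tm_mono.continuous_of_surjective fun s => ⟨K.lastAt s, K.time_lastAt s⟩
  refine measurable_of_Ici fun s => ?_
  have : down ⁻¹' Ici s = K.toTree '' (K.tm ⁻¹' Ici s) := by
    ext τ
    rw [mem_preimage, K.down_eq, mem_Ici]
    constructor
    · exact fun h => ⟨_, h, K.toTree_lst τ⟩
    · rintro ⟨x, hx, hx'⟩
      exact (hx : s ≤ K.tm x).trans (K.tm_mono (K.le_lst hx'))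
  rw [this]
  exact ((isClosed_Ici.preimage hc).isCompact.image K.continuous_toTree).isClosed.measurableSet

omit [DenselyOrdered X] in
include K in
theorem measurable_increment {ρ : I → ℝ} (hρ : Measurable ρ) : Measurable (D.increment ρ) := by
  have hm : ∀ x : D.Tree, MeasurableSet (arc D.root x \ {D.root}) := fun x =>
    (isClosed_arc _ _).measurableSet.diff (measurableSet_singleton _)
  exact (Measurable.ite (hm _) measurable_const (hρ.comp K.measurable_up)).sub
    (Measurable.ite (hm _) measurable_const (hρ.comp K.measurable_down))

end Coding.Chart

end PathTree

end

/-! ### Excursions, antichains and dyadic slices -/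

noncomputable section

namespace PathTree

/-- Hölder's inequality against the counting measure. -/
theorem sum_le_card_rpow_mul {ι : Type*} (F : Finset ι) (g : ι → ℝ≥0∞) {q : ℝ} (hq : 1 ≤ q)
    {V N : ℝ≥0∞} (h : ∑ i ∈ F, g i ^ q ≤ V) (hN : (F.card : ℝ≥0∞) ≤ N) :
    ∑ i ∈ F, g i ≤ N ^ (1 - 1 / q) * V ^ (1 / q) := by
  have hq0 : 0 < q := by linarith
  have h1 : (∑ i ∈ F, g i) ^ q ≤ N ^ (q - 1) * V :=
    (ENNReal.rpow_sum_le_const_mul_sum_rpow F g hq).trans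
      (mul_le_mul' (ENNReal.rpow_le_rpow hN (by linarith)) h)
  have h2 := ENNReal.rpow_le_rpow h1 (one_div_nonneg.2 hq0.le)
  rw [← ENNReal.rpow_mul, mul_one_div_cancel hq0.ne', ENNReal.rpow_one,
    ENNReal.mul_rpow_of_nonneg _ _ (one_div_nonneg.2 hq0.le), ← ENNReal.rpow_mul] at h2
  convert! h2 using 3
  field_simp

namespace Coding

variable {D : Coding}

theorem increment_add (ρ ρ' : I → ℝ) (τ : D.Tree) :
    D.increment (fun t => ρ t + ρ' t) τ = D.increment ρ τ + D.increment ρ' τ := by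
  unfold increment valUp valDown
  split_ifs <;> ring

theorem increment_const_mul (c : ℝ) (ρ : I → ℝ) (τ : D.Tree) :
    D.increment (fun t => c * ρ t) τ = c * D.increment ρ τ := by
  unfold increment valUp valDown
  split_ifs <;> ring

theorem increment_zero (τ : D.Tree) : D.increment (fun _ => 0) τ = 0 := by
  unfold increment valUp valDown
  split_ifs <;> ring

/-- The points of the tree which are visited during `(s,t]` only. -/
def excursions (D : Coding) (s t : I) : Set D.Tree :=
  {τ | τ ∉ arc D.root D.ptA ∧ τ ∉ arc D.root D.ptB ∧ s < up τ ∧ down τ ≤ t}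

theorem valUp_of_ne_root {ρ : I → ℝ} {τ : D.Tree} (h : τ ≠ D.root) [Decidable (τ ∈ arc D.root D.ptA)] :
    valUp ρ τ = if τ ∈ arc D.root D.ptA then 0 else ρ (up τ) := by
  unfold valUp
  by_cases h' : τ ∈ arc D.root D.ptA <;> simp [h, h']

theorem valDown_of_ne_root {ρ : I → ℝ} {τ : D.Tree} (h : τ ≠ D.root)
    [Decidable (τ ∈ arc D.root D.ptB)] :
    valDown ρ τ = if τ ∈ arc D.root D.ptB then 0 else ρ (down τ) := by
  unfold valDown
  by_cases h' : τ ∈ arc D.root D.ptB <;> simp [h, h']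

namespace Chart

variable {ω : I → ℝ} {X : Type*} [ConditionallyCompleteLinearOrder X]
  [BoundedOrder X] [TopologicalSpace X] [OrderTopology X] [DenselyOrdered X] (K : D.Chart ω X)

omit [DenselyOrdered X] in
theorem up_le_iff {τ : D.Tree} {s : I} : up τ ≤ s ↔ K.fst τ ≤ K.lastAt s := by
  rw [K.up_eq]; exact K.time_le_iff _ _

omit [DenselyOrdered X] in
theorem down_le_iff {τ : D.Tree} {s : I} : down τ ≤ s ↔ K.lst τ ≤ K.lastAt s := by
  rw [K.down_eq]; exact K.time_le_iff _ _

omit [DenselyOrdered X] in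
include K in
theorem up_le_down (τ : D.Tree) : up τ ≤ down τ := by
  rw [K.up_eq, K.down_eq]; exact K.tm_mono (K.fst_le_lst τ)

omit [DenselyOrdered X] in
include K in
theorem increment_of_mem {s t : I} (ρ : I → ℝ) {τ : D.Tree} (h : τ ∈ D.excursions s t) :
    D.increment ((Ioc s t).indicator ρ) τ = ρ (up τ) - ρ (down τ) := by
  classical
  have h0 : τ ≠ D.root := fun h' => h.1 (h' ▸ left_mem_arc _ _)
  have hud := K.up_le_down τ
  obtain ⟨h1, h2, h3, h4⟩ := h
  rw [increment, valUp_of_ne_root h0, valDown_of_ne_root h0, if_neg h1, if_neg h2,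
    indicator_of_mem (show up τ ∈ Ioc s t from ⟨h3, hud.trans h4⟩),
    indicator_of_mem (show down τ ∈ Ioc s t from ⟨h3.trans_le hud, h4⟩)]

/-- When `τ` is not an excursion of the window, at most one of its two values is nonzero. In that
case `τ` separates the points of the tree reached at times `s` and `t`, or is the latter point, so
it lies on their arc. -/
theorem enorm_increment_le_of_notMem {s t : I} (ρ : I → ℝ) {τ : D.Tree}
    (h : τ ∉ D.excursions s t) (h0 : τ ≠ D.root) :
    ‖D.increment ((Ioc s t).indicator ρ) τ‖ₑ ≤
      (arc (K.toTree (K.lastAt s)) (K.toTree (K.lastAt t))).indicator (fun _ => supAbs ρ) τ := by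
  classical
  have hud := K.up_le_down τ
  have hb : ∀ u, ‖ρ u‖ₑ ≤ supAbs ρ := le_iSup (fun t => ‖ρ t‖ₑ)
  have hT := K.isRealTree
  rw [increment, valUp_of_ne_root h0, valDown_of_ne_root h0]
  have hs := K.mem_arc_iff (τ := τ) (w := K.lastAt s)
  have ht := K.mem_arc_iff (τ := τ) (w := K.lastAt t)
  by_cases h1 : τ ∉ arc D.root D.ptA ∧ up τ ∈ Ioc s t
  · have h3 : τ ∉ arc D.root (K.toTree (K.lastAt s)) := by
      rw [hs, ← K.up_le_iff]
      exact fun h' => h'.1.elim h1.1 h1.2.1.not_ge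
    have h2 : τ ∈ arc D.root D.ptB ∨ t < down τ := by
      by_contra! h'
      exact h ⟨h1.1, h'.1, h1.2.1, h'.2⟩
    have h4 : τ ∈ arc D.root (K.toTree (K.lastAt t)) := by
      rw [ht, ← K.up_le_iff]
      refine ⟨Or.inr h1.2.2, h2.imp_right fun h' => ?_⟩
      rw [← not_le, K.down_le_iff, not_le] at h'
      exact h'.le
    rw [indicator_of_mem (hT.mem_arc_of_not_mem h4 h3), if_neg h1.1, indicator_of_mem h1.2]
    have : (if τ ∈ arc D.root D.ptB then 0 else (Ioc s t).indicator ρ (down τ)) = 0 := by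
      split_ifs with h'
      · rfl
      · exact indicator_of_notMem (fun h'' => (h2.resolve_left h').not_ge h''.2) _
    rw [this, sub_zero]
    exact hb _
  · have e1 : (if τ ∈ arc D.root D.ptA then 0 else (Ioc s t).indicator ρ (up τ)) = 0 := by
      split_ifs with h'
      · rfl
      · exact indicator_of_notMem (fun h'' => h1 ⟨h', h''⟩) _
    rw [e1, zero_sub, enorm_neg]
    by_cases h2 : τ ∉ arc D.root D.ptB ∧ down τ ∈ Ioc s t
    · rw [if_neg h2.1, indicator_of_mem h2.2]
      have h3 : τ ∈ arc D.root (K.toTree (K.lastAt s)) := by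
        have hlt := h2.2.1
        rw [← not_le, K.down_le_iff, not_le] at hlt
        rw [hs, ← K.up_le_iff]
        refine ⟨?_, Or.inr hlt.le⟩
        by_contra! h'
        exact h1 ⟨h'.1, h'.2, hud.trans h2.2.2⟩
      have h4 : τ ∈ arc (K.toTree (K.lastAt s)) (K.toTree (K.lastAt t)) := by
        -- If the last visit is exactly `lastAt t`, then `τ` does lie below that point, but it is
        -- the end of the arc itself.
        rcases (K.down_le_iff.1 h2.2.2).eq_or_lt with h' | h'
        · rw [← h', K.toTree_lst]; exact right_mem_arc _ _
        · rw [arc_comm]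
          refine hT.mem_arc_of_not_mem h3 ?_
          rw [ht]
          exact fun h'' => h''.2.elim h2.1 h'.not_ge
      rw [indicator_of_mem h4]
      exact hb _
    · have : (if τ ∈ arc D.root D.ptB then 0 else (Ioc s t).indicator ρ (down τ)) = 0 := by
        split_ifs with h'
        · rfl
        · exact indicator_of_notMem (fun h'' => h2 ⟨h', h''⟩) _
      rw [this, enorm_zero]
      exact zero_le

/-- If the visiting intervals met, a common point would lie above both `τ` and `κ`; but two points
below the same point are comparable. -/
theorem lst_lt_fst_or {τ κ : D.Tree} (h1 : τ ∉ arc D.root κ) (h2 : κ ∉ arc D.root τ) :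
    K.lst τ < K.fst κ ∨ K.lst κ < K.fst τ := by
  by_contra! h
  have h3 := K.mem_arc_of_mem_Icc (τ := τ) (w := max (K.fst τ) (K.fst κ))
    ⟨le_max_left _ _, max_le (K.fst_le_lst τ) h.1⟩
  have h4 := K.mem_arc_of_mem_Icc (τ := κ) (w := max (K.fst τ) (K.fst κ))
    ⟨le_max_right _ _, max_le h.2 (K.fst_le_lst κ)⟩
  exact (K.isRealTree.mem_arc_or_mem_arc h3 h4).elim h1 h2

theorem exists_height {s t : I} {a : ℝ} {τ : D.Tree} (h : τ ∈ D.excursions s t)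
    (ha : τ ∈ above D.root a) : ∃ w ∈ Icc (K.fst τ) (K.lst τ), a < K.lev w - K.lev (K.fst τ) := by
  obtain ⟨κ, h1, h2⟩ := ha
  obtain ⟨w, rfl⟩ := K.toTree_surjective κ
  have h3 := K.mem_arc_iff.1 h1
  refine ⟨w, ⟨h3.1.resolve_left h.1, h3.2.resolve_left h.2.1⟩, ?_⟩
  have h4 := K.dist_root_sub w (K.fst τ)
  rw [K.toTree_fst] at h4
  rw [mem_arc] at h1
  linarith

omit [DenselyOrdered X] in
theorem enorm_lev_sub_rpow_le {p : ℝ} {s t : I} {τ : D.Tree} {w : X} (h : τ ∈ D.excursions s t)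
    (hw : w ∈ Icc (K.fst τ) (K.lst τ)) :
    ‖K.lev w - K.lev (K.fst τ)‖ₑ ^ p ≤ chainVar p K.lev (Icc (K.lastAt s) (K.lastAt t)) := by
  have e1 := h.2.2.1
  rw [← not_le, K.up_le_iff, not_le] at e1
  have e2 := K.down_le_iff.1 h.2.2.2
  exact enorm_rpow_le_chainVar hw.1 ⟨e1.le, (K.fst_le_lst τ).trans e2⟩
    ⟨e1.le.trans hw.1, hw.2.trans e2⟩

include K in
-- For an antichain the intervals from first to last visit are disjoint, so the increments of `ρ`
-- are among those of a single chain.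
theorem sum_increment_rpow_le {ρ : I → ℝ} {q : ℝ} (F : Finset D.Tree)
    (hF : ∀ τ ∈ F, ∀ κ ∈ F, τ ≠ κ → τ ∉ arc D.root κ) :
    ∑ τ ∈ F, ‖ρ (up τ) - ρ (down τ)‖ₑ ^ q ≤ pVar q ρ := by
  have h := sum_le_chainVar_of_disjoint (p := q) (g := ρ ∘ K.tm) F (a := K.fst) (b := K.lst)
    (x := ⊥) (y := ⊤) (fun _ _ => bot_le) (fun τ _ => K.fst_le_lst τ) (fun _ _ => le_top)
    (fun τ hτ κ hκ hne => K.lst_lt_fst_or (hF τ hτ κ hκ hne) (hF κ hκ τ hτ hne.symm))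
  refine le_trans (Finset.sum_congr rfl fun τ _ => ?_).le
    (h.trans ((chainVar_comp_le K.tm_mono (mapsTo_univ _ _)).trans chainVar_le_pVar))
  rw [K.up_eq, K.down_eq, enorm_sub_rev]; rfl

/-- Each member of the antichain forces an oscillation of the level larger than `a`, and these occur
on disjoint intervals inside the window. -/
theorem card_mul_le {p a : ℝ} (hp : 1 ≤ p) {s t : I} (F : Finset D.Tree)
    (hE : ∀ τ ∈ F, τ ∈ D.excursions s t ∩ above D.root a)
    (hF : ∀ τ ∈ F, ∀ κ ∈ F, τ ≠ κ → τ ∉ arc D.root κ) :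
    F.card * ENNReal.ofReal a ^ p ≤ chainVar p K.lev (Icc (K.lastAt s) (K.lastAt t)) := by
  choose! w hw1 hw2 using fun τ hτ => K.exists_height (hE τ hτ).1 (hE τ hτ).2
  have h := sum_le_chainVar_of_disjoint (p := p) (g := K.lev) F (a := K.fst) (b := w)
    (x := K.lastAt s) (y := K.lastAt t)
    (fun τ hτ => by
      have := (hE τ hτ).1.2.2.1
      rw [← not_le, K.up_le_iff, not_le] at this
      exact this.le)
    (fun τ hτ => (hw1 τ hτ).1)
    (fun τ hτ => (hw1 τ hτ).2.trans (K.down_le_iff.1 (hE τ hτ).1.2.2.2))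
    (fun τ hτ κ hκ hne => by
      rcases K.lst_lt_fst_or (hF τ hτ κ hκ hne) (hF κ hκ τ hτ hne.symm) with h | h
      · exact Or.inl ((hw1 τ hτ).2.trans_lt h)
      · exact Or.inr ((hw1 κ hκ).2.trans_lt h))
  refine le_trans ?_ h
  rw [← nsmul_eq_mul, ← Finset.sum_const]
  refine Finset.sum_le_sum fun τ hτ => ENNReal.rpow_le_rpow ?_ (by linarith)
  rw [← ofReal_norm, Real.norm_eq_abs]
  exact ENNReal.ofReal_le_ofReal ((hw2 τ hτ).le.trans (le_abs_self _))

omit [DenselyOrdered X] in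
include K in
theorem measurableSet_excursions (s t : I) : MeasurableSet (D.excursions s t) :=
  ((isClosed_arc _ _).measurableSet.compl.inter ((isClosed_arc _ _).measurableSet.compl.inter
    ((K.measurable_up measurableSet_Ioi).inter
      (K.measurable_down measurableSet_Iic))))

end Chart

/-- The points of `excursions s t` with a height in `(R 2⁻ᵏ⁻¹, R 2⁻ᵏ]`. -/
def slice (D : Coding) (s t : I) (R : ℝ) (k : ℕ) : Set D.Tree :=
  D.excursions s t ∩ (above D.root (R / 2 ^ (k + 1)) \ above D.root (R / 2 ^ k))

theorem slice_disjoint (s t : I) {R : ℝ} (hR : 0 < R) :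
    Pairwise (Function.onFun Disjoint (D.slice s t R)) := by
  have key : ∀ i j, i < j → Disjoint (D.slice s t R i) (D.slice s t R j) := fun i j hij => by
    rw [disjoint_left]
    intro τ h1 h2
    refine h2.2.2 (above_anti _ ?_ h1.2.1)
    exact div_le_div_of_nonneg_left hR.le (by positivity)
      (pow_le_pow_right₀ one_le_two (Nat.succ_le_of_lt hij))
  intro i j hij
  rcases lt_or_gt_of_ne hij with h | h
  exacts [key i j h, (key j i h).symm]

namespace Chart

variable {ω : I → ℝ} {X : Type*} [ConditionallyCompleteLinearOrder X]
  [BoundedOrder X] [TopologicalSpace X] [OrderTopology X] [DenselyOrdered X] (K : D.Chart ω X)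

include K in
theorem measurableSet_slice (s t : I) {R : ℝ} (hR : 0 < R) (k : ℕ) :
    MeasurableSet (D.slice s t R k) := by
  have := K.secondCountable_tree
  exact (K.measurableSet_excursions s t).inter
    ((K.isRealTree.measurableSet_above _ (by positivity)).diff
      (K.isRealTree.measurableSet_above _ (by positivity)))

include K in
theorem isLengthMeasure_length : IsLengthMeasure D.root D.length := by
  have := K.secondCountable_tree
  exact K.isRealTree.isLengthMeasure_lengthMeasure _

include K in
/-- To bound an integral on a slice, it is sufficient to bound the sums along antichains. -/
theorem setLIntegral_slice_le {s t : I} {R : ℝ} (hR : 0 < R) (k : ℕ) {g : D.Tree → ℝ≥0∞}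
    (hg : Measurable g) {B : ℝ≥0∞}
    (hB : ∀ F : Finset D.Tree,
      (∀ τ ∈ F, τ ∈ D.excursions s t ∩ above D.root (R / 2 ^ (k + 1))) →
      (∀ τ ∈ F, ∀ κ ∈ F, τ ≠ κ → τ ∉ arc D.root κ) → ∑ τ ∈ F, g τ ≤ B) :
    ∫⁻ τ in D.slice s t R k, g τ ∂D.length ≤ ENNReal.ofReal (R / 2 ^ (k + 1)) * B := by
  have := K.secondCountable_tree
  have ha : 0 < R / 2 ^ (k + 1) := by positivity
  refine K.isRealTree.setLIntegral_lengthMeasure_le _ (K.measurableSet_slice s t hR k) hg ha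
    fun F h1 h2 => hB F (fun τ hτ => ⟨(h1 τ hτ).1, (h1 τ hτ).2.1⟩) fun τ hτ κ hκ hne h => ?_
  -- If `τ` were strictly below `κ`, their levels would differ by at least one step `R/2^(k+1)`.
  -- Adding the height of `κ`, which exceeds one step, would give `τ` a height above `R/2^k`,
  -- excluded by the slice.
  obtain ⟨j, hj⟩ := h2 κ hκ τ hτ
  obtain ⟨ζ, h3, h4⟩ := (h1 κ hκ).2.1
  refine (h1 τ hτ).2.2 ⟨ζ, arc_trans h h3, ?_⟩
  have h5 := arc_trans h h3
  have hpos := dist_pos.2 hne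
  rw [mem_arc] at h h3 h5
  have h6 : 0 < j * (R / 2 ^ (k + 1)) := by rw [← hj]; linarith
  have h7 : (1 : ℝ) ≤ j := by exact_mod_cast Int.cast_pos.1 (pos_of_mul_pos_left h6 ha.le)
  have h8 : R / 2 ^ k = 2 * (R / 2 ^ (k + 1)) := by rw [pow_succ]; field_simp
  have h9 : R / 2 ^ (k + 1) ≤ j * (R / 2 ^ (k + 1)) := le_mul_of_one_le_left ha.le h7
  rw [h8]
  linarith

/-- The ratio of the geometric series in the estimate of the tree integral. -/
def ratio (p q : ℝ) : ℝ := 2 ^ (p * (1 - 1 / q) - 1)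

omit [DenselyOrdered X] in
theorem card_le_of_mul_le {p R : ℝ} (hp : 1 ≤ p) (hR : 0 < R) (k n : ℕ) {V : ℝ≥0∞}
    (hV : V ≤ ENNReal.ofReal R ^ p) (h : n * ENNReal.ofReal (R / 2 ^ (k + 1)) ^ p ≤ V) :
    (n : ℝ≥0∞) ≤ ENNReal.ofReal (((2 : ℝ) ^ (k + 1)) ^ p) := by
  have h1 : 0 < R / 2 ^ (k + 1) := by positivity
  have h2 : ENNReal.ofReal R = ENNReal.ofReal (2 ^ (k + 1)) * ENNReal.ofReal (R / 2 ^ (k + 1)) := by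
    rw [← ENNReal.ofReal_mul (by positivity)]
    congr 1; field_simp
  rw [h2, ENNReal.mul_rpow_of_nonneg _ _ (by linarith)] at hV
  rw [← ENNReal.ofReal_rpow_of_pos (by positivity)]
  exact (ENNReal.mul_le_mul_iff_left (by simp [h1]) (by finiteness)).1 (h.trans hV)

/-- The spacing `R/2^(k+1)` of the levels multiplies Hölder's factor `(2^((k+1)p))^(1-1/q)`; the
product is `R` times the power `k+1` of the ratio. -/
theorem setLIntegral_slice_increment_le {p q : ℝ} (hp : 1 ≤ p) (hq : 1 ≤ q) {s t : I} {R : ℝ}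
    (hR : 0 < R) (hV : chainVar p K.lev (Icc (K.lastAt s) (K.lastAt t)) ≤ ENNReal.ofReal R ^ p)
    {ρ : I → ℝ} (hρ : Measurable ρ) (k : ℕ) :
    ∫⁻ τ in D.slice s t R k, ‖ρ (up τ) - ρ (down τ)‖ₑ ∂D.length ≤
      ENNReal.ofReal (R * ratio p q ^ (k + 1)) * pVar q ρ ^ (1 / q) := by
  have hq' : 0 ≤ 1 - 1 / q := by
    rw [sub_nonneg, div_le_one (by linarith)]; exact hq
  refine (K.setLIntegral_slice_le hR k
    (((hρ.comp K.measurable_up).sub (hρ.comp K.measurable_down)).enorm)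
    (B := ENNReal.ofReal (((2 : ℝ) ^ (k + 1)) ^ p) ^ (1 - 1 / q) * pVar q ρ ^ (1 / q))
    fun F h1 h2 => ?_).trans_eq ?_
  · exact sum_le_card_rpow_mul F _ hq (K.sum_increment_rpow_le F h2)
      (card_le_of_mul_le hp hR k _ hV (K.card_mul_le hp F h1 h2))
  · rw [← mul_assoc, ENNReal.ofReal_rpow_of_nonneg (by positivity) hq',
      ← ENNReal.ofReal_mul (by positivity)]
    congr 2
    rw [← Real.rpow_mul (by positivity), ratio, ← Real.rpow_natCast, ← Real.rpow_natCast,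
      ← Real.rpow_mul (by positivity), ← Real.rpow_mul (by positivity), sub_mul, mul_comm _ (p * _),
      one_mul, Real.rpow_sub two_pos]
    ring

/-- The same counting with the integrand `1`; it makes constants integrable on each slice, as
dominated convergence requires. -/
theorem length_slice_lt_top {p : ℝ} (hp : 1 ≤ p) {s t : I} {R : ℝ}
    (hR : 0 < R) (hV : chainVar p K.lev (Icc (K.lastAt s) (K.lastAt t)) ≤ ENNReal.ofReal R ^ p)
    (k : ℕ) : D.length (D.slice s t R k) < ∞ := by
  have h := K.setLIntegral_slice_le (s := s) (t := t) hR k (g := fun _ => 1) measurable_const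
    (B := ENNReal.ofReal (((2 : ℝ) ^ (k + 1)) ^ p)) fun F h1 h2 => by
      simpa using card_le_of_mul_le hp hR k _ hV (K.card_mul_le hp F h1 h2)
  rw [setLIntegral_const, one_mul] at h
  exact h.trans_lt (by finiteness)

/-- The excursions of positive height are covered by the slices. -/
theorem iUnion_slice {p : ℝ} (hp : 1 ≤ p) {s t : I} {R : ℝ}
    (hR : 0 < R) (hV : chainVar p K.lev (Icc (K.lastAt s) (K.lastAt t)) ≤ ENNReal.ofReal R ^ p) :
    ⋃ k, D.slice s t R k = D.excursions s t ∩ skeleton D.root := by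
  classical
  rw [skeleton_eq_above]
  refine subset_antisymm (iUnion_subset fun k => inter_subset_inter_right _
    (sdiff_subset.trans (above_anti _ (by positivity)))) ?_
  rintro τ ⟨h1, h2⟩
  -- The level oscillates by at most `R` on the window, so no height exceeds `R`.
  have hR' : τ ∉ above D.root R := fun h => by
    obtain ⟨w, hw, hw'⟩ := K.exists_height h1 h
    have h5 := (K.enorm_lev_sub_rpow_le (p := p) h1 hw).trans hV
    rw [ENNReal.rpow_le_rpow_iff (by linarith), ← ofReal_norm, Real.norm_eq_abs,
      ENNReal.ofReal_le_ofReal_iff hR.le] at h5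
    linarith [le_abs_self (K.lev w - K.lev (K.fst τ))]
  have hex : ∃ k : ℕ, τ ∈ above D.root (R / 2 ^ (k + 1)) := by
    obtain ⟨κ, h3, h4⟩ := h2
    obtain ⟨k, hk⟩ := exists_pow_lt_of_lt_one (div_pos h4 hR) (y := (1 / 2 : ℝ)) (by norm_num)
    refine ⟨k, κ, h3, ?_⟩
    rw [lt_div_iff₀ hR] at hk
    refine lt_of_le_of_lt ?_ hk
    rw [div_pow, one_pow, one_div_mul_eq_div]
    exact div_le_div_of_nonneg_left hR.le (by positivity)
      (pow_le_pow_right₀ one_le_two (Nat.le_succ k))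
  -- The least such `k` is the right slice: failure at the previous index is the upper bound on the
  -- height, and for `k = 0` this bound is `hR'`.
  refine mem_iUnion.2 ⟨Nat.find hex, h1, Nat.find_spec hex, ?_⟩
  rcases hk : Nat.find hex with _ | k
  · simpa using hR'
  · exact Nat.find_min hex (by omega)

end Chart

end Coding

end PathTree

end

/-! ### Estimates on time windows and integrals of indicators -/

noncomputable section

namespace PathTree

open Classical in
-- The truth table behind `ae_increment_indicator_one`: `a`, `a'` mean that `τ` is in `[O,A]`,
-- `[O,B]`; `b`, `b'` that `up τ` is at most `s`, `t`; `c`, `c'` the same for `down τ`.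
theorem indicator_identity {a a' b b' c c' : Prop} (h1 : b → b') (h2 : c → c') (h3 : c → b)
    (h4 : c' → b') : (if a then 0 else if ¬ b ∧ b' then 1 else 0) -
      (if a' then 0 else if ¬ c ∧ c' then 1 else 0) =
    (if (a ∨ b') ∧ (a' ∨ ¬ c') then (1 : ℝ) else 0) -
      if (a ∨ b) ∧ (a' ∨ ¬ c) then 1 else 0 := by
  by_cases ha : a <;> by_cases ha' : a' <;> by_cases hc : c <;> by_cases hc' : c' <;>
    by_cases hb : b <;> by_cases hb' : b' <;> simp_all

namespace Coding

namespace Chart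

theorem ratio_pos (p q : ℝ) : 0 < ratio p q := Real.rpow_pos_of_pos two_pos _

/-- This is where Young's condition enters: `1 - 1/q < 1/p` makes the exponent of `2` negative. -/
theorem ratio_lt_one {p q : ℝ} (hp : 1 ≤ p) (hpq : 1 < 1 / p + 1 / q) : ratio p q < 1 := by
  refine Real.rpow_lt_one_of_one_lt_of_neg one_lt_two ?_
  have h1 : 1 - 1 / q < 1 / p := by linarith
  have h2 := mul_lt_mul_of_pos_left h1 (by linarith : 0 < p)
  rw [mul_one_div_cancel (by linarith)] at h2
  linarith

/-- The constant in the estimates of the tree integral. -/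
def youngConst (p q : ℝ) : ℝ≥0 := (ratio p q / (1 - ratio p q)).toNNReal + 2

variable {D : Coding} {ω : I → ℝ} {X : Type*} [ConditionallyCompleteLinearOrder X]
  [BoundedOrder X] [TopologicalSpace X] [OrderTopology X] [DenselyOrdered X] (K : D.Chart ω X)

include K in
theorem restrict_excursions (s t : I) : D.length.restrict (D.excursions s t) =
    D.length.restrict (D.excursions s t ∩ skeleton D.root) := by
  refine Measure.restrict_congr_set (inter_ae_eq_left_of_ae_eq_univ ?_).symm
  rw [ae_eq_univ]
  exact K.isLengthMeasure_length.1

include K in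
theorem ae_ne (σ' : D.Tree) : ∀ᵐ τ ∂D.length, τ ≠ σ' := by
  have := K.isLengthMeasure_length.measure_singleton σ'
  rw [← compl_mem_ae_iff] at this
  exact this

theorem restrict_excursions_of_eq_zero {p : ℝ} (hp : 1 ≤ p) {s t : I}
    (hV : chainVar p K.lev (Icc (K.lastAt s) (K.lastAt t)) = 0) :
    D.length.restrict (D.excursions s t) = 0 := by
  rw [K.restrict_excursions]
  convert! Measure.restrict_empty
  rw [eq_empty_iff_forall_notMem, skeleton_eq_above]
  rintro τ ⟨h1, h2⟩
  obtain ⟨w, hw, hw'⟩ := K.exists_height h1 h2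
  have h := K.enorm_lev_sub_rpow_le (p := p) h1 hw
  rw [hV, nonpos_iff_eq_zero, ENNReal.rpow_eq_zero_iff_of_pos (by linarith), enorm_eq_zero] at h
  linarith

/-- With `R = V^(1/p)` the slices exhaust the skeleton part of the excursions, and their bounds form
a geometric series. -/
theorem setLIntegral_excursions_le {p q : ℝ} (hp : 1 ≤ p) (hq : 1 ≤ q) (hpq : 1 < 1 / p + 1 / q)
    {s t : I} (hV : chainVar p K.lev (Icc (K.lastAt s) (K.lastAt t)) ≠ ∞)
    {ρ : I → ℝ} (hρ : Measurable ρ) :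
    ∫⁻ τ in D.excursions s t, ‖ρ (up τ) - ρ (down τ)‖ₑ ∂D.length ≤
      ENNReal.ofReal (ratio p q / (1 - ratio p q)) *
        chainVar p K.lev (Icc (K.lastAt s) (K.lastAt t)) ^ (1 / p) * pVar q ρ ^ (1 / q) := by
  by_cases h0 : chainVar p K.lev (Icc (K.lastAt s) (K.lastAt t)) = 0
  · rw [K.restrict_excursions_of_eq_zero hp h0, lintegral_zero_measure]; exact zero_le
  have hp0 : 0 < p := by linarith
  set V := chainVar p K.lev (Icc (K.lastAt s) (K.lastAt t)) with hVdef
  have hV1 : V ^ (1 / p) ≠ ∞ := ENNReal.rpow_ne_top_of_nonneg (by positivity) hV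
  have hV2 : V ^ (1 / p) ≠ 0 := by simp [h0, hV]
  obtain ⟨R, hR⟩ : ∃ R, R = (V ^ (1 / p)).toReal := ⟨_, rfl⟩
  have hR0 : 0 < R := hR ▸ ENNReal.toReal_pos hV2 hV1
  have hR1 : ENNReal.ofReal R = V ^ (1 / p) := by rw [hR, ENNReal.ofReal_toReal hV1]
  have hR2 : V ≤ ENNReal.ofReal R ^ p := by
    rw [hR1, ← ENNReal.rpow_mul, one_div_mul_cancel hp0.ne', ENNReal.rpow_one]
  have hr0 := ratio_pos p q
  have hr1 := ratio_lt_one hp hpq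
  have hsum : ∑' k : ℕ, ENNReal.ofReal (R * ratio p q ^ (k + 1)) =
      ENNReal.ofReal (ratio p q / (1 - ratio p q)) * V ^ (1 / p) := by
    have hs : Summable fun k : ℕ => R * ratio p q ^ (k + 1) :=
      (((summable_geometric_of_lt_one hr0.le hr1).mul_left (ratio p q)).congr
        fun k => (pow_succ' _ _).symm).mul_left R
    rw [← hR1, ← ENNReal.ofReal_mul (by have := sub_pos.2 hr1; positivity),
      ← ENNReal.ofReal_tsum_of_nonneg (fun k => by positivity) hs, tsum_mul_left]
    simp_rw [pow_succ']
    rw [tsum_mul_left, tsum_geometric_of_lt_one hr0.le hr1]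
    congr 1; ring
  rw [K.restrict_excursions, ← K.iUnion_slice hp hR0 hR2, ← hsum, ← ENNReal.tsum_mul_right]
  exact (lintegral_iUnion_le _ _).trans (ENNReal.tsum_le_tsum fun k =>
    K.setLIntegral_slice_increment_le hp hq hR0 hR2 hρ k)

omit [DenselyOrdered X] in
-- The arc descends to the lowest point and climbs back; each half is at most `V_p^(1/p)`, whence
-- the factor `2`.
theorem edist_toTree_le {p : ℝ} (hp : 1 ≤ p) {x y : X} (hxy : x ≤ y) :
    edist (K.toTree x) (K.toTree y) ≤ 2 * chainVar p K.lev (Icc x y) ^ (1 / p) := by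
  obtain ⟨z, hz, hlow⟩ := K.exists_lev_eq_low x y
  rw [uIcc_of_le hxy] at hz
  have hp0 : 0 < p := by linarith
  have key : ∀ {a b : ℝ}, ‖a - b‖ₑ ^ p ≤ chainVar p K.lev (Icc x y) →
      ENNReal.ofReal (a - b) ≤ chainVar p K.lev (Icc x y) ^ (1 / p) := fun {a b} h => by
    rw [one_div, ENNReal.le_rpow_inv_iff hp0]
    refine le_trans (ENNReal.rpow_le_rpow ?_ hp0.le) h
    rw [← ofReal_norm]
    exact ENNReal.ofReal_le_ofReal (le_abs_self _)
  have h1 := key (a := K.lev y) (b := K.lev z)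
    (enorm_rpow_le_chainVar hz.2 hz (right_mem_Icc.2 hxy))
  have h2 := key (a := K.lev x) (b := K.lev z) (by
    rw [enorm_sub_rev]; exact enorm_rpow_le_chainVar hz.1 (left_mem_Icc.2 hxy) hz)
  rw [edist_dist, K.dist_toTree, ← hlow, two_mul, two_mul,
    show K.lev x + K.lev y - (K.lev z + K.lev z) = (K.lev x - K.lev z) + (K.lev y - K.lev z) by ring]
  exact ENNReal.ofReal_add_le.trans (add_le_add h2 h1)

theorem ae_enorm_increment_le (s t : I) (ρ : I → ℝ) : ∀ᵐ τ ∂D.length,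
    ‖D.increment ((Ioc s t).indicator ρ) τ‖ₑ ≤
      (D.excursions s t).indicator (fun τ => ‖ρ (up τ) - ρ (down τ)‖ₑ) τ +
      (arc (K.toTree (K.lastAt s)) (K.toTree (K.lastAt t))).indicator (fun _ => supAbs ρ) τ := by
  filter_upwards [K.ae_ne D.root] with τ hτ
  by_cases h : τ ∈ D.excursions s t
  · rw [K.increment_of_mem ρ h, indicator_of_mem h]
    exact le_self_add
  · rw [indicator_of_notMem h, zero_add]
    exact K.enorm_increment_le_of_notMem ρ h hτ

/-- The estimate of the tree integral on a time interval. -/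
theorem lintegral_increment_indicator_le {p q : ℝ} (hp : 1 ≤ p) (hq : 1 ≤ q)
    (hpq : 1 < 1 / p + 1 / q) {s t : I} (hst : s ≤ t) (ρ : I → ℝ) :
    ∫⁻ τ, ‖D.increment ((Ioc s t).indicator ρ) τ‖ₑ ∂D.length ≤
      youngConst p q * chainVar p K.lev (Icc (K.lastAt s) (K.lastAt t)) ^ (1 / p) *
        (pVar q ρ ^ (1 / q) + supAbs ρ) := by
  have hp0 : 0 < p := by linarith
  have hq0 : 0 < q := by linarith
  have hC : (youngConst p q : ℝ≥0∞) = ENNReal.ofReal (ratio p q / (1 - ratio p q)) + 2 := by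
    simp [youngConst, ENNReal.ofReal]
  have hC0 : (youngConst p q : ℝ≥0∞) ≠ 0 := by simp [hC]
  -- Here the right-hand side may be `∞ * 0 = 0`, so the integrand has to vanish identically.
  by_cases hρ0 : supAbs ρ = 0
  · have : (Ioc s t).indicator ρ = fun _ => 0 := by
      ext u
      have h : ‖ρ u‖ₑ ≤ 0 := hρ0 ▸ le_iSup (fun t => ‖ρ t‖ₑ) u
      rw [nonpos_iff_eq_zero, enorm_eq_zero] at h
      rw [indicator_apply_eq_zero]; exact fun _ => h
    rw [this]
    simp [increment_zero]
  set V := chainVar p K.lev (Icc (K.lastAt s) (K.lastAt t)) with hV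
  have harc : D.length (arc (K.toTree (K.lastAt s)) (K.toTree (K.lastAt t))) ≤ 2 * V ^ (1 / p) := by
    rw [K.isLengthMeasure_length.2]
    exact K.edist_toTree_le hp (K.lastAt_mono hst)
  have hle : ∫⁻ τ, ‖D.increment ((Ioc s t).indicator ρ) τ‖ₑ ∂D.length ≤
      ∫⁻ τ in D.excursions s t, ‖ρ (up τ) - ρ (down τ)‖ₑ ∂D.length +
        supAbs ρ * (2 * V ^ (1 / p)) := by
    have hm := (isClosed_arc (K.toTree (K.lastAt s)) (K.toTree (K.lastAt t))).measurableSet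
    refine (lintegral_mono_ae (K.ae_enorm_increment_le s t ρ)).trans ?_
    rw [lintegral_add_right _ (measurable_const.indicator hm),
      lintegral_indicator (K.measurableSet_excursions s t), lintegral_indicator hm,
      setLIntegral_const]
    gcongr
  -- When `V = 0` both parts of the bound vanish, even if `sup |ρ| = ∞`. Afterwards all factors are
  -- nonzero, so an infinite one makes the right-hand side infinite.
  by_cases hV0 : V = 0
  · rw [K.restrict_excursions_of_eq_zero hp hV0, lintegral_zero_measure, hV0] at hle
    exact hle.trans (by simp [hp0])
  by_cases hVt : V = ∞
  · rw [hVt, ENNReal.top_rpow_of_pos (by positivity), ENNReal.mul_top hC0, ENNReal.top_mul]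
    · exact le_top
    · simp [hρ0]
  by_cases hqt : pVar q ρ = ∞
  · rw [hqt, ENNReal.top_rpow_of_pos (by positivity), top_add, ENNReal.mul_top]
    · exact le_top
    · exact mul_ne_zero hC0 (by simp [hV0, hVt])
  -- Finite `q`-variation is what makes `ρ` Borel, which the slicing needs; hence the infinite cases
  -- had to be settled before.
  have hρm := measurable_of_countable_not_continuousAt
    (countable_not_continuousAt hq (lt_top_iff_ne_top.2 hqt))
  refine hle.trans ((add_le_add_left (K.setLIntegral_excursions_le hp hq hpq hVt hρm) _).trans ?_)
  rw [hC, ← hV, mul_add]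
  refine add_le_add ?_ ?_
  · gcongr
    exact le_self_add
  · rw [mul_comm]
    gcongr
    exact le_add_self

include K in
-- The window omits only time `0`, and all the points at time `0` project to the single point `A`,
-- which is null.
theorem ae_increment_indicator_Ioc (ρ : I → ℝ) :
    D.increment ((Ioc 0 1).indicator ρ) =ᵐ[D.length] D.increment ρ := by
  classical
  filter_upwards [K.ae_ne D.root, K.ae_ne D.ptA] with τ h0 hA
  have h1 : K.lst τ ≤ K.lastAt 0 → False := fun h => hA (by rw [← K.toTree_lst τ, K.toTree_of_le h])
  have h2 : K.fst τ ≤ K.lastAt 0 → False := fun h => hA (by rw [← K.toTree_fst τ, K.toTree_of_le h])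
  have e1 : up τ ∈ Ioc (0 : I) 1 := ⟨by rw [← not_le, K.up_le_iff]; exact h2, unitInterval.le_one'⟩
  have e2 : down τ ∈ Ioc (0 : I) 1 :=
    ⟨by rw [← not_le, K.down_le_iff]; exact h1, unitInterval.le_one'⟩
  rw [increment, increment, valUp_of_ne_root h0, valUp_of_ne_root h0, valDown_of_ne_root h0,
    valDown_of_ne_root h0, indicator_of_mem e1, indicator_of_mem e2]

/-- The points at times `s` and `t` are discarded as null, so that comparisons of last visits with
`lastAt` become strict; the rest is `mem_arc_iff` and propositional logic. -/
theorem ae_increment_indicator_one {s t : I} (hst : s ≤ t) :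
    D.increment ((Ioc s t).indicator fun _ => 1) =ᵐ[D.length] fun τ =>
      (arc D.root (K.toTree (K.lastAt t))).indicator (fun _ => (1 : ℝ)) τ -
        (arc D.root (K.toTree (K.lastAt s))).indicator (fun _ => (1 : ℝ)) τ := by
  classical
  filter_upwards [K.ae_ne D.root, K.ae_ne (K.toTree (K.lastAt s)),
    K.ae_ne (K.toTree (K.lastAt t))] with τ h0 hs ht
  have hs' : K.lastAt s ≤ K.lst τ ↔ ¬ down τ ≤ s := by
    rw [K.down_le_iff]
    refine ⟨fun h h' => hs ?_, fun h => (not_le.1 h).le⟩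
    rw [← le_antisymm h' h, K.toTree_lst]
  have ht' : K.lastAt t ≤ K.lst τ ↔ ¬ down τ ≤ t := by
    rw [K.down_le_iff]
    refine ⟨fun h h' => ht ?_, fun h => (not_le.1 h).le⟩
    rw [← le_antisymm h' h, K.toTree_lst]
  have hud := K.up_le_down τ
  have h1 : up τ ≤ s → up τ ≤ t := fun h => h.trans hst
  have h2 : down τ ≤ s → down τ ≤ t := fun h => h.trans hst
  have h3 : down τ ≤ s → up τ ≤ s := hud.trans
  have h4 : down τ ≤ t → up τ ≤ t := hud.trans
  rw [increment, valUp_of_ne_root h0, valDown_of_ne_root h0]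
  simp only [indicator_apply, K.mem_arc_iff, ← K.up_le_iff, hs', ht', mem_Ioc, ← not_le]
  exact indicator_identity h1 h2 h3 h4

include K in
-- The two arcs from the root have lengths equal to the levels at `t` and `s` up to a common
-- constant.
theorem integral_increment_indicator_one {s t : I} (hst : s ≤ t) :
    Integrable (D.increment ((Ioc s t).indicator fun _ => 1)) D.length ∧
      D.integral ((Ioc s t).indicator fun _ => 1) = ω t - ω s := by
  have hi : ∀ x : D.Tree,
      Integrable ((arc D.root x).indicator fun _ => (1 : ℝ)) D.length := fun x => by
    rw [integrable_indicator_iff (isClosed_arc _ _).measurableSet]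
    refine integrableOn_const ?_
    rw [K.isLengthMeasure_length.2]
    exact edist_ne_top _ _
  have hv : ∀ x : D.Tree, ∫ τ, (arc D.root x).indicator (fun _ => (1 : ℝ)) τ ∂D.length =
      dist D.root x := fun x => by
    rw [integral_indicator_const _ (isClosed_arc _ _).measurableSet, measureReal_def,
      K.isLengthMeasure_length.2, edist_dist, ENNReal.toReal_ofReal dist_nonneg, smul_eq_mul,
      mul_one]
  have hae := K.ae_increment_indicator_one hst
  refine ⟨((hi _).sub (hi _)).congr hae.symm, ?_⟩
  rw [integral, integral_congr_ae hae, integral_sub (hi _) (hi _), hv, hv, K.dist_root_sub, lev,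
    lev, K.level_lastAt, K.level_lastAt]

end Chart

end Coding

end PathTree

end

/-! ### Step functions, dominated convergence and Riemann sums -/

noncomputable section

namespace PathTree

/-- The strict inequality leaves room to replace the variation indices by exponents with finite
variation. Neither inverse index exceeds `1`, so neither is `0`, which allows both to be decreased.
-/
theorem exists_exponents {ω ρ : I → ℝ} (h : 1 < (varIndex ω)⁻¹ + (varIndex ρ)⁻¹) :
    ∃ p q : ℝ, 1 ≤ p ∧ 1 ≤ q ∧ 1 < 1 / p + 1 / q ∧ pVar p ω < ∞ ∧ pVar q ρ < ∞ := by
  have h1 : ∀ f : I → ℝ, (varIndex f)⁻¹ ≤ 1 := fun f => by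
    rw [ENNReal.inv_le_one]
    exact le_iInf₂ fun p hp => ENNReal.one_le_ofReal.2 hp.1
  have hne : ∀ f g : I → ℝ, 1 < (varIndex f)⁻¹ + (varIndex g)⁻¹ → (varIndex f)⁻¹ ≠ 0 :=
    fun f g h h0 => by
      rw [h0, zero_add] at h
      exact h.not_ge (h1 g)
  have key : ∀ (f : I → ℝ) (a : ℝ≥0∞), a < (varIndex f)⁻¹ →
      ∃ p, 1 ≤ p ∧ pVar p f < ∞ ∧ a < ENNReal.ofReal (1 / p) := fun f a ha => by
    rw [ENNReal.lt_inv_iff_lt_inv, varIndex] at ha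
    simp only [iInf_lt_iff] at ha
    obtain ⟨p, ⟨hp, hf⟩, hpa⟩ := ha
    refine ⟨p, hp, hf, ?_⟩
    rw [one_div, ENNReal.ofReal_inv_of_pos (by linarith), ENNReal.lt_inv_iff_lt_inv]
    exact hpa
  obtain ⟨a, ha, b, hb, hab⟩ := ENNReal.exists_lt_add_of_lt_add h (hne ω ρ h)
    (hne ρ ω (by rwa [add_comm]))
  obtain ⟨p, hp, hpω, hpa⟩ := key ω a ha
  obtain ⟨q, hq, hqρ, hqb⟩ := key ρ b hb
  refine ⟨p, q, hp, hq, ?_, hpω, hqρ⟩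
  have := hab.trans (ENNReal.add_lt_add hpa hqb)
  rwa [← ENNReal.ofReal_add (by positivity) (by positivity), ENNReal.one_lt_ofReal] at this

theorem supAbs_ne_top {q : ℝ} (hq : 1 ≤ q) {ρ : I → ℝ} (h : pVar q ρ < ∞) : supAbs ρ ≠ ∞ := by
  have hq0 : 0 < q := by linarith
  refine ne_top_of_le_ne_top (b := ‖ρ 0‖ₑ + pVar q ρ ^ (1 / q))
    (ENNReal.add_ne_top.2 ⟨enorm_ne_top, ENNReal.rpow_ne_top_of_nonneg (by positivity) h.ne⟩)
    (iSup_le fun t => ?_)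
  have h1 := (enorm_rpow_le_chainVar (p := q) (g := ρ) (s := univ) (unitInterval.nonneg' (t := t))
    (mem_univ _) (mem_univ _)).trans chainVar_le_pVar
  rw [← ENNReal.le_rpow_inv_iff hq0, ← one_div] at h1
  calc ‖ρ t‖ₑ = ‖ρ 0 + (ρ t - ρ 0)‖ₑ := by congr 1; ring
    _ ≤ _ := (enorm_add_le _ _).trans (by gcongr)

theorem pVar_comp_le {q : ℝ} {ρ : I → ℝ} {φ : I → I} (hφ : Monotone φ) :
    pVar q (ρ ∘ φ) ≤ pVar q ρ :=
  pVar_le_chainVar.trans ((chainVar_comp_le hφ (mapsTo_univ _ _)).trans chainVar_le_pVar)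

theorem supAbs_comp_le {ρ : I → ℝ} {φ : I → I} : supAbs (ρ ∘ φ) ≤ supAbs ρ :=
  iSup_le fun t => le_iSup (fun t => ‖ρ t‖ₑ) (φ t)

/-- The function which is constant and equal to the tag on each interval of a subdivision. -/
theorem exists_tag_function {n : ℕ} {t s : ℕ → I} (ht : IsSubdivision n t)
    (hs : ∀ i < n, t i ≤ s i ∧ s i ≤ t (i + 1)) {η : ℝ}
    (hη : ∀ i < n, (t (i + 1) : ℝ) - t i < η) :
    ∃ φ : I → I, Monotone φ ∧ (∀ u, dist (φ u) u < η) ∧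
      ∀ ρ : I → ℝ, (Ioc 0 1).indicator (ρ ∘ φ) = fun u =>
        ∑ i ∈ Finset.range n, ρ (s i) * (Ioc (t i) (t (i + 1))).indicator (fun _ => 1) u := by
  classical
  obtain ⟨hm, h0, h1⟩ := ht
  obtain ⟨m, rfl⟩ : ∃ m, n = m + 1 := Nat.exists_eq_succ_of_ne_zero fun h => by
    rw [h, h0] at h1; exact zero_ne_one h1
  have hex : ∀ u : I, ∃ i, u ≤ t (i + 1) := fun u => ⟨m, h1 ▸ unitInterval.le_one'⟩
  -- The first interval whose right end reaches `u`. For `u > 0` it is the one with `u ∈ (t k, t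
  -- (k+1)]`; intervals of length zero are skipped.
  set k : I → ℕ := fun u => Nat.find (hex u) with hk
  have hk1 : ∀ u, u ≤ t (k u + 1) := fun u => Nat.find_spec (hex u)
  have hk2 : ∀ u, k u < m + 1 := fun u =>
    Nat.lt_succ_of_le (Nat.find_min' (hex u) (h1 ▸ unitInterval.le_one'))
  have hk3 : ∀ u, t (k u) ≤ u := fun u => by
    rcases h : k u with _ | j
    · rw [h0]; exact unitInterval.nonneg'
    · exact (not_le.1 (Nat.find_min (hex u) (m := j) (by rw [hk] at h; dsimp only at h; omega))).le
  have hk4 : ∀ u, 0 < u → t (k u) < u := fun u hu => by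
    rcases h : k u with _ | j
    · rwa [h0]
    · exact not_le.1 (Nat.find_min (hex u) (m := j) (by rw [hk] at h; dsimp only at h; omega))
  refine ⟨fun u => s (k u), fun u v huv => ?_, fun u => ?_, fun ρ => ?_⟩
  · have hkk : k u ≤ k v := Nat.find_min' (hex u) (huv.trans (hk1 v))
    rcases hkk.eq_or_lt with h | h
    · dsimp only; rw [h]
    · exact (hs _ (hk2 u)).2.trans ((hm h).trans (hs _ (hk2 v)).1)
  · have a1 := hη _ (hk2 u)
    have a2 : (t (k u) : ℝ) ≤ s (k u) := (hs _ (hk2 u)).1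
    have a3 : (s (k u) : ℝ) ≤ t (k u + 1) := (hs _ (hk2 u)).2
    have a4 : (t (k u) : ℝ) ≤ u := hk3 u
    have a5 : (u : ℝ) ≤ t (k u + 1) := hk1 u
    rw [Subtype.dist_eq, Real.dist_eq, abs_lt]
    constructor <;> linarith
  · ext u
    rcases (unitInterval.nonneg' (t := u)).eq_or_lt with rfl | hu
    · rw [indicator_of_notMem (by simp)]
      refine (Finset.sum_eq_zero fun i _ => ?_).symm
      rw [indicator_of_notMem (fun h => h.1.not_ge unitInterval.nonneg'), mul_zero]
    · rw [indicator_of_mem (show u ∈ Ioc 0 1 from ⟨hu, unitInterval.le_one'⟩),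
        Finset.sum_eq_single_of_mem (k u) (Finset.mem_range.2 (hk2 u)),
        indicator_of_mem (show u ∈ Ioc (t (k u)) (t (k u + 1)) from ⟨hk4 u hu, hk1 u⟩), mul_one]
      · rfl
      · intro i _ hi
        rw [indicator_of_notMem, mul_zero]
        intro h
        have h2 : k u ≤ i := Nat.find_min' (hex u) h.2
        have h3 : k u + 1 ≤ i := lt_of_le_of_ne h2 hi.symm
        exact h.1.not_ge ((hk1 u).trans (hm h3))

namespace Coding

variable {D : Coding}

theorem increment_sum {ι : Type*} (F : Finset ι) (c : ι → ℝ) (g : ι → I → ℝ) (τ : D.Tree) :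
    D.increment (fun u => ∑ i ∈ F, c i * g i u) τ = ∑ i ∈ F, c i * D.increment (g i) τ := by
  classical
  induction F using Finset.induction_on with
  | empty => simp [increment_zero]
  | insert i F hi ih =>
    simp only [Finset.sum_insert hi]
    rw [increment_add, increment_const_mul, ih]

theorem tendsto_increment {ρ : I → ℝ} {ρ' : ℕ → I → ℝ} {τ : D.Tree}
    (h1 : Tendsto (fun n => ρ' n (up τ)) atTop (𝓝 (ρ (up τ))))
    (h2 : Tendsto (fun n => ρ' n (down τ)) atTop (𝓝 (ρ (down τ)))) :
    Tendsto (fun n => D.increment (ρ' n) τ) atTop (𝓝 (D.increment ρ τ)) := by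
  refine Tendsto.sub ?_ ?_
  · unfold valUp; split_ifs; exacts [tendsto_const_nhds, h1]
  · unfold valDown; split_ifs; exacts [tendsto_const_nhds, h2]

theorem norm_increment_le {ρ : I → ℝ} {M : ℝ} (hM : ∀ u, ‖ρ u‖ ≤ M) (τ : D.Tree) :
    ‖D.increment ρ τ‖ ≤ M + M := by
  have h0 : 0 ≤ M := (norm_nonneg _).trans (hM 0)
  refine (norm_sub_le _ _).trans (add_le_add ?_ ?_)
  · unfold valUp; split_ifs; exacts [by simpa using h0, hM _]
  · unfold valDown; split_ifs; exacts [by simpa using h0, hM _]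

namespace Chart

variable {ω : I → ℝ} {X : Type*} [ConditionallyCompleteLinearOrder X]
  [BoundedOrder X] [TopologicalSpace X] [OrderTopology X] [DenselyOrdered X] (K : D.Chart ω X)

include K in
theorem integrable_increment_indicator {p q : ℝ} (hp : 1 ≤ p) (hq : 1 ≤ q)
    (hpq : 1 < 1 / p + 1 / q) (hω : pVar p ω < ∞) {ρ : I → ℝ} (hρ : pVar q ρ < ∞) {s t : I}
    (hst : s ≤ t) : Integrable (D.increment ((Ioc s t).indicator ρ)) D.length := by
  have hρm := measurable_of_countable_not_continuousAt (countable_not_continuousAt hq hρ)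
  refine ⟨(K.measurable_increment (hρm.indicator measurableSet_Ioc)).aestronglyMeasurable, ?_⟩
  refine (K.lintegral_increment_indicator_le hp hq hpq hst ρ).trans_lt ?_
  have h1 : chainVar p K.lev (Icc (K.lastAt s) (K.lastAt t)) < ∞ :=
    ((chainVar_mono (subset_univ _)).trans (K.chainVar_le p hp)).trans_lt hω
  have h2 := supAbs_ne_top hq hρ
  have h3 : 0 ≤ 1 / p := by positivity
  have h4 : 0 ≤ 1 / q := by positivity
  refine ENNReal.mul_lt_top (ENNReal.mul_lt_top (by finiteness) ?_) (ENNReal.add_lt_top.2 ⟨?_, ?_⟩)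
  exacts [ENNReal.rpow_lt_top_of_nonneg h3 h1.ne, ENNReal.rpow_lt_top_of_nonneg h4 hρ.ne, h2.lt_top]

include K in
-- By linearity, tree integrals of step functions are Riemann sums.
theorem integral_increment_sum {n : ℕ} {t : ℕ → I} (ht : Monotone t) (c : ℕ → ℝ) :
    D.integral (fun u => ∑ i ∈ Finset.range n,
      c i * (Ioc (t i) (t (i + 1))).indicator (fun _ => 1) u) =
    ∑ i ∈ Finset.range n, c i * (ω (t (i + 1)) - ω (t i)) := by
  have h := fun i => K.integral_increment_indicator_one (ht (Nat.le_succ i))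
  unfold integral at h ⊢
  simp_rw [increment_sum]
  rw [integral_finsetSum _ fun i _ => (h i).1.const_mul _]
  refine Finset.sum_congr rfl fun i _ => ?_
  rw [integral_const_mul, (h i).2]

/-- There are countably many bad times, and by `hN` each corresponds to a single point of the tree,
hence to a null set. This is where jumps common to `ρ` and `ω` are excluded. -/
theorem ae_continuousAt {ρ : I → ℝ} (hc : {u | ¬ ContinuousAt ρ u}.Countable)
    (hN : ∀ u, ¬ ContinuousAt ρ u → ∀ x y, K.tm x = u → K.tm y = u → K.toTree x = K.toTree y) :
    ∀ᵐ τ ∂D.length, ContinuousAt ρ (up τ) ∧ ContinuousAt ρ (down τ) := by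
  have key : ∀ (w : D.Tree → X), (∀ τ, K.toTree (w τ) = τ) →
      ∀ᵐ τ ∂D.length, ContinuousAt ρ (K.tm (w τ)) := fun w hw => by
    have : ∀ᵐ τ ∂D.length, ∀ u ∈ {u | ¬ ContinuousAt ρ u}, K.tm (w τ) ≠ u := by
      rw [ae_ball_iff hc]
      intro u hu
      by_cases hex : ∃ τ, K.tm (w τ) = u
      · obtain ⟨τ₀, h0⟩ := hex
        filter_upwards [K.ae_ne τ₀] with τ hτ h
        exact hτ (by rw [← hw τ, hN u hu _ _ h h0, hw])
      · exact Eventually.of_forall fun τ h => hex ⟨τ, h⟩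
    filter_upwards [this] with τ hτ
    by_contra h
    exact hτ _ h rfl
  filter_upwards [key _ K.toTree_fst, key _ K.toTree_lst] with τ h1 h2
  rw [K.up_eq, K.down_eq]
  exact ⟨h1, h2⟩

/-- Three dominations: a constant on each slice, which has finite length; the geometric bound over
the slices, uniform in `n` since `φ n` does not increase the `q`-variation; and `sup |ρ|` on the arc
for the complement of the excursions. -/
theorem tendsto_integral {p q : ℝ} (hp : 1 ≤ p) (hq : 1 ≤ q)
    (hpq : 1 < 1 / p + 1 / q) (hω : pVar p ω < ∞) {ρ : I → ℝ} (hρ : pVar q ρ < ∞)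
    (hN : ∀ u, ¬ ContinuousAt ρ u → ∀ x y, K.tm x = u → K.tm y = u → K.toTree x = K.toTree y)
    {φ : ℕ → I → I} (hφ : ∀ n, Monotone (φ n))
    (hlim : ∀ u, Tendsto (fun n => φ n u) atTop (𝓝 u)) :
    Tendsto (fun n => D.integral ((Ioc 0 1).indicator (ρ ∘ φ n))) atTop
      (𝓝 (D.integral ((Ioc 0 1).indicator ρ))) := by
  have hp0 : 0 < p := by linarith
  have hq0 : 0 < q := by linarith
  have hc := countable_not_continuousAt hq hρ
  have hφq : ∀ n, pVar q (ρ ∘ φ n) < ∞ := fun n => (pVar_comp_le (hφ n)).trans_lt hρ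
  have hm : ∀ n, Measurable (ρ ∘ φ n) := fun n =>
    measurable_of_countable_not_continuousAt (countable_not_continuousAt hq (hφq n))
  have hM := supAbs_ne_top hq hρ
  have hb : ∀ u, ‖ρ u‖ ≤ (supAbs ρ).toReal := fun u => by
    rw [← toReal_enorm]
    exact ENNReal.toReal_mono hM (le_iSup (fun t => ‖ρ t‖ₑ) u)
  have hbi : ∀ n u, ‖(Ioc 0 1).indicator (ρ ∘ φ n) u‖ ≤ (supAbs ρ).toReal := fun n u =>
    (norm_indicator_le_norm_self _ _).trans (hb _)
  have hint : ∀ n, Integrable (D.increment ((Ioc 0 1).indicator (ρ ∘ φ n))) D.length := fun n =>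
    K.integrable_increment_indicator hp hq hpq hω (hφq n) unitInterval.nonneg'
  have hint' : Integrable (D.increment ((Ioc 0 1).indicator ρ)) D.length :=
    K.integrable_increment_indicator hp hq hpq hω hρ unitInterval.nonneg'
  have hae : ∀ᵐ τ ∂D.length, Tendsto (fun n => D.increment ((Ioc 0 1).indicator (ρ ∘ φ n)) τ) atTop
      (𝓝 (D.increment ((Ioc 0 1).indicator ρ) τ)) := by
    filter_upwards [K.ae_continuousAt hc hN] with τ hτ
    have key : ∀ u, ContinuousAt ρ u → Tendsto (fun n => (Ioc 0 1).indicator (ρ ∘ φ n) u) atTop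
        (𝓝 ((Ioc 0 1).indicator ρ u)) := fun u hu => by
      by_cases h : u ∈ Ioc (0 : I) 1
      · simp only [indicator_of_mem h]
        exact hu.tendsto.comp (hlim u)
      · simp only [indicator_of_notMem h]
        exact tendsto_const_nhds
    exact tendsto_increment (key _ hτ.1) (key _ hτ.2)
  set E := D.excursions 0 1
  have hE : MeasurableSet E := K.measurableSet_excursions 0 1
  -- a level above the height of the tree
  have hV : chainVar p K.lev (Icc (K.lastAt 0) (K.lastAt 1)) < ∞ :=
    ((chainVar_mono (subset_univ _)).trans (K.chainVar_le p hp)).trans_lt hω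
  obtain ⟨R, hR, hVR⟩ : ∃ R : ℝ, 0 < R ∧
      chainVar p K.lev (Icc (K.lastAt 0) (K.lastAt 1)) ≤ ENNReal.ofReal R ^ p := by
    have h1 : chainVar p K.lev (Icc (K.lastAt 0) (K.lastAt 1)) ^ (1 / p) ≠ ∞ :=
      ENNReal.rpow_ne_top_of_nonneg (by positivity) hV.ne
    refine ⟨(chainVar p K.lev (Icc (K.lastAt 0) (K.lastAt 1)) ^ (1 / p)).toReal + 1,
      by positivity, ?_⟩
    rw [← ENNReal.rpow_inv_le_iff hp0, ← one_div]
    refine (ENNReal.ofReal_toReal h1).ge.trans (ENNReal.ofReal_le_ofReal (by linarith))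
  have hSm := K.measurableSet_slice 0 1 hR
  have hdecomp : ∀ g : D.Tree → ℝ, Integrable g D.length →
      ∫ τ, g τ ∂D.length = ∑' k, ∫ τ in D.slice 0 1 R k, g τ ∂D.length +
        ∫ τ in Eᶜ, g τ ∂D.length := fun g hg => by
    rw [← integral_add_compl hE hg, K.restrict_excursions, ← K.iUnion_slice hp hR hVR,
      integral_iUnion hSm (slice_disjoint 0 1 hR) hg.integrableOn]
  unfold integral
  simp_rw [fun n => hdecomp _ (hint n), hdecomp _ hint']
  refine Tendsto.add ?_ ?_
  · refine tendsto_tsum_of_dominated_convergence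
      (bound := fun k => R * ratio p q ^ (k + 1) * (pVar q ρ ^ (1 / q)).toReal) ?_ (fun k => ?_)
      (Eventually.of_forall fun n k => ?_)
    · have hr0 := ratio_pos p q
      have hr1 := ratio_lt_one hp hpq
      exact ((((summable_geometric_of_lt_one hr0.le hr1).mul_left (ratio p q)).congr
        fun k => (pow_succ' _ _).symm).mul_left R).mul_right _
    · have := K.length_slice_lt_top hp hR hVR k
      refine tendsto_integral_of_dominated_convergence
        (fun _ => (supAbs ρ).toReal + (supAbs ρ).toReal)
        (fun n => (hint n).aestronglyMeasurable.restrict) (integrableOn_const this.ne)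
        (fun n => Eventually.of_forall fun τ => norm_increment_le (hbi n) τ)
        (ae_restrict_of_ae hae)
    · have hr0 := ratio_pos p q
      have h1 : ‖∫ τ in D.slice 0 1 R k, D.increment ((Ioc 0 1).indicator (ρ ∘ φ n)) τ ∂D.length‖ₑ ≤
          ENNReal.ofReal (R * ratio p q ^ (k + 1)) * pVar q ρ ^ (1 / q) := by
        refine (enorm_integral_le_lintegral_enorm _).trans ?_
        rw [setLIntegral_congr_fun (g := fun τ => ‖(ρ ∘ φ n) (up τ) - (ρ ∘ φ n) (down τ)‖ₑ) (hSm k)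
          fun τ hτ => by dsimp only; rw [K.increment_of_mem _ hτ.1]]
        refine (K.setLIntegral_slice_increment_le hp hq hR hVR (hm n) k).trans ?_
        gcongr
        exact pVar_comp_le (hφ n)
      have h2 := ENNReal.toReal_mono (ENNReal.mul_ne_top ENNReal.ofReal_ne_top
        (ENNReal.rpow_ne_top_of_nonneg (by positivity) hρ.ne)) h1
      rwa [toReal_enorm, ENNReal.toReal_mul, ENNReal.toReal_ofReal (by positivity)] at h2
  · set B := arc (K.toTree (K.lastAt 0)) (K.toTree (K.lastAt 1))
    have hBm : MeasurableSet B := (isClosed_arc _ _).measurableSet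
    refine tendsto_integral_of_dominated_convergence (B.indicator fun _ => (supAbs ρ).toReal)
      (fun n => (hint n).aestronglyMeasurable.restrict) ?_ (fun n => ?_) (ae_restrict_of_ae hae)
    · refine Integrable.integrableOn ?_
      rw [integrable_indicator_iff hBm]
      refine integrableOn_const ?_
      rw [K.isLengthMeasure_length.2]
      exact edist_ne_top _ _
    · rw [ae_restrict_iff' hE.compl]
      filter_upwards [K.ae_ne D.root] with τ h0 hτ
      have h1 := K.enorm_increment_le_of_notMem (s := 0) (t := 1) (ρ ∘ φ n) hτ h0
      have h2 : ‖D.increment ((Ioc 0 1).indicator (ρ ∘ φ n)) τ‖ₑ ≤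
          B.indicator (fun _ => supAbs ρ) τ :=
        h1.trans (indicator_le_indicator supAbs_comp_le)
      rw [← toReal_enorm]
      by_cases hB : τ ∈ B
      · rw [indicator_of_mem hB] at h2 ⊢
        exact ENNReal.toReal_mono hM h2
      · rw [indicator_of_notMem hB] at h2 ⊢
        exact (ENNReal.toReal_mono ENNReal.zero_ne_top h2).trans_eq ENNReal.toReal_zero

/-- If convergence failed, choose bad tagged subdivisions with mesh tending to `0`. Their Riemann
sums are tree integrals of `ρ ∘ φ j` with `φ j` converging to the identity, contradicting
`tendsto_integral`. -/
theorem riemannSumsTendTo {p q : ℝ} (hp : 1 ≤ p) (hq : 1 ≤ q)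
    (hpq : 1 < 1 / p + 1 / q) (hω : pVar p ω < ∞) {ρ : I → ℝ} (hρ : pVar q ρ < ∞)
    (hN : ∀ u, ¬ ContinuousAt ρ u → ∀ x y, K.tm x = u → K.tm y = u → K.toTree x = K.toTree y) :
    RiemannSumsTendTo ρ ω (D.integral ((Ioc 0 1).indicator ρ)) := by
  by_contra hcon
  unfold RiemannSumsTendTo at hcon
  push Not at hcon
  obtain ⟨ε, hε, hcon⟩ := hcon
  choose n t s ht hs hη hbad using fun j : ℕ => hcon (1 / ((j : ℝ) + 1)) (by positivity)
  choose φ h1 h2 h3 using fun j => exists_tag_function (ht j) (hs j) (hη j)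
  have hlim := K.tendsto_integral hp hq hpq hω hρ hN h1 fun u => by
    rw [tendsto_iff_dist_tendsto_zero]
    exact squeeze_zero (fun _ => dist_nonneg) (fun j => (h2 j u).le)
      tendsto_one_div_add_atTop_nhds_zero_nat
  rw [Metric.tendsto_atTop] at hlim
  obtain ⟨N, hN'⟩ := hlim ε hε
  have := hN' N le_rfl
  rw [h3, K.integral_increment_sum (ht N).1 fun i => ρ (s N i), Real.dist_eq] at this
  exact this.not_ge (hbad N)

end Chart

end Coding

end PathTree

end

/-! ### Chasles relation, indefinite integral and the general theorem -/

noncomputable section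

namespace PathTree

namespace Coding

variable {D : Coding}

theorem indicator_Ioc_add {s t u : I} (hst : s ≤ t) (htu : t ≤ u) (ρ : I → ℝ) :
    (Ioc s u).indicator ρ = fun x => (Ioc s t).indicator ρ x + (Ioc t u).indicator ρ x := by
  rw [← Ioc_union_Ioc_eq_Ioc hst htu, indicator_union_of_disjoint]
  exact Ioc_disjoint_Ioc_of_le le_rfl

theorem integralOn_add {ρ : I → ℝ} {s t u : I} (hst : s ≤ t) (htu : t ≤ u)
    (h1 : Integrable (D.increment ((Ioc s t).indicator ρ)) D.length)
    (h2 : Integrable (D.increment ((Ioc t u).indicator ρ)) D.length) :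
    D.integralOn ρ s t + D.integralOn ρ t u = D.integralOn ρ s u := by
  unfold integralOn integral
  rw [indicator_Ioc_add hst htu, ← integral_add h1 h2]
  simp_rw [increment_add]

namespace Chart

variable {ω : I → ℝ} {X : Type*} [ConditionallyCompleteLinearOrder X]
  [BoundedOrder X] [TopologicalSpace X] [OrderTopology X] [DenselyOrdered X] (K : D.Chart ω X)

include K in
-- Each increment is bounded by the window estimate with the local variation of the level and the
-- global quantity `Q` for `ρ`; the local variations add up by superadditivity.
theorem pVar_integralOn_le {p q : ℝ} (hp : 1 ≤ p) (hq : 1 ≤ q)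
    (hpq : 1 < 1 / p + 1 / q) {ρ : I → ℝ}
    (hint : ∀ s t : I, s ≤ t → Integrable (D.increment ((Ioc s t).indicator ρ)) D.length) :
    pVar p (fun t => D.integralOn ρ 0 t) ^ (1 / p) ≤
      youngConst p q * pVar p ω ^ (1 / p) * (pVar q ρ ^ (1 / q) + supAbs ρ) := by
  have hp0 : 0 < p := by linarith
  set Q := pVar q ρ ^ (1 / q) + supAbs ρ
  have key : pVar p (fun t => D.integralOn ρ 0 t) ≤
      (youngConst p q * Q) ^ p * pVar p ω := by
    refine iSup_le fun n => iSup_le fun t => iSup_le fun ht => ?_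
    refine le_trans ?_ (mul_le_mul_right ((chainVar_mono (subset_univ
      (Icc (K.lastAt (t 0)) (K.lastAt (t n))))).trans (K.chainVar_le p hp)) _)
    refine le_trans ?_ (mul_le_mul_right
      (sum_chainVar_Icc_le (g := K.lev) (K.lastAt_mono.comp ht.1) n) _)
    rw [Finset.mul_sum]
    refine Finset.sum_le_sum fun i _ => ?_
    have hi : t i ≤ t (i + 1) := ht.1 (Nat.le_succ i)
    dsimp only
    rw [← integralOn_add unitInterval.nonneg' hi (hint _ _ unitInterval.nonneg') (hint _ _ hi),
      add_sub_cancel_left]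
    have h1 := (enorm_integral_le_lintegral_enorm _).trans
      (K.lintegral_increment_indicator_le hp hq hpq hi ρ)
    refine (ENNReal.rpow_le_rpow h1 hp0.le).trans_eq ?_
    rw [mul_right_comm, ENNReal.mul_rpow_of_nonneg _ _ hp0.le, ← ENNReal.rpow_mul,
      one_div_mul_cancel hp0.ne', ENNReal.rpow_one]
    rfl
  refine (ENNReal.rpow_le_rpow key (by positivity)).trans_eq ?_
  rw [ENNReal.mul_rpow_of_nonneg _ _ (by positivity), ← ENNReal.rpow_mul,
    mul_one_div_cancel hp0.ne', ENNReal.rpow_one, mul_right_comm]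

theorem young {p q : ℝ} (hp : 1 ≤ p) (hq : 1 ≤ q) (hpq : 1 < 1 / p + 1 / q) (ρ : I → ℝ)
    (hN : ∀ u, ¬ ContinuousAt ρ u → ∀ x y, K.tm x = u → K.tm y = u → K.toTree x = K.toTree y) :
    (∀ μ : Measure D.Tree, IsLengthMeasure D.root μ ↔ μ = D.length) ∧
    ∫⁻ τ, ‖D.increment ρ τ‖ₑ ∂D.length ≤
      youngConst p q * pVar p ω ^ (1 / p) * (pVar q ρ ^ (1 / q) + supAbs ρ) ∧
    (1 < (varIndex ω)⁻¹ + (varIndex ρ)⁻¹ →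
      Integrable (D.increment ρ) D.length ∧
      ‖D.integral ρ‖ₑ ≤
        youngConst p q * pVar p ω ^ (1 / p) * (pVar q ρ ^ (1 / q) + supAbs ρ) ∧
      RiemannSumsTendTo ρ ω (D.integral ρ) ∧
      (∀ s t : I, s ≤ t → Integrable (D.increment ((Ioc s t).indicator ρ)) D.length) ∧
      D.integralOn ρ 0 1 = D.integral ρ ∧
      (∀ s t u : I, s ≤ t → t ≤ u →
        D.integralOn ρ s t + D.integralOn ρ t u = D.integralOn ρ s u) ∧
      pVar p (fun t => D.integralOn ρ 0 t) ^ (1 / p) ≤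
        youngConst p q * pVar p ω ^ (1 / p) * (pVar q ρ ^ (1 / q) + supAbs ρ)) := by
  have := K.secondCountable_tree
  have hae := K.ae_increment_indicator_Ioc ρ
  have hest : ∫⁻ τ, ‖D.increment ρ τ‖ₑ ∂D.length ≤
      youngConst p q * pVar p ω ^ (1 / p) * (pVar q ρ ^ (1 / q) + supAbs ρ) := by
    have h : ∫⁻ τ, ‖D.increment ((Ioc 0 1).indicator ρ) τ‖ₑ ∂D.length =
        ∫⁻ τ, ‖D.increment ρ τ‖ₑ ∂D.length := lintegral_congr_ae (hae.fun_comp (‖·‖ₑ))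
    rw [← h]
    refine (K.lintegral_increment_indicator_le hp hq hpq unitInterval.nonneg' ρ).trans ?_
    gcongr
    exact (chainVar_mono (subset_univ _)).trans (K.chainVar_le p hp)
  refine ⟨K.isRealTree.isLengthMeasure_iff D.root, hest, fun h => ?_⟩
  -- Existence and convergence use exponents adapted to `ω` and `ρ`; the estimates keep the given
  -- `p`, `q`, for which the variations may be infinite.
  obtain ⟨p', q', hp', hq', hpq', hω, hρ⟩ := exists_exponents h
  have hint := fun s t (hst : s ≤ t) =>
    K.integrable_increment_indicator hp' hq' hpq' hω hρ hst
  have heq : D.integralOn ρ 0 1 = D.integral ρ := integral_congr_ae hae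
  refine ⟨(hint 0 1 unitInterval.nonneg').congr hae,
    (enorm_integral_le_lintegral_enorm _).trans hest, ?_, hint, heq,
    fun s t u hst htu => integralOn_add hst htu (hint _ _ hst) (hint _ _ htu),
    K.pVar_integralOn_le hp hq hpq hint⟩
  rw [← heq]
  exact K.riemannSumsTendTo hp' hq' hpq' hω hρ hN

end Chart

end Coding

/-- The chart of the coding of a continuous path. -/
def continuousChart (ω : C(I, ℝ)) : (ofContinuous ω).Chart ω I where
  pt := fun t => t
  lastAt := fun s => s
  surj := fun t => ⟨t, rfl⟩
  cont := ω.continuous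
  dist_eq := fun x y h => by
    change contDist ω x y = _
    rw [contDist, uIcc_of_le h]; rfl
  time_mono := fun _ _ h => h
  time_le_iff := fun _ _ => Iff.rfl
  time_lastAt := fun _ => rfl
  level_lastAt := fun _ => rfl
  pt_of_le := fun x hx => le_antisymm (α := I) hx unitInterval.nonneg'
  pt_top := rfl
  chainVar_le := fun _ _ => chainVar_le_pVar

end PathTree

end

noncomputable section

namespace PathTree

/-! ### The time line of a càdlàg path with its jumps filled in -/

/-- The lexicographic square: each time is replaced by an interval. -/
def JumpLine : Type := I ×ₗ I

namespace JumpLine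

instance : LinearOrder JumpLine := inferInstanceAs (LinearOrder (I ×ₗ I))

instance : BoundedOrder JumpLine := inferInstanceAs (BoundedOrder (I ×ₗ I))

instance : DenselyOrdered JumpLine := inferInstanceAs (DenselyOrdered (I ×ₗ I))

/-- The point of the jump at time `t` with parameter `θ`. -/
def mk (t θ : I) : JumpLine := toLex (t, θ)

/-- The time of a point. -/
def time (x : JumpLine) : I := (ofLex x).1

/-- The position of a point in the jump. -/
def pos (x : JumpLine) : I := (ofLex x).2

@[simp] theorem time_mk (t θ : I) : (mk t θ).time = t := rfl

@[simp] theorem pos_mk (t θ : I) : (mk t θ).pos = θ := rfl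

theorem mk_eta (x : JumpLine) : mk x.time x.pos = x := rfl

theorem le_iff {x y : JumpLine} :
    x ≤ y ↔ x.time < y.time ∨ x.time = y.time ∧ x.pos ≤ y.pos := Prod.Lex.le_iff

theorem lt_iff {x y : JumpLine} :
    x < y ↔ x.time < y.time ∨ x.time = y.time ∧ x.pos < y.pos := Prod.Lex.lt_iff

theorem time_mono {x y : JumpLine} (h : x ≤ y) : x.time ≤ y.time :=
  (le_iff.1 h).elim le_of_lt fun h => h.1.le

/-- Take the supremum `u` of the times. If it is attained in `s`, take the supremum of the positions
at time `u`; otherwise the least point at time `u` is the bound. -/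
theorem exists_isLUB (s : Set JumpLine) : ∃ x, IsLUB s x := by
  set u := sSup (time '' s) with hu
  have hle : ∀ x ∈ s, x.time ≤ u := fun x hx => le_sSup (mem_image_of_mem _ hx)
  have hb : ∀ b ∈ upperBounds s, u ≤ b.time := fun b hb => sSup_le (by
    rintro _ ⟨x, hx, rfl⟩; exact time_mono (hb hx))
  by_cases h : ∃ x ∈ s, x.time = u
  · refine ⟨mk u (sSup {θ | mk u θ ∈ s}), fun x hx => ?_, fun b hbs => ?_⟩
    · rw [le_iff]
      rcases (hle x hx).eq_or_lt with h' | h'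
      · refine Or.inr ⟨h', le_sSup ?_⟩
        change mk u x.pos ∈ s
        rw [← h']; exact hx
      · exact Or.inl h'
    · rw [le_iff]
      rcases (hb b hbs).eq_or_lt with h' | h'
      · refine Or.inr ⟨h', sSup_le fun θ hθ => ?_⟩
        have h2 := le_iff.1 (hbs hθ)
        rw [time_mk, h'] at h2
        exact (h2.resolve_left (lt_irrefl _)).2
      · exact Or.inl h'
  · refine ⟨mk u 0, fun x hx => ?_, fun b hbs => ?_⟩
    · exact le_iff.2 (Or.inl (lt_of_le_of_ne (hle x hx) fun h' => h ⟨x, hx, h'⟩))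
    · exact le_iff.2 ((hb b hbs).lt_or_eq.imp_right fun h' => ⟨h', unitInterval.nonneg'⟩)

instance : SupSet JumpLine := ⟨fun s => (exists_isLUB s).choose⟩

instance : ConditionallyCompleteLinearOrder JumpLine :=
  { (inferInstance : LinearOrder JumpLine),
    conditionallyCompleteLatticeOfLatticeOfsSup JumpLine fun s _ _ =>
      (exists_isLUB s).choose_spec with
    csSup_of_not_bddAbove := fun s h => (h (OrderTop.bddAbove s)).elim
    csInf_of_not_bddBelow := fun s h => (h (OrderBot.bddBelow s)).elim }

instance : TopologicalSpace JumpLine := Preorder.topology JumpLine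

instance : OrderTopology JumpLine := ⟨rfl⟩

end JumpLine

/-! ### Filling the jumps continuously -/

namespace CadlagPath

variable (ω : CadlagPath)

theorem tendsto_leftLim (t : I) : Tendsto ω (𝓝[<] t) (𝓝 (Function.leftLim ω t)) := by
  obtain ⟨l, hl⟩ := ω.left_lim t
  exact tendsto_leftLim_of_tendsto ⟨l, hl⟩

theorem leftLim_zero : Function.leftLim ω 0 = ω 0 :=
  leftLim_eq_of_isBot fun _ => unitInterval.nonneg'

theorem leftLim_mem {C : Set ℝ} (hC : IsClosed C) {s t : I} (hst : s < t)
    (h : ∀ u ∈ Ioo s t, ω u ∈ C) : Function.leftLim ω t ∈ C := by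
  have : (𝓝[<] t).NeBot := nhdsLT_neBot_of_exists_lt ⟨s, hst⟩
  exact hC.mem_of_tendsto (ω.tendsto_leftLim t) (by
    filter_upwards [Ioo_mem_nhdsLT hst] with u hu using h u hu)

/-- The level of a point of the jump line. -/
def jumpLevel (x : JumpLine) : ℝ :=
  (1 - x.pos) * Function.leftLim ω x.time + x.pos * ω x.time

theorem jumpLevel_mem {C : Set ℝ} (hC : Convex ℝ C) {x : JumpLine}
    (h1 : Function.leftLim ω x.time ∈ C) (h2 : ω x.time ∈ C) : ω.jumpLevel x ∈ C :=
  hC h1 h2 (by linarith [x.pos.2.2]) x.pos.2.1 (by ring)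

theorem jumpLevel_mem_uIcc (x : JumpLine) :
    ω.jumpLevel x ∈ uIcc (Function.leftLim ω x.time) (ω x.time) :=
  ω.jumpLevel_mem (convex_uIcc _ _) left_mem_uIcc right_mem_uIcc

@[simp] theorem jumpLevel_mk_one (t : I) : ω.jumpLevel (.mk t 1) = ω t := by simp [jumpLevel]

@[simp] theorem jumpLevel_mk_zero (t : I) :
    ω.jumpLevel (.mk t 0) = Function.leftLim ω t := by simp [jumpLevel]

theorem continuous_jumpLevel_mk (t : I) : Continuous fun θ => ω.jumpLevel (.mk t θ) := by
  unfold jumpLevel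
  simp only [JumpLine.time_mk, JumpLine.pos_mk]
  fun_prop

/-- Inside a jump the level is affine. To the left of position `0` the left limit is used, and to
the right of position `1` right continuity. Closed balls serve as neighbourhoods because, being
closed and convex, they contain the left limits and the interpolated values at the nearby times. -/
theorem continuous_jumpLevel : Continuous ω.jumpLevel := by
  rw [continuous_iff_continuousAt]
  intro x
  rw [continuousAt_iff_continuous_left_right]
  constructor
  · rw [ContinuousWithinAt, (Metric.nhds_basis_closedBall).tendsto_right_iff]
    intro ε hε
    rcases (unitInterval.nonneg' (t := x.pos)).eq_or_lt with h0 | h0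
    · rcases (unitInterval.nonneg' (t := x.time)).eq_or_lt with h1 | h1
      · have : Iic x = {x} := by
          rw [← JumpLine.mk_eta x, ← h0, ← h1]; exact Iic_bot
        rw [this, nhdsWithin_singleton, eventually_pure]
        exact Metric.mem_closedBall_self hε.le
      · have hx : ω.jumpLevel x = Function.leftLim ω x.time := by
          rw [← JumpLine.mk_eta x, ← h0, jumpLevel_mk_zero]; rfl
        have h2 := (ω.tendsto_leftLim x.time).eventually (Metric.closedBall_mem_nhds _ hε)
        obtain ⟨s, hs, hsub⟩ := (mem_nhdsLT_iff_exists_Ioo_subset' h1).1 h2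
        have hlt : JumpLine.mk s 1 < x := JumpLine.lt_iff.2 (Or.inl hs)
        filter_upwards [Ioc_mem_nhdsLE hlt] with y hy
        rw [hx]
        have hy1 : s < y.time := (JumpLine.lt_iff.1 hy.1).resolve_right
          fun h => h.2.not_ge unitInterval.le_one'
        rcases JumpLine.le_iff.1 hy.2 with h | h
        · exact ω.jumpLevel_mem (convex_closedBall _ _) (ω.leftLim_mem Metric.isClosed_closedBall
            hy1 fun u hu => hsub ⟨hu.1, hu.2.trans h⟩) (hsub ⟨hy1, h⟩)
        · have : y = x := by
            rw [← JumpLine.mk_eta x, ← JumpLine.mk_eta y, h.1, ← h0,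
              le_antisymm (h.2.trans h0.ge) unitInterval.nonneg']
          rw [this, hx]
          exact Metric.mem_closedBall_self hε.le
    · have h2 := ((ω.continuous_jumpLevel_mk x.time).continuousAt (x := x.pos)).eventually
        (Metric.closedBall_mem_nhds _ hε)
      obtain ⟨θ, hθ, hsub⟩ := (mem_nhdsLE_iff_exists_Ioc_subset' h0).1 (mem_nhdsWithin_of_mem_nhds h2)
      have hlt : JumpLine.mk x.time θ < x := JumpLine.lt_iff.2 (Or.inr ⟨rfl, hθ⟩)
      filter_upwards [Ioc_mem_nhdsLE hlt] with y hy
      have hy1 : y.time = x.time :=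
        le_antisymm (JumpLine.time_mono hy.2) (JumpLine.time_mono hy.1.le :)
      have hy2 := (JumpLine.lt_iff.1 hy.1).resolve_left (by simp [hy1])
      have hy3 := (JumpLine.le_iff.1 hy.2).resolve_left (by simp [hy1])
      rw [← JumpLine.mk_eta y, hy1]
      exact hsub ⟨hy2.2, hy3.2⟩
  · rw [ContinuousWithinAt, (Metric.nhds_basis_closedBall).tendsto_right_iff]
    intro ε hε
    rcases (unitInterval.le_one' (t := x.pos)).eq_or_lt with h0 | h0
    · rcases (unitInterval.le_one' (t := x.time)).eq_or_lt with h1 | h1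
      · have : Ici x = {x} := by
          rw [← JumpLine.mk_eta x, h0, h1]; exact Ici_top
        rw [this, nhdsWithin_singleton, eventually_pure]
        exact Metric.mem_closedBall_self hε.le
      · have hx : ω.jumpLevel x = ω x.time := by
          rw [← JumpLine.mk_eta x, h0, jumpLevel_mk_one]; rfl
        have h2 := (ω.right_cont x.time).eventually (Metric.closedBall_mem_nhds _ hε)
        obtain ⟨s, hs, hsub⟩ := (mem_nhdsGE_iff_exists_Ico_subset' h1).1 h2
        have hlt : x < JumpLine.mk s 0 := JumpLine.lt_iff.2 (Or.inl hs)
        filter_upwards [Ico_mem_nhdsGE hlt] with y hy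
        rw [hx]
        have hy1 : y.time < s := (JumpLine.lt_iff.1 hy.2).resolve_right
          fun h => h.2.not_ge unitInterval.nonneg'
        rcases JumpLine.le_iff.1 hy.1 with h | h
        · exact ω.jumpLevel_mem (convex_closedBall _ _) (ω.leftLim_mem Metric.isClosed_closedBall
            h fun u hu => hsub ⟨hu.1.le, hu.2.trans hy1⟩) (hsub ⟨h.le, hy1⟩)
        · have : y = x := by
            rw [← JumpLine.mk_eta x, ← JumpLine.mk_eta y, h.1, h0,
              le_antisymm unitInterval.le_one' (h0.ge.trans h.2)]
          rw [this, hx]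
          exact Metric.mem_closedBall_self hε.le
    · have h2 := ((ω.continuous_jumpLevel_mk x.time).continuousAt (x := x.pos)).eventually
        (Metric.closedBall_mem_nhds _ hε)
      obtain ⟨θ, hθ, hsub⟩ := (mem_nhdsGE_iff_exists_Ico_subset' h0).1 (mem_nhdsWithin_of_mem_nhds h2)
      have hlt : x < JumpLine.mk x.time θ := JumpLine.lt_iff.2 (Or.inr ⟨rfl, hθ⟩)
      filter_upwards [Ico_mem_nhdsGE hlt] with y hy
      have hy1 : y.time = x.time :=
        le_antisymm (JumpLine.time_mono hy.2.le :) (JumpLine.time_mono hy.1)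
      have hy2 := (JumpLine.lt_iff.1 hy.2).resolve_left (by simp [hy1])
      have hy3 := (JumpLine.le_iff.1 hy.1).resolve_left (by simp [hy1])
      rw [← JumpLine.mk_eta y, hy1]
      exact hsub ⟨hy3.2, hy2.2⟩

/-- The point of the graph associated with a point of the jump line. -/
def graphPt (x : JumpLine) : ω.Graph := ⟨(x.time, ω.jumpLevel x), ω.jumpLevel_mem_uIcc x⟩

theorem graphPt_surjective : Function.Surjective ω.graphPt := by
  rintro ⟨⟨t, y⟩, hy⟩
  rw [← segment_eq_uIcc] at hy
  obtain ⟨a, b, ha, hb, hab, hy⟩ := hy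
  refine ⟨.mk t ⟨b, hb, by linarith⟩, ?_⟩
  refine Subtype.ext (Prod.ext rfl ?_)
  simp only [graphPt, jumpLevel, JumpLine.time_mk, JumpLine.pos_mk]
  rw [← hab]; simp only [smul_eq_mul] at hy; rw [← hy]; ring

theorem le_jumpLevel_of_right {x z : JumpLine} (ht : x.time = z.time) (hp : x.pos ≤ z.pos) {c : ℝ}
    (h1 : c ≤ ω.jumpLevel x) (h2 : c ≤ ω x.time) : c ≤ ω.jumpLevel z := by
  unfold jumpLevel at *
  rw [← ht]
  have hp' : (x.pos : ℝ) ≤ z.pos := hp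
  have hz := z.pos.2.2
  rcases le_total (Function.leftLim ω x.time) (ω x.time) with h | h <;> nlinarith

theorem le_jumpLevel_of_left {z y : JumpLine} (ht : z.time = y.time) (hp : z.pos ≤ y.pos) {c : ℝ}
    (h1 : c ≤ ω.jumpLevel y) (h2 : c ≤ Function.leftLim ω y.time) : c ≤ ω.jumpLevel z := by
  unfold jumpLevel at *
  rw [ht]
  have hp' : (z.pos : ℝ) ≤ y.pos := hp
  have hz := z.pos.2.1
  rcases le_total (Function.leftLim ω y.time) (ω y.time) with h | h <;> nlinarith

/-- At intermediate times the values and left limits are above the infimum. At the end times,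
affinity of the level in the position places it between the endpoint and the value on the relevant
side of the jump. -/
theorem graphInf_le_jumpLevel {x y z : JumpLine} (hz : z ∈ Icc x y) :
    graphInf ω (ω.graphPt x) (ω.graphPt y) ≤ ω.jumpLevel z := by
  have hx := graphInf_le_left ω (ω.graphPt x) (ω.graphPt y)
  have hy := graphInf_le_right ω (ω.graphPt x) (ω.graphPt y)
  rcases (JumpLine.time_mono (hz.1.trans hz.2)).eq_or_lt with hxy | hxy
  · have h1 : x.time = z.time := le_antisymm (JumpLine.time_mono hz.1)
      ((JumpLine.time_mono hz.2).trans hxy.ge)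
    have h2 : z.time = y.time := h1.symm.trans hxy
    have h3 := ((JumpLine.le_iff.1 hz.1).resolve_left (by simp [h1])).2
    have h4 := ((JumpLine.le_iff.1 hz.2).resolve_left (by simp [h2])).2
    rcases le_total (Function.leftLim ω x.time) (ω x.time) with h | h
    · refine hx.trans ?_
      change ω.jumpLevel x ≤ _
      have h3' : (x.pos : ℝ) ≤ z.pos := h3
      unfold jumpLevel
      rw [← h1]; nlinarith
    · refine hy.trans ?_
      change ω.jumpLevel y ≤ _
      have h4' : (z.pos : ℝ) ≤ y.pos := h4
      unfold jumpLevel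
      rw [← hxy, ← h1]; nlinarith
  · have hleft : ∀ t, x.time < t → t ≤ y.time →
        graphInf ω (ω.graphPt x) (ω.graphPt y) ≤ Function.leftLim ω t := fun t h1 h2 =>
      ω.leftLim_mem (C := Ici _) isClosed_Ici h1 fun u hu =>
        graphInf_le_apply ω (z := ω.graphPt x) (w := ω.graphPt y) hu.1 (hu.2.trans_le h2)
    rcases JumpLine.le_iff.1 hz.1 with h1 | ⟨h1, h1'⟩
    · rcases JumpLine.le_iff.1 hz.2 with h2 | ⟨h2, h2'⟩
      · exact ω.jumpLevel_mem (convex_Ici _) (hleft _ h1 h2.le)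
          (graphInf_le_apply ω (z := ω.graphPt x) (w := ω.graphPt y) h1 h2)
      · exact ω.le_jumpLevel_of_left h2 h2' hy (hleft _ hxy le_rfl)
    · exact ω.le_jumpLevel_of_right h1 h1' hx
        (graphInf_le_apply_left ω (z := ω.graphPt x) (w := ω.graphPt y) hxy)

theorem sInf_jumpLevel {x y : JumpLine} (hxy : x ≤ y) :
    sInf (ω.jumpLevel '' Icc x y) = graphInf ω (ω.graphPt x) (ω.graphPt y) := by
  have hb : BddBelow (ω.jumpLevel '' Icc x y) :=
    (isCompact_Icc.image ω.continuous_jumpLevel).bddBelow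
  refine le_antisymm ?_ (le_csInf ((nonempty_Icc.2 hxy).image _) ?_)
  · have hx : sInf (ω.jumpLevel '' Icc x y) ≤ ω.jumpLevel x :=
      csInf_le hb (mem_image_of_mem _ (left_mem_Icc.2 hxy))
    have hy : sInf (ω.jumpLevel '' Icc x y) ≤ ω.jumpLevel y :=
      csInf_le hb (mem_image_of_mem _ (right_mem_Icc.2 hxy))
    unfold graphInf
    change _ ≤ if x.time = y.time then min (ω.jumpLevel x) (ω.jumpLevel y) else
      min (sInf (ω '' Ioo (min x.time y.time) (max x.time y.time)))
        (min (ω.jumpLevel x) (ω.jumpLevel y))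
    split_ifs with h
    · exact le_min hx hy
    · have hlt : x.time < y.time := lt_of_le_of_ne (JumpLine.time_mono hxy) h
      refine le_min ?_ (le_min hx hy)
      rw [min_eq_left hlt.le, max_eq_right hlt.le]
      refine le_csInf ((nonempty_Ioo.2 hlt).image _) ?_
      rintro _ ⟨u, hu, rfl⟩
      rw [← ω.jumpLevel_mk_one u]
      exact csInf_le hb (mem_image_of_mem _
        ⟨JumpLine.le_iff.2 (Or.inl hu.1), JumpLine.le_iff.2 (Or.inl hu.2)⟩)
  · rintro _ ⟨z, hz, rfl⟩
    exact ω.graphInf_le_jumpLevel hz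

end CadlagPath

end PathTree

end

/-! ### Variation of the filled path and the chart of a càdlàg path -/

noncomputable section

namespace PathTree

namespace CadlagPath

variable (ω : CadlagPath)

open Classical in
/-- The path is evaluated after or before the jump, according to whether the point is above or
below `θ`. -/
def sideValue (θ : I) (x : JumpLine) : ℝ :=
  if θ ≤ x.pos then ω x.time else Function.leftLim ω x.time

/-- For fixed `θ`, the side values are limits of values of `ω` at the times themselves or slightly
before. Along a finite chain these times are eventually ordered, so the bound passes to the limit.
-/
theorem sum_sideValue_le {p : ℝ} (θ : I) (n : ℕ) {x : ℕ → JumpLine}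
    (hx : Monotone x) :
    ∑ i ∈ Finset.range n, ‖ω.sideValue θ (x (i + 1)) - ω.sideValue θ (x i)‖ₑ ^ p ≤ pVar p ω := by
  classical
  -- a time before `t`, converging to `t`
  set b : ℕ → I → I := fun m t => projIcc 0 1 zero_le_one ((t : ℝ) - 1 / ((m : ℝ) + 1)) with hb
  have hb0 : ∀ m, b m 0 = 0 := fun m =>
    projIcc_of_le_left _ (by simp only [Set.Icc.coe_zero, zero_sub, neg_nonpos]; positivity)
  have hble : ∀ m t, b m t ≤ t := fun m t => by
    refine Subtype.coe_le_coe.1 ?_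
    rw [hb]; dsimp only
    rw [coe_projIcc]
    refine max_le t.2.1 ((min_le_right _ _).trans ?_)
    have : (0 : ℝ) ≤ 1 / ((m : ℝ) + 1) := by positivity
    linarith
  have hblt : ∀ m t, 0 < t → b m t < t := fun m t ht => by
    refine Subtype.coe_lt_coe.1 ?_
    rw [hb]; dsimp only
    rw [coe_projIcc]
    refine max_lt ht ((min_le_right _ _).trans_lt ?_)
    have : (0 : ℝ) < 1 / ((m : ℝ) + 1) := by positivity
    linarith
  have hbt : ∀ t, Tendsto (fun m => b m t) atTop (𝓝 t) := fun t => by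
    have h1 : Tendsto (fun m : ℕ => (t : ℝ) - 1 / ((m : ℝ) + 1)) atTop (𝓝 t) := by
      simpa using tendsto_const_nhds.sub (tendsto_one_div_add_atTop_nhds_zero_nat (𝕜 := ℝ))
    have h2 := (continuous_projIcc (h := zero_le_one)).continuousAt.tendsto.comp h1
    rwa [projIcc_val] at h2
  set g : ℕ → JumpLine → I := fun m y => if θ ≤ y.pos then y.time else b m y.time with hg
  have hgt : ∀ y, Tendsto (fun m => ω (g m y)) atTop (𝓝 (ω.sideValue θ y)) := fun y => by
    by_cases h : θ ≤ y.pos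
    · simp only [hg, sideValue, if_pos h]; exact tendsto_const_nhds
    · simp only [hg, sideValue, if_neg h]
      rcases (unitInterval.nonneg' (t := y.time)).eq_or_lt with h0 | h0
      · simp only [← h0, hb0, ω.leftLim_zero]; exact tendsto_const_nhds
      · exact (ω.tendsto_leftLim _).comp (tendsto_nhdsWithin_iff.2
          ⟨hbt _, Eventually.of_forall fun m => hblt m _ h0⟩)
  have hgm : ∀ y z : JumpLine, y ≤ z → ∀ᶠ m in atTop, g m y ≤ g m z := fun y z hyz => by
    have hgy : ∀ m, g m y ≤ y.time := fun m => by
      simp only [hg]; split_ifs; exacts [le_rfl, hble _ _]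
    rcases JumpLine.le_iff.1 hyz with h | ⟨h1, h2⟩
    · have : ∀ᶠ m in atTop, y.time < g m z := by
        by_cases h' : θ ≤ z.pos
        · simp only [hg, if_pos h']; exact Eventually.of_forall fun _ => h
        · simp only [hg, if_neg h']; exact (hbt z.time).eventually (lt_mem_nhds h)
      exact this.mono fun m hm => (hgy m).trans hm.le
    · refine Eventually.of_forall fun m => ?_
      by_cases h' : θ ≤ z.pos
      · simp only [hg, if_pos h', ← h1]; exact hgy m
      · have : ¬ θ ≤ y.pos := fun h => h' (h.trans h2)
        simp only [hg, if_neg h', if_neg this, h1, le_rfl]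
  have hev : ∀ᶠ m in atTop, ∀ i ∈ Finset.range n, g m (x i) ≤ g m (x (i + 1)) :=
    (Filter.eventually_all_finset _).2 fun i _ => hgm _ _ (hx (Nat.le_succ i))
  have hlim : Tendsto (fun m => ∑ i ∈ Finset.range n, ‖ω (g m (x (i + 1))) - ω (g m (x i))‖ₑ ^ p)
      atTop (𝓝 (∑ i ∈ Finset.range n,
        ‖ω.sideValue θ (x (i + 1)) - ω.sideValue θ (x i)‖ₑ ^ p)) :=
    tendsto_finsetSum _ fun i _ =>
      (ENNReal.continuous_rpow_const.tendsto _).comp ((hgt _).sub (hgt _)).enorm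
  refine le_of_tendsto hlim (hev.mono fun m hm => ?_)
  -- The order is only known for the first `n` steps, so the chain is frozen from index `n` on.
  have hmono : Monotone fun i => g m (x (min i n)) := by
    refine monotone_nat_of_le_succ fun i => ?_
    rcases lt_or_ge i n with h | h
    · rw [min_eq_left h.le, min_eq_left (Nat.succ_le_of_lt h)]
      exact hm i (Finset.mem_range.2 h)
    · rw [min_eq_right h, min_eq_right (h.trans (Nat.le_succ i))]
  refine le_trans (Finset.sum_congr rfl fun i hi => ?_).le
    ((sum_le_chainVar (s := univ) n hmono fun _ => mem_univ _).trans chainVar_le_pVar)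
  have hi := Finset.mem_range.1 hi
  rw [min_eq_left hi.le, min_eq_left (Nat.succ_le_of_lt hi)]

theorem sideValue_eq (θ : I) (x : JumpLine) : ω.sideValue θ x = Function.leftLim ω x.time +
    (Iic x.pos).indicator (fun _ => ω x.time - Function.leftLim ω x.time) θ := by
  unfold sideValue
  by_cases h : θ ≤ x.pos
  · rw [if_pos h, indicator_of_mem (mem_Iic.2 h)]; ring
  · rw [if_neg h, indicator_of_notMem (mt mem_Iic.1 h)]; ring

theorem measurable_sideValue (x : JumpLine) : Measurable fun θ => ω.sideValue θ x := by
  simp_rw [sideValue_eq]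
  exact measurable_const.add (measurable_const.indicator measurableSet_Iic)

theorem integrable_sideValue (x : JumpLine) : Integrable fun θ => ω.sideValue θ x := by
  simp_rw [sideValue_eq]
  exact (integrable_const _).add ((integrable_const _).indicator measurableSet_Iic)

/-- The thresholds `θ ≤ x.pos` have total mass `x.pos`, which is the weight of `ω x.time` in the
interpolation. -/
theorem integral_sideValue (x : JumpLine) : ∫ θ, ω.sideValue θ x = ω.jumpLevel x := by
  simp_rw [sideValue_eq]
  rw [integral_add (integrable_const _) ((integrable_const _).indicator measurableSet_Iic),
    integral_indicator_const _ measurableSet_Iic, integral_const, probReal_univ, measureReal_def,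
    unitInterval.volume_Iic, ENNReal.toReal_ofReal x.pos.2.1, jumpLevel]
  simp only [smul_eq_mul]; ring

theorem enorm_integral_rpow_le {α : Type*} [MeasurableSpace α] {μ : Measure α}
    [IsProbabilityMeasure μ] {p : ℝ} (hp : 1 ≤ p) {f : α → ℝ} (hf : AEStronglyMeasurable f μ) :
    ‖∫ x, f x ∂μ‖ₑ ^ p ≤ ∫⁻ x, ‖f x‖ₑ ^ p ∂μ := by
  have h1 := eLpNorm'_le_eLpNorm'_of_exponent_le one_pos hp μ hf
  have h2 := ENNReal.rpow_le_rpow ((enorm_integral_le_lintegral_enorm f).trans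
    (by simpa [eLpNorm'] using h1)) (by linarith : 0 ≤ p)
  rwa [← ENNReal.rpow_mul, inv_mul_cancel₀ (by linarith), ENNReal.rpow_one] at h2

/-- The filled level is the average over `θ` of the side values; by Jensen's inequality its power
sums are averages of sums already bounded by `V_p(ω)`. -/
theorem chainVar_jumpLevel_le {p : ℝ} (hp : 1 ≤ p) :
    chainVar p ω.jumpLevel univ ≤ pVar p ω := by
  refine chainVar_le fun n x hx _ => ?_
  calc ∑ i ∈ Finset.range n, ‖ω.jumpLevel (x (i + 1)) - ω.jumpLevel (x i)‖ₑ ^ p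
      ≤ ∑ i ∈ Finset.range n,
          ∫⁻ θ, ‖ω.sideValue θ (x (i + 1)) - ω.sideValue θ (x i)‖ₑ ^ p := by
        refine Finset.sum_le_sum fun i _ => ?_
        rw [← integral_sideValue, ← integral_sideValue,
          ← integral_sub (ω.integrable_sideValue _) (ω.integrable_sideValue _)]
        exact enorm_integral_rpow_le hp
          ((ω.integrable_sideValue _).sub (ω.integrable_sideValue _)).aestronglyMeasurable
    _ = ∫⁻ θ, ∑ i ∈ Finset.range n,
          ‖ω.sideValue θ (x (i + 1)) - ω.sideValue θ (x i)‖ₑ ^ p := by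
        rw [lintegral_finsetSum]
        exact fun i _ => ((ω.measurable_sideValue _).sub
          (ω.measurable_sideValue _)).enorm.pow_const p
    _ ≤ ∫⁻ _ : I, pVar p ω := lintegral_mono fun θ => ω.sum_sideValue_le θ n hx
    _ = pVar p ω := by simp

theorem graphPt_of_continuousAt {x : JumpLine} (h : ContinuousAt ω x.time) :
    ω.graphPt x = ⟨(x.time, ω x.time), right_mem_uIcc⟩ := by
  refine Subtype.ext (Prod.ext rfl ?_)
  simp only [graphPt, jumpLevel, h.continuousWithinAt.leftLim_eq]; ring

/-- The chart of the coding of a càdlàg path. -/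
def chart : (ofCadlag ω).Chart ω JumpLine where
  pt := ω.graphPt
  lastAt := fun s => .mk s 1
  surj := ω.graphPt_surjective
  cont := ω.continuous_jumpLevel
  dist_eq := fun x y h => by
    change graphDist ω (ω.graphPt x) (ω.graphPt y) = _
    rw [graphDist_eq]
    change _ = _ - 2 * sInf (ω.jumpLevel '' Icc x y)
    rw [ω.sInf_jumpLevel h]; rfl
  time_mono := fun _ _ h => JumpLine.time_mono h
  time_le_iff := fun x s => by
    rw [JumpLine.le_iff, le_iff_lt_or_eq]
    exact or_congr Iff.rfl (and_iff_left unitInterval.le_one').symm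
  time_lastAt := fun _ => rfl
  level_lastAt := ω.jumpLevel_mk_one
  pt_of_le := fun x hx => by
    have h0 : x.time = 0 := le_antisymm (JumpLine.time_mono hx) unitInterval.nonneg'
    refine Subtype.ext (Prod.ext h0 ?_)
    change ω.jumpLevel x = ω 0
    rw [jumpLevel, h0, ω.leftLim_zero]; ring
  pt_top := Subtype.ext (Prod.ext rfl (ω.jumpLevel_mk_one 1))
  chainVar_le := fun _ hp => ω.chainVar_jumpLevel_le hp

end CadlagPath

end PathTree

end

/-! ### The theorem for continuous and càdlàg paths -/

theorem mainTheorem3 (p q : ℝ) (hp : 1 ≤ p) (hq : 1 ≤ q) (hpq : 1 < 1 / p + 1 / q) :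
    ∃ C : ℝ≥0,
      -- continuous paths
      (∀ (ω : C(I, ℝ)) (ρ : I → ℝ),
        -- the length measure is the one of the tree
        (∀ μ : Measure (PathTree.ofContinuous ω).Tree,
          PathTree.IsLengthMeasure (PathTree.ofContinuous ω).root μ ↔
            μ = (PathTree.ofContinuous ω).length) ∧
        -- the basic estimate
        ∫⁻ τ, ‖(PathTree.ofContinuous ω).increment ρ τ‖ₑ ∂(PathTree.ofContinuous ω).length ≤
          C * PathTree.pVar p ω ^ (1 / p) *
            (PathTree.pVar q ρ ^ (1 / q) + PathTree.supAbs ρ) ∧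
        (1 < (PathTree.varIndex ω)⁻¹ + (PathTree.varIndex ρ)⁻¹ →
          -- existence of the tree integral
          Integrable ((PathTree.ofContinuous ω).increment ρ) (PathTree.ofContinuous ω).length ∧
          -- the Young estimate
          ‖(PathTree.ofContinuous ω).integral ρ‖ₑ ≤
            C * PathTree.pVar p ω ^ (1 / p) *
              (PathTree.pVar q ρ ^ (1 / q) + PathTree.supAbs ρ) ∧
          -- it is the limit of Riemann sums
          PathTree.RiemannSumsTendTo ρ ω ((PathTree.ofContinuous ω).integral ρ) ∧
          -- integrals on subintervals exist and satisfy the Chasles relation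
          (∀ s t : I, s ≤ t →
            Integrable ((PathTree.ofContinuous ω).increment ((Ioc s t).indicator ρ))
              (PathTree.ofContinuous ω).length) ∧
          (PathTree.ofContinuous ω).integralOn ρ 0 1 = (PathTree.ofContinuous ω).integral ρ ∧
          (∀ s t u : I, s ≤ t → t ≤ u →
            (PathTree.ofContinuous ω).integralOn ρ s t +
              (PathTree.ofContinuous ω).integralOn ρ t u =
                (PathTree.ofContinuous ω).integralOn ρ s u) ∧
          -- variation of the indefinite integral
          PathTree.pVar p (fun t => (PathTree.ofContinuous ω).integralOn ρ 0 t) ^ (1 / p) ≤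
            C * PathTree.pVar p ω ^ (1 / p) *
              (PathTree.pVar q ρ ^ (1 / q) + PathTree.supAbs ρ))) ∧
      -- càdlàg paths
      (∀ (ω : PathTree.CadlagPath) (ρ : I → ℝ),
        (∀ t, ¬ ContinuousAt ω t → ContinuousAt ρ t) →
        (∀ μ : Measure (PathTree.ofCadlag ω).Tree,
          PathTree.IsLengthMeasure (PathTree.ofCadlag ω).root μ ↔
            μ = (PathTree.ofCadlag ω).length) ∧
        ∫⁻ τ, ‖(PathTree.ofCadlag ω).increment ρ τ‖ₑ ∂(PathTree.ofCadlag ω).length ≤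
          C * PathTree.pVar p ω ^ (1 / p) *
            (PathTree.pVar q ρ ^ (1 / q) + PathTree.supAbs ρ) ∧
        (1 < (PathTree.varIndex ω)⁻¹ + (PathTree.varIndex ρ)⁻¹ →
          Integrable ((PathTree.ofCadlag ω).increment ρ) (PathTree.ofCadlag ω).length ∧
          ‖(PathTree.ofCadlag ω).integral ρ‖ₑ ≤
            C * PathTree.pVar p ω ^ (1 / p) *
              (PathTree.pVar q ρ ^ (1 / q) + PathTree.supAbs ρ) ∧
          PathTree.RiemannSumsTendTo ρ ω ((PathTree.ofCadlag ω).integral ρ) ∧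
          (∀ s t : I, s ≤ t →
            Integrable ((PathTree.ofCadlag ω).increment ((Ioc s t).indicator ρ))
              (PathTree.ofCadlag ω).length) ∧
          (PathTree.ofCadlag ω).integralOn ρ 0 1 = (PathTree.ofCadlag ω).integral ρ ∧
          (∀ s t u : I, s ≤ t → t ≤ u →
            (PathTree.ofCadlag ω).integralOn ρ s t + (PathTree.ofCadlag ω).integralOn ρ t u =
              (PathTree.ofCadlag ω).integralOn ρ s u) ∧
          PathTree.pVar p (fun t => (PathTree.ofCadlag ω).integralOn ρ 0 t) ^ (1 / p) ≤
            C * PathTree.pVar p ω ^ (1 / p) *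
              (PathTree.pVar q ρ ^ (1 / q) + PathTree.supAbs ρ))) := by
  refine ⟨PathTree.Coding.Chart.youngConst p q, fun ω ρ => ?_, fun ω ρ h => ?_⟩
  · exact (PathTree.continuousChart ω).young hp hq hpq ρ fun u _ x y hx hy => by
      -- In this chart a point is its own time, so no condition on `ρ` is needed.
      have hxy : x = y := hx.trans hy.symm
      rw [hxy]
  · refine ω.chart.young hp hq hpq ρ fun u hu x y hx hy => ?_
    -- At a discontinuity of `ρ` the path does not jump, so all the chart points at that time give
    -- the same point of the graph.
    have hc : ContinuousAt ω u := by_contra fun hc => hu (h u hc)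
    have hxt : x.time = u := hx
    have hyt : y.time = u := hy
    change (PathTree.ofCadlag ω).proj (ω.graphPt x) = (PathTree.ofCadlag ω).proj (ω.graphPt y)
    rw [ω.graphPt_of_continuousAt (hxt ▸ hc), ω.graphPt_of_continuousAt (hyt ▸ hc)]
    congr 3 <;> rw [hxt, hyt]
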